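/- Let $N\ge 1$, $0<\sigma<1$, and let $\Omega\subset\mathbb{R}^N$ be a bounded open set (no regularity of $\partial\Omega$ is needed; in particular $\Omega$ may be a bounded domain with Lipschitz boundary). For $u\in L^2(\mathbb{R}^N)$ vanishing outside $\Omega$ let $$I_{1-\sigma}u(x)=\gamma_{N,1-\sigma}\int_{\mathbb{R}^N}\frac{u(y)}{|x-y|^{N-1+\sigma}}\,dy,\qquad \gamma_{N,\alpha}=\frac{\Gamma(\frac{N-\alpha}{2})}{\pi^{N/2}\,2^{\alpha}\,\Gamma(\frac{\alpha}{2})},$$ and let $D^\sigma u=D(I_{1-\sigma}u)$ be its distributional Riesz fractional gradient. Let $H^\sigma_0(\Omega)$ be the closure of $\mathscr{C}^\infty_c(\Omega)$ (functions extended by zero to $\mathbb{R}^N$) for the norm $(\|u\|_{L^2(\mathbb{R}^N)}^2+\|D^\sigma u\|_{L^2(\mathbb{R}^N)^N}^2)^{1/2}$, equipped with the equivalent norm $\|u\|_{H^\sigma_0(\Omega)}=\|D^\sigma u\|_{L^2(\mathbb{R}^N)^N}$. Let $A:\mathbb{R}^N\to\mathbb{R}^{N\times N}$ be measurable, not necessarily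 symmetric, such that for some constants $a_*,a^*>0$, for a.e. $x\in\mathbb{R}^N$ and all $\xi,\eta\in\mathbb{R}^N$, $a_*|\xi|^2\le A(x)\xi\cdot\xi$ and $A(x)\xi\cdot\eta\le a^*|\xi||\eta|$. Let $\nu>0$ and let $g\in L^\infty(\mathbb{R}^N)$ satisfy $g\ge\nu$ a.e. in $\mathbb{R}^N$. Let $f\in L^{2^\#}(\Omega)$, where $2^\#=\frac{2N}{N+2\sigma}$ if $\sigma<\frac N2$; $2^\#=\frac{q}{q-1}$ with an arbitrary fixed $q\in(1,\infty)$ if $\sigma=\frac N2$ (so $N=1$, $\sigma=\frac12$); and $2^\#=1$ if $\sigma>\frac N2$ (so $N=1$, $\sigma>\frac12$). For $0<\varepsilon<1$ define $k_\varepsilon:\mathbb{R}\to\mathbb{R}$ by $k_\varepsilon(s)=0$ for $s<0$, $k_\varepsilon(s)=e^{s/\varepsilon}-1$ for $0\le s\le\frac1\varepsilon$, and $k_\varepsilon(s)=e^{1/\varepsilon^2}-1$ for $s>\frac1\varepsilon$. Then, for every $\varepsilon\in(0,1)$, there is a unique $u^\varepsilon\in H^\sigma_0(\Omega)$ such that $$\int_{\mathbb{R}^N}\big(k_\varepsilon(|D^\sigma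 u^\varepsilon|-g)\,D^\sigma u^\varepsilon+A D^\sigma u^\varepsilon\big)\cdot D^\sigma v=\int_\Omega f v\qquad\forall v\in H^\sigma_0(\Omega);$$ there is a unique $u\in\mathbb{K}_g^\sigma=\{v\in H^\sigma_0(\Omega):|D^\sigma v|\le g\text{ a.e. in }\mathbb{R}^N\}$ such that $$\int_{\mathbb{R}^N}A D^\sigma u\cdot D^\sigma(v-u)\ge\int_\Omega f(v-u)\qquad\forall v\in\mathbb{K}_g^\sigma$$ (the products $fv$ and $f(v-u)$ being integrable on $\Omega$); and $u^\varepsilon\rightharpoonup u$ weakly in $H^\sigma_0(\Omega)$ as $\varepsilon\to0^+$. -/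

import Mathlib

open MeasureTheory Set Filter Topology
open scoped ENNReal ContDiff

noncomputable section

/-- The normalising constant `γ_{N,α} = Γ((N-α)/2) / (π^{N/2} 2^α Γ(α/2))` of the Riesz kernel. -/
def rieszConst (N : ℕ) (α : ℝ) : ℝ :=
  Real.Gamma (((N : ℝ) - α) / 2) / (Real.pi ^ ((N : ℝ) / 2) * 2 ^ α * Real.Gamma (α / 2))

/-- The Riesz potential `I_α u (x) = γ_{N,α} ∫ u(y) / |x-y|^{N-α} dy`. -/
def rieszPotential {N : ℕ} (α : ℝ) (u : EuclideanSpace ℝ (Fin N) → ℝ)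
    (x : EuclideanSpace ℝ (Fin N)) : ℝ :=
  rieszConst N α * ∫ y, u y / ‖x - y‖ ^ ((N : ℝ) - α)

/-- `G` is the distributional Riesz fractional gradient `D^σ u = D (I_{1-σ} u)`: the Riesz potential
`I_{1-σ} u` is a well-defined locally integrable function, and its distributional partial
derivatives are the components of the locally integrable field `G`. -/
structure HasSigmaGradient {N : ℕ} (σ : ℝ) (u : EuclideanSpace ℝ (Fin N) → ℝ)
    (G : EuclideanSpace ℝ (Fin N) → EuclideanSpace ℝ (Fin N)) : Prop where
  integrable_kernel : ∀ᵐ x : EuclideanSpace ℝ (Fin N),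
    Integrable (fun y => u y / ‖x - y‖ ^ ((N : ℝ) - (1 - σ)))
  locallyIntegrable_potential : LocallyIntegrable (rieszPotential (1 - σ) u)
  locallyIntegrable_gradient : LocallyIntegrable G
  integral_eq : ∀ φ : EuclideanSpace ℝ (Fin N) → ℝ, ContDiff ℝ ∞ φ → HasCompactSupport φ →
    ∀ j : Fin N, ∫ x, G x j * φ x =
      -∫ x, rieszPotential (1 - σ) u x * fderiv ℝ φ x (EuclideanSpace.single j 1)

section Auxiliary

variable {N : ℕ} {σ : ℝ} {u v : EuclideanSpace ℝ (Fin N) → ℝ}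
  {G H : EuclideanSpace ℝ (Fin N) → EuclideanSpace ℝ (Fin N)}

theorem rieszPotential_congr {α : ℝ} (h : u =ᵐ[volume] v) :
    rieszPotential α u = rieszPotential α v := by
  funext x
  unfold rieszPotential
  congr 1
  apply integral_congr_ae
  filter_upwards [h] with y hy
  rw [hy]

theorem HasSigmaGradient.congr (h : HasSigmaGradient σ u G) (huv : u =ᵐ[volume] v)
    (hGH : G =ᵐ[volume] H) : HasSigmaGradient σ v H where
  integrable_kernel := by
    filter_upwards [h.integrable_kernel] with x hx
    refine hx.congr ?_
    filter_upwards [huv] with y hy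
    rw [hy]
  locallyIntegrable_potential := by
    rw [← rieszPotential_congr huv]; exact h.locallyIntegrable_potential
  locallyIntegrable_gradient := h.locallyIntegrable_gradient.congr hGH
  integral_eq φ hφ hφc j := by
    rw [← rieszPotential_congr huv, ← h.integral_eq φ hφ hφc j]
    apply integral_congr_ae
    filter_upwards [hGH] with y hy
    rw [hy]

theorem integrable_coord_mul (hG : LocallyIntegrable G) {φ : EuclideanSpace ℝ (Fin N) → ℝ}
    (hφ : Continuous φ) (hφc : HasCompactSupport φ) (j : Fin N) :
    Integrable (fun x => G x j * φ x) := by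
  have h1 : Integrable (fun x => φ x • G x) :=
    hG.integrable_smul_left_of_hasCompactSupport hφ hφc
  have h2 := (EuclideanSpace.proj (𝕜 := ℝ) j).integrable_comp h1
  refine h2.congr (Eventually.of_forall fun x => ?_)
  simp [mul_comm]

theorem integrable_mul_fderiv {w : EuclideanSpace ℝ (Fin N) → ℝ} (hw : LocallyIntegrable w)
    {φ : EuclideanSpace ℝ (Fin N) → ℝ} (hφ : ContDiff ℝ ∞ φ) (hφc : HasCompactSupport φ)
    (e : EuclideanSpace ℝ (Fin N)) : Integrable (fun x => w x * fderiv ℝ φ x e) := by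
  have h1 : Integrable (fun x => (fderiv ℝ φ x e) • w x) :=
    hw.integrable_smul_left_of_hasCompactSupport
      ((hφ.continuous_fderiv (by simp)).clm_apply continuous_const) (hφc.fderiv_apply ℝ e)
  refine h1.congr (Eventually.of_forall fun x => ?_)
  simp [mul_comm]

theorem HasSigmaGradient.add (hu : HasSigmaGradient σ u G) (hv : HasSigmaGradient σ v H) :
    HasSigmaGradient σ (u + v) (G + H) := by
  have hpot : rieszPotential (1 - σ) u + rieszPotential (1 - σ) v =ᵐ[volume]
      rieszPotential (1 - σ) (u + v) := by
    filter_upwards [hu.integrable_kernel, hv.integrable_kernel] with x hx hy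
    simp only [rieszPotential, Pi.add_apply, add_div]
    rw [integral_add hx hy, mul_add]
  refine ⟨?_, ?_, hu.locallyIntegrable_gradient.add hv.locallyIntegrable_gradient, ?_⟩
  · filter_upwards [hu.integrable_kernel, hv.integrable_kernel] with x hx hy
    refine (hx.add hy).congr (Eventually.of_forall fun y => ?_)
    simp only [Pi.add_apply, add_div]
  · exact (hu.locallyIntegrable_potential.add hv.locallyIntegrable_potential).congr hpot
  · intro φ hφ hφc j
    have e1 : ∫ x, rieszPotential (1 - σ) (u + v) x * fderiv ℝ φ x (EuclideanSpace.single j 1) =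
        ∫ x, (rieszPotential (1 - σ) u x * fderiv ℝ φ x (EuclideanSpace.single j 1) +
          rieszPotential (1 - σ) v x * fderiv ℝ φ x (EuclideanSpace.single j 1)) := by
      apply integral_congr_ae
      filter_upwards [hpot] with x hx
      rw [← hx, Pi.add_apply, add_mul]
    rw [e1, integral_add (integrable_mul_fderiv hu.locallyIntegrable_potential hφ hφc _)
      (integrable_mul_fderiv hv.locallyIntegrable_potential hφ hφc _), neg_add,
      ← hu.integral_eq φ hφ hφc j, ← hv.integral_eq φ hφ hφc j,
      ← integral_add (integrable_coord_mul hu.locallyIntegrable_gradient hφ.continuous hφc j)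
        (integrable_coord_mul hv.locallyIntegrable_gradient hφ.continuous hφc j)]
    simp [add_mul]

theorem rieszPotential_smul (α c : ℝ) :
    rieszPotential α (c • u) = c • rieszPotential α u := by
  funext x
  simp only [rieszPotential, Pi.smul_apply, smul_eq_mul, mul_div_assoc]
  rw [integral_const_mul]
  ring

theorem HasSigmaGradient.smul (c : ℝ) (hu : HasSigmaGradient σ u G) :
    HasSigmaGradient σ (c • u) (c • G) := by
  refine ⟨?_, ?_, hu.locallyIntegrable_gradient.smul c, ?_⟩
  · filter_upwards [hu.integrable_kernel] with x hx
    simpa only [Pi.smul_apply, smul_eq_mul, mul_div_assoc] using hx.const_mul c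
  · rw [rieszPotential_smul]
    exact hu.locallyIntegrable_potential.smul c
  · intro φ hφ hφc j
    have h := hu.integral_eq φ hφ hφc j
    simp only [rieszPotential_smul, Pi.smul_apply, PiLp.smul_apply, smul_eq_mul, mul_assoc]
    rw [integral_const_mul, integral_const_mul, h, mul_neg]

theorem hasSigmaGradient_zero : HasSigmaGradient (N := N) σ 0 0 := by
  have h0 : rieszPotential (N := N) (1 - σ) 0 = 0 := by
    funext x; simp [rieszPotential]
  refine ⟨by simp, ?_, locallyIntegrable_zero, ?_⟩
  · rw [h0]; exact locallyIntegrable_zero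
  · intro φ _ _ j
    simp [h0]

theorem HasSigmaGradient.unique (hG : HasSigmaGradient σ u G) (hH : HasSigmaGradient σ u H) :
    G =ᵐ[volume] H := by
  have key : ∀ j : Fin N, ∀ᵐ x, G x j = H x j := by
    intro j
    have hloc : ∀ {F : EuclideanSpace ℝ (Fin N) → EuclideanSpace ℝ (Fin N)},
        LocallyIntegrable F → LocallyIntegrable (fun x => F x j) := by
      intro F hF x
      obtain ⟨s, hs, hsF⟩ := hF x
      exact ⟨s, hs, (EuclideanSpace.proj (𝕜 := ℝ) j).integrable_comp hsF⟩
    refine ae_eq_of_integral_contDiff_smul_eq (hloc hG.locallyIntegrable_gradient)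
      (hloc hH.locallyIntegrable_gradient) ?_
    intro φ hφ hφc
    have h := (hG.integral_eq φ hφ hφc j).trans (hH.integral_eq φ hφ hφc j).symm
    simpa only [smul_eq_mul, mul_comm] using h
  filter_upwards [ae_all_iff.2 key] with x hx
  ext j
  exact hx j

end Auxiliary

/-- The graph of `D^σ` over the smooth functions with compact support in `Ω`, inside
`L²(ℝ^N) × L²(ℝ^N)^N`. -/
def sigmaTestGraph {N : ℕ} (σ : ℝ) (Ω : Set (EuclideanSpace ℝ (Fin N))) :
    Submodule ℝ (Lp ℝ 2 (volume : Measure (EuclideanSpace ℝ (Fin N))) ×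
      Lp (EuclideanSpace ℝ (Fin N)) 2 (volume : Measure (EuclideanSpace ℝ (Fin N)))) where
  carrier := {p | ∃ φ : EuclideanSpace ℝ (Fin N) → ℝ, ContDiff ℝ ∞ φ ∧ HasCompactSupport φ ∧
    tsupport φ ⊆ Ω ∧ p.1 =ᵐ[volume] φ ∧ HasSigmaGradient σ φ p.2}
  zero_mem' := ⟨0, contDiff_const, HasCompactSupport.zero, by simp [tsupport], Lp.coeFn_zero _ _ _,
    hasSigmaGradient_zero.congr (EventuallyEq.refl _ _) (Lp.coeFn_zero _ _ _).symm⟩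
  add_mem' := by
    rintro p q ⟨φ, h1, h2, h3, h4, h5⟩ ⟨ψ, k1, k2, k3, k4, k5⟩
    refine ⟨φ + ψ, h1.add k1, h2.add k2, (tsupport_add φ ψ).trans (union_subset h3 k3),
      (Lp.coeFn_add _ _).trans (h4.add k4),
      (h5.add k5).congr (EventuallyEq.refl _ _) (Lp.coeFn_add _ _).symm⟩
  smul_mem' := by
    rintro c p ⟨φ, h1, h2, h3, h4, h5⟩
    refine ⟨c • φ, h1.const_smul c, h2.smul_left (f := fun _ => c), ?_,
      (Lp.coeFn_smul _ _).trans (h4.const_smul c),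
      (h5.smul c).congr (EventuallyEq.refl _ _) (Lp.coeFn_smul _ _).symm⟩
    exact (closure_mono (Function.support_const_smul_subset c φ)).trans h3

/-- The functions of `H^σ_0(Ω)`, extended by zero outside `Ω`: the functions `u ∈ L²(ℝ^N)` with a
`σ`-gradient in `L²(ℝ^N)^N` that are limits of functions of `C_c^∞(Ω)` with respect to the norm
`(‖u‖² + ‖D^σ u‖²)^{1/2}`. -/
def sigmaSobolevSubmodule {N : ℕ} (σ : ℝ) (Ω : Set (EuclideanSpace ℝ (Fin N))) :
    Submodule ℝ (Lp ℝ 2 (volume : Measure (EuclideanSpace ℝ (Fin N)))) where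
  carrier := {u | ∃ G : Lp (EuclideanSpace ℝ (Fin N)) 2
      (volume : Measure (EuclideanSpace ℝ (Fin N))),
    HasSigmaGradient σ u G ∧ (u, G) ∈ closure (sigmaTestGraph σ Ω : Set _)}
  zero_mem' := ⟨0, hasSigmaGradient_zero.congr (Lp.coeFn_zero _ _ _).symm
    (Lp.coeFn_zero _ _ _).symm, subset_closure (sigmaTestGraph σ Ω).zero_mem⟩
  add_mem' := by
    rintro u v ⟨G, h1, h2⟩ ⟨H, k1, k2⟩
    exact ⟨G + H, (h1.add k1).congr (Lp.coeFn_add _ _).symm (Lp.coeFn_add _ _).symm,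
      (sigmaTestGraph σ Ω).topologicalClosure.add_mem h2 k2⟩
  smul_mem' := by
    rintro c u ⟨G, h1, h2⟩
    exact ⟨c • G, (h1.smul c).congr (Lp.coeFn_smul _ _).symm (Lp.coeFn_smul _ _).symm,
      (sigmaTestGraph σ Ω).topologicalClosure.smul_mem c h2⟩

/-- The space `H^σ_0(Ω)`; it is given the norm `‖u‖ = ‖D^σ u‖_{L²(ℝ^N)^N}` below. -/
def SigmaSobolev {N : ℕ} (σ : ℝ) (Ω : Set (EuclideanSpace ℝ (Fin N))) : Type :=
  sigmaSobolevSubmodule σ Ω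

section SobolevSpace

variable {N : ℕ} {σ : ℝ} {Ω : Set (EuclideanSpace ℝ (Fin N))}

instance : AddCommGroup (SigmaSobolev σ Ω) :=
  inferInstanceAs (AddCommGroup (sigmaSobolevSubmodule σ Ω))

instance : Module ℝ (SigmaSobolev σ Ω) :=
  inferInstanceAs (Module ℝ (sigmaSobolevSubmodule σ Ω))

/-- The inclusion of `H^σ_0(Ω)` in `L²(ℝ^N)`. -/
def SigmaSobolev.toL2 : SigmaSobolev σ Ω →ₗ[ℝ]
    Lp ℝ 2 (volume : Measure (EuclideanSpace ℝ (Fin N))) :=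
  (sigmaSobolevSubmodule σ Ω).subtype

theorem SigmaSobolev.exists_gradient (u : SigmaSobolev σ Ω) :
    ∃ G : Lp (EuclideanSpace ℝ (Fin N)) 2 (volume : Measure (EuclideanSpace ℝ (Fin N))),
      HasSigmaGradient σ u.toL2 G := by
  obtain ⟨u, G, hG, -⟩ := u
  exact ⟨G, hG⟩

/-- The `σ`-gradient `D^σ : H^σ_0(Ω) → L²(ℝ^N)^N`. -/
def SigmaSobolev.grad : SigmaSobolev σ Ω →ₗ[ℝ]
    Lp (EuclideanSpace ℝ (Fin N)) 2 (volume : Measure (EuclideanSpace ℝ (Fin N))) where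
  toFun u := u.exists_gradient.choose
  map_add' u v := by
    refine Lp.ext ((u + v).exists_gradient.choose_spec.unique ?_)
    refine (u.exists_gradient.choose_spec.add v.exists_gradient.choose_spec).congr ?_
      (Lp.coeFn_add _ _).symm
    rw [map_add]
    exact (Lp.coeFn_add _ _).symm
  map_smul' c u := by
    refine Lp.ext ((c • u).exists_gradient.choose_spec.unique ?_)
    refine (u.exists_gradient.choose_spec.smul c).congr ?_ (Lp.coeFn_smul _ _).symm
    rw [map_smul]
    exact (Lp.coeFn_smul _ _).symm

theorem SigmaSobolev.hasSigmaGradient_grad (u : SigmaSobolev σ Ω) :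
    HasSigmaGradient σ u.toL2 u.grad :=
  u.exists_gradient.choose_spec

/-- `‖u‖_{H^σ_0(Ω)} = ‖D^σ u‖_{L²(ℝ^N)^N}`.  (That only `0` has norm `0` is a Poincaré inequality,
which is not needed to speak of the topology.) -/
instance : SeminormedAddCommGroup (SigmaSobolev σ Ω) :=
  SeminormedAddCommGroup.induced _ _ (SigmaSobolev.grad (σ := σ) (Ω := Ω))

instance : NormedSpace ℝ (SigmaSobolev σ Ω) :=
  NormedSpace.induced ℝ (SigmaSobolev σ Ω) _ (SigmaSobolev.grad (σ := σ) (Ω := Ω))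

theorem SigmaSobolev.norm_eq (u : SigmaSobolev σ Ω) : ‖u‖ = ‖u.grad‖ := rfl

end SobolevSpace

/-- `p` is the exponent `2^#`: `2N/(N+2σ)` if `σ < N/2`, any `q' = q/(q-1)` with `1 < q < ∞` if
`σ = N/2`, and `1` if `σ > N/2`. -/
def IsTwoSharp (N : ℕ) (σ : ℝ) (p : ℝ≥0∞) : Prop :=
  (2 * σ < N ∧ p = ENNReal.ofReal (2 * N / (N + 2 * σ))) ∨
  (2 * σ = N ∧ ∃ q : ℝ, 1 < q ∧ p = ENNReal.ofReal (q / (q - 1))) ∨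
  (N < 2 * σ ∧ p = 1)

/-- The penalisation function `k_ε`. -/
def penalty (ε s : ℝ) : ℝ :=
  if s < 0 then 0
  else if s ≤ 1 / ε then Real.exp (s / ε) - 1
  else Real.exp (1 / ε ^ 2) - 1

section Problems

variable {N : ℕ} {σ : ℝ} {Ω : Set (EuclideanSpace ℝ (Fin N))}

/-- `u ∈ H^σ_0(Ω)` solves the penalised problem
`∫_{ℝ^N} (k_ε(|D^σ u| - g) D^σ u + A D^σ u) · D^σ v = ∫_Ω f v` for all `v ∈ H^σ_0(Ω)`. -/
def IsPenalisedSolution (A : EuclideanSpace ℝ (Fin N) → Matrix (Fin N) (Fin N) ℝ)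
    (f g : EuclideanSpace ℝ (Fin N) → ℝ) (ε : ℝ) (u : SigmaSobolev σ Ω) : Prop :=
  ∀ v : SigmaSobolev σ Ω,
    IntegrableOn (fun x => f x * v.toL2 x) Ω ∧
    ∫ x, inner ℝ (penalty ε (‖u.grad x‖ - g x) • u.grad x +
        Matrix.toEuclideanLin (A x) (u.grad x)) (v.grad x) =
      ∫ x in Ω, f x * v.toL2 x

/-- The convex set `K_g^σ = {v ∈ H^σ_0(Ω) : |D^σ v| ≤ g a.e. in ℝ^N}`. -/
def gradientConstraintSet (σ : ℝ) (Ω : Set (EuclideanSpace ℝ (Fin N)))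
    (g : EuclideanSpace ℝ (Fin N) → ℝ) : Set (SigmaSobolev σ Ω) :=
  {v | ∀ᵐ x, ‖v.grad x‖ ≤ g x}

/-- `u ∈ K_g^σ` solves the variational inequality
`∫_{ℝ^N} A D^σ u · D^σ (v - u) ≥ ∫_Ω f (v - u)` for all `v ∈ K_g^σ`. -/
def IsConstrainedSolution (A : EuclideanSpace ℝ (Fin N) → Matrix (Fin N) (Fin N) ℝ)
    (f g : EuclideanSpace ℝ (Fin N) → ℝ) (u : SigmaSobolev σ Ω) : Prop :=
  u ∈ gradientConstraintSet σ Ω g ∧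
  ∀ v ∈ gradientConstraintSet σ Ω g,
    IntegrableOn (fun x => f x * (v - u).toL2 x) Ω ∧
    ∫ x, inner ℝ (Matrix.toEuclideanLin (A x) (u.grad x)) ((v - u).grad x) ≥
      ∫ x in Ω, f x * (v - u).toL2 x

end Problems

end

/-! ### Integrability of the kernel |x|^{-b}. -/

section RieszKernel

variable {N : ℕ} {b : ℝ}

/-! Everything is transported by `SigmaSobolev.grad` to the Hilbert space Y = L²(ℝ^N)^N. A Poincaré
inequality makes D^σ injective on H^σ_0(Ω) with closed range X. A Sobolev inequality makes v ↦ ∫_Ω f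
v a bounded functional of D^σ v, hence of the form ⟨F, D^σ v⟩ with F ∈ Y
(`exists_inner_grad_eq_setIntegral`). On Y the matrix term is a Lipschitz, strongly monotone
operator T and the penalty term, for fixed ε, a Lipschitz monotone operator S. Both existence claims
are then Stampacchia's theorem (`exists_variational_inequality`), for S + T - F on X and for T - F
on X ∩ B, where B is `boundedFields g`. Uniqueness comes from the strong monotonicity of T.

For the limit, let G = D^σ u^ε and U = D^σ u. Testing with u^ε bounds ‖G‖ and ⟨S G, G⟩ independently
of ε, and the pointwise inequality `sq_posPart_le_penalty` turns the second bound into dist(G, B)² ≤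
Cε. Testing with u^ε - u, where ⟨S G, G - U⟩ ≥ 0 because U ∈ B, gives a_*‖G - U‖² ≤ -⟨T U - F, G -
U⟩. The truncation of G to B need not be a σ-gradient, so the variational inequality cannot be
applied to it. Instead a compactness argument for decreasing convex sets
(`exists_pos_inner_gt_of_mem_cthickening`) shows that ⟨T U - F, · - U⟩, nonnegative on X ∩ B, is
almost nonnegative at bounded points of X near B. The convergence obtained is even strong.

The analytic input is Fourier analysis on test functions. Writing |x|^{-b} as a superposition of
Gaussians gives the transform of a Riesz potential, and then ‖D^σ φ‖² is a multiple of ∫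
|ξ|^{2σ}|φ̂|². Poincaré follows because φ̂ is bounded by ‖φ‖_{L¹}, so low frequencies carry little
mass; the critical Sobolev inequality follows by cutting frequencies at a radius depending on the
level. The estimates then pass to the closure of the test graph. -/

theorem measurable_inv_norm_rpow :
    Measurable fun x : EuclideanSpace ℝ (Fin N) => (‖x‖ ^ b)⁻¹ := by
  fun_prop

theorem integrable_indicator_inv_norm_rpow (hN : 1 ≤ N) (hb : b < N) :
    Integrable ((Metric.ball (0 : EuclideanSpace ℝ (Fin N)) 1).indicator
      fun x => (‖x‖ ^ b)⁻¹) := by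
  rw [integrable_indicator_iff measurableSet_ball]
  refine integrableOn_ball_of_norm_le_rpow (C := 1) (α := b) (by simpa using hN) (by simpa using hb)
    (Eventually.of_forall fun x => ?_) measurable_inv_norm_rpow.aestronglyMeasurable
  rw [one_mul, Real.rpow_neg (norm_nonneg _), norm_inv, Real.norm_of_nonneg (by positivity)]

theorem locallyIntegrable_inv_norm_rpow (hN : 1 ≤ N) (hb : b < N) :
    LocallyIntegrable fun x : EuclideanSpace ℝ (Fin N) => (‖x‖ ^ b)⁻¹ := by
  refine locallyIntegrable_of_norm_le_rpow (C := 1) (α := b) (by simpa using hN)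
    (by simpa using hb) (Eventually.of_forall fun x => ?_)
    measurable_inv_norm_rpow.aestronglyMeasurable
  rw [one_mul, Real.rpow_neg (norm_nonneg _), norm_inv, Real.norm_of_nonneg (by positivity)]

theorem norm_indicator_compl_inv_norm_rpow_le (hb : 0 ≤ b) (x : EuclideanSpace ℝ (Fin N)) :
    ‖(Metric.ball (0 : EuclideanSpace ℝ (Fin N)) 1)ᶜ.indicator (fun x => (‖x‖ ^ b)⁻¹) x‖ ≤ 1 := by
  by_cases hx : x ∈ (Metric.ball (0 : EuclideanSpace ℝ (Fin N)) 1)ᶜ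
  · rw [indicator_of_mem hx, norm_inv, Real.norm_of_nonneg (by positivity)]
    refine inv_le_one_of_one_le₀ (Real.one_le_rpow ?_ hb)
    simpa using hx
  · rw [indicator_of_notMem hx]; simp

/-- Inside the unit ball the kernel is integrable, which gives a convolution integrand times a
bounded factor; outside it is at most 1 and h ⊗ θ is integrable. This is the Fubini hypothesis for
Riesz potentials, with real θ (cut-offs, derivatives of test functions) and complex θ (Schwartz
functions). -/
theorem integrable_prod_rieszKernel {F : Type*} [NormedAddCommGroup F] [NormedSpace ℝ F]
    (hN : 1 ≤ N) (hb0 : 0 ≤ b) (hb : b < N)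
    {h : EuclideanSpace ℝ (Fin N) → ℝ} {θ : EuclideanSpace ℝ (Fin N) → F}
    (hh : Integrable h) (hθ : Integrable θ) {M : ℝ} (hM : ∀ x, ‖θ x‖ ≤ M) :
    Integrable (fun q : EuclideanSpace ℝ (Fin N) × EuclideanSpace ℝ (Fin N) =>
      (h q.2 / ‖q.1 - q.2‖ ^ b) • θ q.1) (volume.prod volume) := by
  set B := Metric.ball (0 : EuclideanSpace ℝ (Fin N)) 1
  set K : EuclideanSpace ℝ (Fin N) → ℝ := fun x => (‖x‖ ^ b)⁻¹
  have hθm : AEStronglyMeasurable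
      (fun q : EuclideanSpace ℝ (Fin N) × EuclideanSpace ℝ (Fin N) => θ q.1)
      (volume.prod volume) := hθ.aestronglyMeasurable.comp_fst
  have i1 : Integrable (fun q : EuclideanSpace ℝ (Fin N) × EuclideanSpace ℝ (Fin N) =>
      (h q.2 * B.indicator K (q.1 - q.2)) • θ q.1) (volume.prod volume) := by
    have := hh.convolution_integrand (ContinuousLinearMap.mul ℝ ℝ)
      (integrable_indicator_inv_norm_rpow hN hb)
    exact this.smul_bdd M hθm (Eventually.of_forall fun q => hM q.1)
  have i2 : Integrable (fun q : EuclideanSpace ℝ (Fin N) × EuclideanSpace ℝ (Fin N) =>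
      Bᶜ.indicator K (q.1 - q.2) • (h q.2 • θ q.1)) (volume.prod volume) := by
    have : Integrable (fun q : EuclideanSpace ℝ (Fin N) × EuclideanSpace ℝ (Fin N) =>
        h q.2 • θ q.1) (volume.prod volume) := (Integrable.smul_prod hh hθ).swap
    refine this.bdd_smul 1 ?_ (Eventually.of_forall fun q =>
      norm_indicator_compl_inv_norm_rpow_le hb0 _)
    exact ((measurable_inv_norm_rpow.indicator measurableSet_ball.compl).comp
      (measurable_fst.sub measurable_snd)).aestronglyMeasurable
  refine (i1.add i2).congr (Eventually.of_forall fun q => ?_)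
  have : K (q.1 - q.2) = B.indicator K (q.1 - q.2) + Bᶜ.indicator K (q.1 - q.2) :=
    (congrFun (indicator_self_add_compl B K) _).symm
  simp only [Pi.add_apply, div_eq_mul_inv]
  change _ = (h q.2 * K (q.1 - q.2)) • θ q.1
  rw [this, smul_smul, ← add_smul]
  ring_nf

end RieszKernel

/-! ### Riesz potentials of integrable functions and closedness of D^σ. -/

section RieszPotential

variable {N : ℕ} {α σ : ℝ} {Ω : Set (EuclideanSpace ℝ (Fin N))}

theorem integrable_prod_indicator_rieszKernel (hN : 1 ≤ N) (hα0 : 0 < α) (hα1 : α ≤ 1)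
    {h : EuclideanSpace ℝ (Fin N) → ℝ} (hh : Integrable h) (R : ℝ) :
    Integrable (fun q : EuclideanSpace ℝ (Fin N) × EuclideanSpace ℝ (Fin N) =>
      (h q.2 / ‖q.1 - q.2‖ ^ ((N : ℝ) - α)) •
        (Metric.closedBall (0 : EuclideanSpace ℝ (Fin N)) R).indicator (fun _ => (1 : ℝ)) q.1)
      (volume.prod volume) := by
  have hN' : (1 : ℝ) ≤ N := by exact_mod_cast hN
  refine integrable_prod_rieszKernel hN (by linarith) (by linarith) hh
    ((integrable_indicator_iff measurableSet_closedBall).2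
      (integrableOn_const (Metric.isBounded_closedBall.measure_lt_top.ne))) (M := 1) fun x => ?_
  refine (norm_indicator_le_norm_self _ _).trans (by simp)

theorem ae_integrable_rieszKernel (hN : 1 ≤ N) (hα0 : 0 < α) (hα1 : α ≤ 1)
    {h : EuclideanSpace ℝ (Fin N) → ℝ} (hh : Integrable h) :
    ∀ᵐ x : EuclideanSpace ℝ (Fin N),
      Integrable (fun y => h y / ‖x - y‖ ^ ((N : ℝ) - α)) := by
  have key : ∀ n : ℕ, ∀ᵐ x : EuclideanSpace ℝ (Fin N), Integrable (fun y =>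
      (h y / ‖x - y‖ ^ ((N : ℝ) - α)) •
        (Metric.closedBall (0 : EuclideanSpace ℝ (Fin N)) n).indicator (fun _ => (1 : ℝ)) x) :=
    fun n => (integrable_prod_indicator_rieszKernel hN hα0 hα1 hh n).prod_right_ae
  filter_upwards [ae_all_iff.2 key] with x hx
  obtain ⟨n, hn⟩ := exists_nat_ge ‖x‖
  have := hx n
  rw [indicator_of_mem (by simpa using hn)] at this
  simpa using this

theorem locallyIntegrable_rieszPotential (hN : 1 ≤ N) (hα0 : 0 < α) (hα1 : α ≤ 1)
    {h : EuclideanSpace ℝ (Fin N) → ℝ} (hh : Integrable h) :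
    LocallyIntegrable (rieszPotential α h) := by
  refine (locallyIntegrable_iff).2 fun k hk => ?_
  obtain ⟨R, hR⟩ := hk.isBounded.subset_closedBall 0
  refine IntegrableOn.mono_set ?_ hR
  rw [← integrable_indicator_iff measurableSet_closedBall]
  have := (integrable_prod_indicator_rieszKernel hN hα0 hα1 hh R).integral_prod_left.const_mul
    (rieszConst N α)
  refine this.congr (Eventually.of_forall fun x => ?_)
  by_cases hx : x ∈ Metric.closedBall (0 : EuclideanSpace ℝ (Fin N)) R
  · simp [hx, rieszPotential]
  · simp [hx]

/-- Fubini and the symmetry of |x - y|: the potential is a symmetric operator. -/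
theorem integral_rieszPotential_mul (hN : 1 ≤ N) (hα0 : 0 < α) (hα1 : α ≤ 1)
    {h χ : EuclideanSpace ℝ (Fin N) → ℝ} (hh : Integrable h) (hχ : Integrable χ) {M : ℝ}
    (hM : ∀ x, ‖χ x‖ ≤ M) :
    ∫ x, rieszPotential α h x * χ x = ∫ y, h y * rieszPotential α χ y := by
  have hN' : (1 : ℝ) ≤ N := by exact_mod_cast hN
  have hint := integrable_prod_rieszKernel (b := (N : ℝ) - α) hN (by linarith) (by linarith)
    hh hχ hM
  calc ∫ x, rieszPotential α h x * χ x
      = ∫ x, rieszConst N α * ∫ y, (h y / ‖x - y‖ ^ ((N : ℝ) - α)) • χ x := by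
        congr 1 with x
        simp only [rieszPotential, smul_eq_mul]
        rw [integral_mul_const, mul_assoc]
    _ = rieszConst N α * ∫ y, ∫ x, (h y / ‖x - y‖ ^ ((N : ℝ) - α)) • χ x := by
        rw [integral_const_mul, integral_integral_swap hint]
    _ = ∫ y, h y * rieszPotential α χ y := by
        rw [← integral_const_mul]
        congr 1 with y
        simp only [rieszPotential, smul_eq_mul]
        rw [mul_left_comm, ← integral_const_mul (h y)]
        congr 2 with x
        rw [norm_sub_rev]; ring

theorem exists_norm_rieszPotential_le (hN : 1 ≤ N) (hα0 : 0 < α) (hα1 : α ≤ 1)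
    {χ : EuclideanSpace ℝ (Fin N) → ℝ} (hχ : Integrable χ) {M : ℝ}
    (hM : ∀ x, ‖χ x‖ ≤ M) : ∃ C, ∀ x, ‖rieszPotential α χ x‖ ≤ C := by
  have hN' : (1 : ℝ) ≤ N := by exact_mod_cast hN
  set B := Metric.ball (0 : EuclideanSpace ℝ (Fin N)) 1
  set K : EuclideanSpace ℝ (Fin N) → ℝ := fun x => (‖x‖ ^ ((N : ℝ) - α))⁻¹
  refine ⟨‖rieszConst N α‖ * ((∫ y, M * B.indicator K y) + ∫ y, ‖χ y‖), fun x => ?_⟩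
  have iK := integrable_indicator_inv_norm_rpow hN (show (N : ℝ) - α < N by linarith)
  rw [rieszPotential, norm_mul]
  refine mul_le_mul_of_nonneg_left ?_ (norm_nonneg _)
  have e : ∫ y, M * B.indicator K y = ∫ y, M * B.indicator K (x - y) :=
    (integral_sub_left_eq_self (fun y => M * B.indicator K y) volume x).symm
  have i1 : Integrable fun y => M * B.indicator K (x - y) := (iK.comp_sub_left x).const_mul M
  rw [e, ← integral_add i1 hχ.norm]
  refine norm_integral_le_of_norm_le (i1.add hχ.norm) (Eventually.of_forall fun y => ?_)
  have hd : K (x - y) = B.indicator K (x - y) + Bᶜ.indicator K (x - y) :=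
    (congrFun (indicator_self_add_compl B K) _).symm
  have h1 : 0 ≤ B.indicator K (x - y) := indicator_nonneg (fun z _ => by positivity) _
  have h2 : ‖Bᶜ.indicator K (x - y)‖ ≤ 1 :=
    norm_indicator_compl_inv_norm_rpow_le (by linarith) _
  rw [div_eq_mul_inv]
  change ‖χ y * K (x - y)‖ ≤ _
  rw [hd, mul_add]
  refine (norm_add_le _ _).trans (add_le_add ?_ ?_)
  · rw [norm_mul, Real.norm_of_nonneg h1]
    exact mul_le_mul_of_nonneg_right (hM y) h1
  · rw [norm_mul]
    exact mul_le_of_le_one_right (norm_nonneg _) h2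

theorem continuous_integral_inner_Lp {F : Type*} [NormedAddCommGroup F] [InnerProductSpace ℝ F]
    {w : EuclideanSpace ℝ (Fin N) → F} (hw : MemLp w 2) :
    Continuous fun G : Lp F 2 (volume : Measure (EuclideanSpace ℝ (Fin N))) =>
      ∫ x, inner ℝ (w x) (G x) := by
  have : (fun G : Lp F 2 (volume : Measure (EuclideanSpace ℝ (Fin N))) =>
      ∫ x, inner ℝ (w x) (G x)) = fun G => inner ℝ (hw.toLp w) G := by
    funext G
    rw [L2.inner_def]
    refine integral_congr_ae ?_
    filter_upwards [hw.coeFn_toLp] with x hx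
    rw [hx]
  rw [this]
  fun_prop

theorem isClosed_ae_eq_zero_off (p : ℝ≥0∞) [Fact (1 ≤ p)] :
    IsClosed {u : Lp ℝ p (volume : Measure (EuclideanSpace ℝ (Fin N))) |
      ∀ᵐ x, x ∉ Ω → u x = 0} := by
  refine IsSeqClosed.isClosed fun u v hu huv => ?_
  obtain ⟨ns, -, hns⟩ := (tendstoInMeasure_of_tendsto_Lp huv).exists_seq_tendsto_ae
  filter_upwards [hns, ae_all_iff.2 hu] with x hx hx' hxΩ
  refine tendsto_nhds_unique hx ?_
  simp [hx' _ hxΩ]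

theorem integrable_of_ae_eq_zero_off (hΩ : Bornology.IsBounded Ω)
    {u : EuclideanSpace ℝ (Fin N) → ℝ} (hu : MemLp u 2) (h0 : ∀ᵐ x, x ∉ Ω → u x = 0) :
    Integrable u := by
  obtain ⟨R, hR⟩ := hΩ.subset_closedBall 0
  have : IsFiniteMeasure (volume.restrict (Metric.closedBall (0 : EuclideanSpace ℝ (Fin N)) R)) :=
    ⟨by simpa using Metric.isBounded_closedBall.measure_lt_top⟩
  have h1 : IntegrableOn u (Metric.closedBall 0 R) :=
    (hu.mono_measure Measure.restrict_le_self).integrable (by norm_num)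
  refine h1.integrable_of_ae_notMem_eq_zero ?_
  filter_upwards [h0] with x hx hxR
  exact hx fun h => hxR (hR h)

/-- By symmetry, integrating I_{1-σ}u against ∂_jφ is pairing u with the bounded function
I_{1-σ}∂_jφ. As u vanishes off the bounded set Ω, that function may be cut off to Ω, which puts it
in L². Both sides of the distributional identity are then continuous on L² × L², so it passes from
the test graph to its closure. -/
theorem hasSigmaGradient_of_mem_closure (hN : 1 ≤ N) (hσ0 : 0 < σ) (hσ1 : σ < 1)
    (hΩo : IsOpen Ω) (hΩ : Bornology.IsBounded Ω)
    {p : Lp ℝ 2 (volume : Measure (EuclideanSpace ℝ (Fin N))) ×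
      Lp (EuclideanSpace ℝ (Fin N)) 2 (volume : Measure (EuclideanSpace ℝ (Fin N)))}
    (hp : p ∈ closure (sigmaTestGraph σ Ω : Set _)) :
    HasSigmaGradient σ p.1 p.2 ∧ ∀ᵐ x, x ∉ Ω → p.1 x = 0 := by
  have hσ' : 0 < 1 - σ := by linarith
  have hσ'' : 1 - σ ≤ 1 := by linarith
  set S : Set (Lp ℝ 2 (volume : Measure (EuclideanSpace ℝ (Fin N))) ×
      Lp (EuclideanSpace ℝ (Fin N)) 2 (volume : Measure (EuclideanSpace ℝ (Fin N)))) :=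
    {p | ∀ᵐ x, x ∉ Ω → p.1 x = 0} with hS
  have hSc : IsClosed S := (isClosed_ae_eq_zero_off 2).preimage continuous_fst
  have hgS : (sigmaTestGraph σ Ω : Set _) ⊆ S := by
    rintro q ⟨φ, -, -, h3, h4, -⟩
    filter_upwards [h4] with x hx hxΩ
    rw [hx]
    exact image_eq_zero_of_notMem_tsupport fun h => hxΩ (h3 h)
  have h0 : ∀ᵐ x, x ∉ Ω → p.1 x = 0 := hSc.closure_subset_iff.2 hgS hp
  have hint : ∀ q ∈ S, Integrable (q.1 : EuclideanSpace ℝ (Fin N) → ℝ) := fun q hq =>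
    integrable_of_ae_eq_zero_off hΩ (Lp.memLp q.1) hq
  have hpS : p ∈ S := h0
  refine ⟨⟨ae_integrable_rieszKernel hN hσ' hσ'' (hint p hpS),
    locallyIntegrable_rieszPotential hN hσ' hσ'' (hint p hpS),
    (Lp.memLp p.2).locallyIntegrable (by norm_num), fun φ hφ hφc j => ?_⟩, h0⟩
  set χ : EuclideanSpace ℝ (Fin N) → ℝ := fun x => fderiv ℝ φ x (EuclideanSpace.single j 1)
  have hχc : Continuous χ := (hφ.continuous_fderiv (by simp)).clm_apply continuous_const
  have hχs : HasCompactSupport χ := hφc.fderiv_apply ℝ _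
  have hχi : Integrable χ := hχc.integrable_of_hasCompactSupport hχs
  obtain ⟨M, hM⟩ := hχc.bounded_above_of_compact_support hχs
  obtain ⟨C, hC⟩ := exists_norm_rieszPotential_le hN hσ' hσ'' hχi hM
  have hwm : MemLp (Ω.indicator (rieszPotential (1 - σ) χ)) 2 := by
    rw [memLp_indicator_iff_restrict hΩo.measurableSet]
    have : IsFiniteMeasure (volume.restrict Ω) := ⟨by simpa using hΩ.measure_lt_top⟩
    exact MemLp.of_bound
      (locallyIntegrable_rieszPotential hN hσ' hσ'' hχi).aestronglyMeasurable.restrict C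
      (Eventually.of_forall hC)
  have hφm : MemLp (fun x => φ x • (EuclideanSpace.single j 1 : EuclideanSpace ℝ (Fin N))) 2 :=
    (hφ.continuous.smul continuous_const).memLp_of_hasCompactSupport hφc.smul_right
  have e1 : ∀ q : Lp ℝ 2 (volume : Measure (EuclideanSpace ℝ (Fin N))) ×
      Lp (EuclideanSpace ℝ (Fin N)) 2 (volume : Measure (EuclideanSpace ℝ (Fin N))),
      ∫ x, q.2 x j * φ x =
        ∫ x, inner ℝ (φ x • (EuclideanSpace.single j 1 : EuclideanSpace ℝ (Fin N))) (q.2 x) := by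
    intro q
    congr 1 with x
    rw [real_inner_smul_left, EuclideanSpace.inner_single_left]
    simp [mul_comm]
  have e2 : ∀ q ∈ S, ∫ x, rieszPotential (1 - σ) q.1 x * χ x =
      ∫ x, inner ℝ (Ω.indicator (rieszPotential (1 - σ) χ) x) (q.1 x) := by
    intro q hq
    rw [integral_rieszPotential_mul hN hσ' hσ'' (hint q hq) hχi hM]
    refine integral_congr_ae ?_
    filter_upwards [hq] with x hx
    by_cases hxΩ : x ∈ Ω
    · simp [hxΩ]
    · simp [hxΩ, hx hxΩ]
  rw [e1, e2 p hpS]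
  refine (isClosed_eq ((continuous_integral_inner_Lp hφm).comp continuous_snd)
    ((continuous_integral_inner_Lp hwm).comp continuous_fst).neg).closure_subset_iff.2 ?_ hp
  intro q hq
  have hqS := hgS hq
  obtain ⟨ψ, -, -, -, h4, h5⟩ := hq
  have := (h5.congr h4.symm (EventuallyEq.refl _ _)).integral_eq φ hφ hφc j
  rw [e1, e2 q hqS] at this
  exact this

end RieszPotential

/-! ### The Fourier transform of |x|^{-b} by Gaussian superposition. -/

section FourierRiesz

open FourierTransform SchwartzMap

variable {N : ℕ} {b α σ : ℝ}

theorem ae_norm_pos (hN : 1 ≤ N) : ∀ᵐ x : EuclideanSpace ℝ (Fin N), 0 < ‖x‖ := by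
  have : Nontrivial (EuclideanSpace ℝ (Fin N)) :=
    Module.nontrivial_of_finrank_pos (R := ℝ) (by simpa using (show 0 < N by omega))
  have h0 : ∀ᵐ x : EuclideanSpace ℝ (Fin N), x ∈ ({0} : Set (EuclideanSpace ℝ (Fin N)))ᶜ :=
    compl_mem_ae_iff.2 (measure_singleton _)
  filter_upwards [h0] with x hx
  exact norm_pos_iff.2 hx

theorem integrable_inv_norm_rpow_smul {F : Type*} [NormedAddCommGroup F] [NormedSpace ℝ F]
    (hN : 1 ≤ N) (hb0 : 0 ≤ b) (hb : b < N) {θ : EuclideanSpace ℝ (Fin N) → F}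
    (hθ : Integrable θ) {M : ℝ} (hM : ∀ x, ‖θ x‖ ≤ M) :
    Integrable fun x => (‖x‖ ^ b)⁻¹ • θ x := by
  set B := Metric.ball (0 : EuclideanSpace ℝ (Fin N)) 1
  set K : EuclideanSpace ℝ (Fin N) → ℝ := fun x => (‖x‖ ^ b)⁻¹
  have i1 : Integrable fun x => B.indicator K x • θ x :=
    (integrable_indicator_inv_norm_rpow hN hb).smul_bdd M hθ.aestronglyMeasurable
      (Eventually.of_forall hM)
  have i2 : Integrable fun x => Bᶜ.indicator K x • θ x :=
    hθ.bdd_smul 1 (measurable_inv_norm_rpow.indicator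
      measurableSet_ball.compl).aestronglyMeasurable
      (Eventually.of_forall fun x => norm_indicator_compl_inv_norm_rpow_le hb0 x)
  refine (i1.add i2).congr (Eventually.of_forall fun x => ?_)
  have : K x = B.indicator K x + Bᶜ.indicator K x :=
    (congrFun (indicator_self_add_compl B K) _).symm
  change _ = K x • θ x
  rw [this, Pi.add_apply, ← add_smul]

/-- Fubini for a kernel that is a superposition over `t > 0` of radial functions. -/
theorem integral_superposition (hN : 1 ≤ N) {w : ℝ → ℝ → ℝ}
    (hwm : Measurable fun q : ℝ × ℝ => w q.1 q.2)
    (hw0 : ∀ r t, 0 < t → 0 ≤ w r t) {c : ℝ} (hc : 0 < c)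
    (hw : ∀ r, 0 < r → ∫ t in Ioi 0, w r t = c * (r ^ b)⁻¹)
    {Φ : EuclideanSpace ℝ (Fin N) → ℂ} (hΦm : AEStronglyMeasurable Φ)
    (hΦ : Integrable fun x => (‖x‖ ^ b)⁻¹ • Φ x) :
    c • ∫ x, (‖x‖ ^ b)⁻¹ • Φ x = ∫ t in Ioi (0 : ℝ), ∫ x, w ‖x‖ t • Φ x := by
  have hwi : ∀ r, 0 < r → IntegrableOn (w r) (Ioi 0) := by
    intro r hr
    -- A non-integrable function has integral 0, whereas the prescribed value is positive.
    by_contra h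
    have h1 := integral_undef h
    rw [hw r hr] at h1
    have : 0 < c * (r ^ b)⁻¹ := by positivity
    exact this.ne' h1
  have hn : ∀ r, 0 < r → ∫ t in Ioi 0, ‖w r t‖ = c * (r ^ b)⁻¹ := by
    intro r hr
    rw [← hw r hr]
    exact setIntegral_congr_fun measurableSet_Ioi fun t ht => Real.norm_of_nonneg (hw0 r t ht)
  have hint : Integrable (fun q : EuclideanSpace ℝ (Fin N) × ℝ => w ‖q.1‖ q.2 • Φ q.1)
      (volume.prod (volume.restrict (Ioi 0))) := by
    rw [integrable_prod_iff]
    · refine ⟨?_, ?_⟩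
      · filter_upwards [ae_norm_pos hN] with x hx
        exact (hwi _ hx).smul_const _
      · refine (hΦ.norm.const_mul c).congr ?_
        filter_upwards [ae_norm_pos hN] with x hx
        simp_rw [norm_smul]
        rw [integral_mul_const, hn _ hx, norm_inv, Real.norm_of_nonneg (by positivity), mul_assoc]
    · exact (hwm.comp ((measurable_norm.comp measurable_fst).prodMk
        measurable_snd)).aestronglyMeasurable.smul hΦm.comp_fst
  have hsw := integral_integral_swap (f := fun x t => w ‖x‖ t • Φ x) hint
  rw [← hsw, ← integral_smul]
  refine integral_congr_ae ?_
  filter_upwards [ae_norm_pos hN] with x hx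
  rw [integral_smul_const, hw _ hx, smul_smul]

/-- The Gamma integral, read as a superposition of the Gaussians e^{-πt|x|²}, whose transforms are
explicit. -/
theorem integral_rpow_mul_exp_neg_mul_sq (hb : 0 < b) {r : ℝ} (hr : 0 < r) :
    ∫ t in Ioi 0, t ^ (b / 2 - 1) * Real.exp (-(Real.pi * r ^ 2 * t)) =
      ((1 / Real.pi) ^ (b / 2) * Real.Gamma (b / 2)) * (r ^ b)⁻¹ := by
  have hpi := Real.pi_pos
  rw [Real.integral_rpow_mul_exp_neg_mul_Ioi (by positivity) (by positivity),
    show 1 / (Real.pi * r ^ 2) = 1 / Real.pi * (r ^ 2)⁻¹ by field_simp,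
    Real.mul_rpow (by positivity) (by positivity), Real.inv_rpow (by positivity),
    ← Real.rpow_natCast, ← Real.rpow_mul hr.le]
  rw [show ((2 : ℕ) : ℝ) * (b / 2) = b by push_cast; ring]
  ring

/-- The preceding formula for N - b after t ↦ 1/t. It is the same superposition on the Fourier side:
transforming the Gaussian produces the factor t^{-N/2} and replaces t by 1/t in the exponent. -/
theorem integral_rpow_mul_exp_neg_mul_sq_div (hb : b < N) {r : ℝ} (hr : 0 < r) :
    ∫ t in Ioi 0, t ^ (b / 2 - 1 - N / 2) * Real.exp (-(Real.pi * r ^ 2 / t)) =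
      ((1 / Real.pi) ^ ((N - b) / 2) * Real.Gamma ((N - b) / 2)) * (r ^ (N - b))⁻¹ := by
  rw [← integral_rpow_mul_exp_neg_mul_sq (by linarith) hr,
    ← integral_comp_rpow_Ioi _ (show (-1 : ℝ) ≠ 0 by norm_num)]
  refine setIntegral_congr_fun measurableSet_Ioi fun t ht => ?_
  have ht : 0 < t := ht
  simp only [abs_neg, abs_one, one_mul, smul_eq_mul]
  rw [← Real.rpow_mul ht.le, ← mul_assoc, ← Real.rpow_add ht, Real.rpow_neg_one, div_eq_mul_inv]
  congr 2
  · ring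
  · rw [div_inv_eq_mul]

theorem integral_fourier_smul_eq_of_integrable {f g : EuclideanSpace ℝ (Fin N) → ℂ}
    (hf : Integrable f) (hg : Integrable g) :
    ∫ ξ, 𝓕 f ξ * g ξ = ∫ x, f x * 𝓕 g x := by
  simpa using! VectorFourier.integral_fourierIntegral_smul_eq_flip (L := innerₗ _)
    Real.continuous_fourierChar continuous_inner hf hg

theorem integral_gaussian_mul_fourier {t : ℝ} (ht : 0 < t)
    {Θ : EuclideanSpace ℝ (Fin N) → ℂ} (hΘ : Integrable Θ) :
    ∫ x : EuclideanSpace ℝ (Fin N), Real.exp (-(Real.pi * ‖x‖ ^ 2 * t)) • 𝓕 Θ x =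
      ∫ ξ, (t ^ (-(N / 2 : ℝ)) * Real.exp (-(Real.pi * ‖ξ‖ ^ 2 / t))) • Θ ξ := by
  have hpi := Real.pi_pos
  have hre : 0 < ((Real.pi * t : ℝ) : ℂ).re := by rw [Complex.ofReal_re]; positivity
  have hg : Integrable fun v : EuclideanSpace ℝ (Fin N) =>
      Complex.exp (-((Real.pi * t : ℝ) : ℂ) * ‖v‖ ^ 2) := by
    simpa using GaussianFourier.integrable_cexp_neg_mul_sq_norm_add hre 0
      (0 : EuclideanSpace ℝ (Fin N))
  have h := integral_fourier_smul_eq_of_integrable hg hΘ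
  have e1 : ∀ x : EuclideanSpace ℝ (Fin N), Complex.exp (-((Real.pi * t : ℝ) : ℂ) * ‖x‖ ^ 2) =
      (Real.exp (-(Real.pi * ‖x‖ ^ 2 * t)) : ℂ) := by
    intro x
    push_cast
    congr 1
    ring
  have e2 : ∀ ξ : EuclideanSpace ℝ (Fin N),
      𝓕 (fun v : EuclideanSpace ℝ (Fin N) =>
        Complex.exp (-((Real.pi * t : ℝ) : ℂ) * ‖v‖ ^ 2)) ξ =
      ((t ^ (-(N / 2 : ℝ)) * Real.exp (-(Real.pi * ‖ξ‖ ^ 2 / t)) : ℝ) : ℂ) := by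
    intro ξ
    rw [fourier_gaussian_innerProductSpace hre]
    have h1 : (Real.pi : ℂ) / ((Real.pi * t : ℝ) : ℂ) = ((t⁻¹ : ℝ) : ℂ) := by
      push_cast
      field_simp
    rw [h1, finrank_euclideanSpace_fin, Real.rpow_neg ht.le, ← Real.inv_rpow ht.le]
    rw [Complex.ofReal_mul (t⁻¹ ^ _), Complex.ofReal_cpow (by positivity)]
    push_cast
    congr 2
    field_simp
  simp only [e2] at h
  simp only [e1] at h
  simp only [Complex.real_smul]
  exact h.symm

/-- The Fourier transform of `‖x‖ ^ (-b)` is a multiple of `‖ξ‖ ^ (-(N - b))`. -/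
theorem integral_inv_norm_rpow_smul_fourier (hN : 1 ≤ N) (hb0 : 0 < b) (hb : b < N)
    {Θ : EuclideanSpace ℝ (Fin N) → ℂ} (hΘ : Integrable Θ)
    (hΘm : AEStronglyMeasurable (𝓕 Θ))
    (h1 : Integrable fun x => (‖x‖ ^ b)⁻¹ • 𝓕 Θ x)
    (h2 : Integrable fun ξ => (‖ξ‖ ^ (N - b))⁻¹ • Θ ξ) :
    ((1 / Real.pi) ^ (b / 2) * Real.Gamma (b / 2)) • ∫ x, (‖x‖ ^ b)⁻¹ • 𝓕 Θ x =
      ((1 / Real.pi) ^ ((N - b) / 2) * Real.Gamma ((N - b) / 2)) •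
        ∫ ξ, (‖ξ‖ ^ (N - b))⁻¹ • Θ ξ := by
  have hpi := Real.pi_pos
  have g1 := Real.Gamma_pos_of_pos (show 0 < b / 2 by linarith)
  have g2 := Real.Gamma_pos_of_pos (show 0 < (N - b) / 2 by linarith)
  rw [integral_superposition hN (w := fun r t => t ^ (b / 2 - 1) *
      Real.exp (-(Real.pi * r ^ 2 * t))) (by fun_prop)
      (fun r t ht => by positivity) (by positivity)
      (fun r hr => integral_rpow_mul_exp_neg_mul_sq hb0 hr) hΘm h1,
    integral_superposition hN (w := fun r t => t ^ (b / 2 - 1 - N / 2) *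
      Real.exp (-(Real.pi * r ^ 2 / t))) (by fun_prop)
      (fun r t ht => by positivity) (by positivity)
      (fun r hr => integral_rpow_mul_exp_neg_mul_sq_div hb hr) hΘ.aestronglyMeasurable h2]
  refine setIntegral_congr_fun measurableSet_Ioi fun t ht => ?_
  have ht : 0 < t := ht
  simp only [← smul_smul]
  rw [integral_smul, integral_gaussian_mul_fourier ht hΘ, ← integral_smul]
  congr 1 with ξ
  rw [sub_eq_add_neg (b / 2 - 1), Real.rpow_add ht]
  simp only [smul_smul]
  rw [mul_assoc]

end FourierRiesz

/-! ### D^σ as a Fourier multiplier on test functions. -/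

section FourierGradient

open FourierTransform SchwartzMap LineDeriv

variable {N : ℕ} {b α σ : ℝ}

theorem fourier_modulation (ψ : EuclideanSpace ℝ (Fin N) → ℂ) (y z : EuclideanSpace ℝ (Fin N)) :
    𝓕 (fun ξ => (Real.fourierChar (-inner ℝ ξ y) : ℂ) * ψ ξ) z = 𝓕 ψ (z + y) := by
  simp only [Real.fourier_eq]
  congr 1 with ξ
  rw [inner_add_right, neg_add, AddChar.map_add_eq_mul, mul_smul]
  rfl

/-- Fubini leaves the kernel centred at y integrated against 𝓕 ψ. Translating by y amounts to
modulating ψ, so the formula for the centred kernel with b = N - α applies. The identity is stated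
weakly because I_α h need not be integrable. Of C only its nonvanishing and its independence of h
and ψ matter later. -/
theorem exists_fourier_rieszPotential_eq (hN : 1 ≤ N) (hα0 : 0 < α) (hα1 : α < 1) :
    ∃ C : ℝ, C ≠ 0 ∧ ∀ (h : EuclideanSpace ℝ (Fin N) → ℝ) (_ : Integrable h)
      (ψ : 𝓢(EuclideanSpace ℝ (Fin N), ℂ)),
      ∫ x, (rieszPotential α h x : ℂ) * 𝓕 ψ x =
        ∫ ξ, ((C * (‖ξ‖ ^ α)⁻¹ : ℝ) : ℂ) * 𝓕 (fun y => (h y : ℂ)) ξ * ψ ξ := by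
  have hN' : (1 : ℝ) ≤ N := by exact_mod_cast hN
  have hpi := Real.pi_pos
  set b : ℝ := N - α with hb
  have hNb : (N : ℝ) - b = α := by rw [hb]; ring
  have g1 := Real.Gamma_pos_of_pos (show 0 < b / 2 by linarith)
  have g2 := Real.Gamma_pos_of_pos (show 0 < α / 2 by linarith)
  have g3 := Real.Gamma_pos_of_pos (show 0 < (N - α) / 2 by linarith)
  set c1 : ℝ := (1 / Real.pi) ^ (b / 2) * Real.Gamma (b / 2)
  set c2 : ℝ := (1 / Real.pi) ^ (α / 2) * Real.Gamma (α / 2)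
  have hc1 : 0 < c1 := by positivity
  have hc2 : 0 < c2 := by positivity
  have hγ : 0 < rieszConst N α := by unfold rieszConst; positivity
  refine ⟨rieszConst N α * (c2 / c1), by positivity, fun h hh ψ => ?_⟩
  have hM : ∃ M, ∀ x, ‖𝓕 ψ x‖ ≤ M :=
    ⟨_, fun x => SchwartzMap.norm_le_seminorm ℝ (𝓕 ψ) x⟩
  obtain ⟨M, hM⟩ := hM
  obtain ⟨M', hM'⟩ : ∃ M, ∀ x, ‖ψ x‖ ≤ M :=
    ⟨_, fun x => SchwartzMap.norm_le_seminorm ℝ ψ x⟩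
  have hint := integrable_prod_rieszKernel (b := b) hN (by linarith) (by linarith)
    hh (𝓕 ψ).integrable hM
  have hKψ : Integrable fun ξ : EuclideanSpace ℝ (Fin N) => (((‖ξ‖ ^ α)⁻¹ : ℝ) : ℂ) * ψ ξ :=
    integrable_inv_norm_rpow_smul hN hα0.le (by linarith) ψ.integrable hM'
  have key : ∀ y, ∫ x, (‖x - y‖ ^ b)⁻¹ • 𝓕 ψ x =
      (c2 / c1) • 𝓕 (fun ξ : EuclideanSpace ℝ (Fin N) => (((‖ξ‖ ^ α)⁻¹ : ℝ) : ℂ) * ψ ξ) y := by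
    intro y
    set Θ : EuclideanSpace ℝ (Fin N) → ℂ := fun ξ => (Real.fourierChar (-inner ℝ ξ y) : ℂ) * ψ ξ
    have hchar : Continuous fun ξ : EuclideanSpace ℝ (Fin N) =>
        (Real.fourierChar (-inner ℝ ξ y) : ℂ) :=
      continuous_subtype_val.comp (Real.continuous_fourierChar.comp (by fun_prop))
    have hΘ : Integrable Θ := ψ.integrable.bdd_mul (c := 1) hchar.aestronglyMeasurable
      (Eventually.of_forall fun x => (Circle.norm_coe _).le)
    have hΘM : ∀ x, ‖Θ x‖ ≤ M' := fun x => by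
      rw [norm_mul, Circle.norm_coe, one_mul]; exact hM' x
    have hF : 𝓕 Θ = fun z => 𝓕 ψ (z + y) := by
      funext z
      rw [fourier_modulation, fourier_coe]
    have hFi : Integrable (𝓕 Θ) := by
      rw [hF]; exact (𝓕 ψ).integrable.comp_add_right y
    have := integral_inv_norm_rpow_smul_fourier hN (b := b) (by linarith) (by linarith) hΘ
      hFi.aestronglyMeasurable
      (integrable_inv_norm_rpow_smul hN (by linarith) (by linarith) hFi
        (fun x => by rw [hF]; exact hM _))
      (integrable_inv_norm_rpow_smul hN (by linarith) (by linarith) hΘ hΘM)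
    rw [hNb] at this
    calc ∫ x, (‖x - y‖ ^ b)⁻¹ • 𝓕 ψ x = ∫ x, (‖x‖ ^ b)⁻¹ • 𝓕 ψ (x + y) := by
          rw [← integral_add_right_eq_self _ y]
          simp
      _ = ∫ x, (‖x‖ ^ b)⁻¹ • 𝓕 Θ x := by rw [hF]
      _ = (c2 / c1) • ∫ ξ, (‖ξ‖ ^ α)⁻¹ • Θ ξ := by
          rw [div_eq_inv_mul, mul_smul, ← this, smul_smul, inv_mul_cancel₀ hc1.ne', one_smul]
      _ = _ := by
          rw [Real.fourier_eq]
          congr 2 with ξ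
          simp only [Θ, Complex.real_smul, Circle.smul_def, smul_eq_mul]
          ring
  calc ∫ x, (rieszPotential α h x : ℂ) * 𝓕 ψ x
      = ∫ x, rieszConst N α • ∫ y, (h y / ‖x - y‖ ^ b) • 𝓕 ψ x := by
        congr 1 with x
        rw [integral_smul_const, ← Complex.real_smul, rieszPotential, mul_smul]
    _ = rieszConst N α • ∫ y, ∫ x, (h y / ‖x - y‖ ^ b) • 𝓕 ψ x := by
        rw [integral_smul, integral_integral_swap hint]
    _ = rieszConst N α • ∫ y, (c2 / c1) • ((h y : ℂ) *
          𝓕 (fun ξ : EuclideanSpace ℝ (Fin N) => (((‖ξ‖ ^ α)⁻¹ : ℝ) : ℂ) * ψ ξ) y) := by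
        congr 2 with y
        simp only [div_eq_mul_inv, mul_smul]
        rw [integral_smul, key y, ← Complex.real_smul, smul_comm]
        rw [div_eq_mul_inv, mul_smul]
    _ = _ := by
        have hflip := integral_fourier_smul_eq_of_integrable (f := fun y => (h y : ℂ))
          hh.ofReal hKψ
        rw [integral_smul, ← hflip, smul_smul, ← integral_smul]
        congr 1 with ξ
        simp only [Complex.real_smul]
        push_cast
        ring

/-- For a smooth function with compact support, `D^σ φ = I_{1-σ} (D φ)`. -/
theorem HasSigmaGradient.ae_eq_rieszPotential (hN : 1 ≤ N) (hσ0 : 0 < σ) (hσ1 : σ < 1)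
    {φ : EuclideanSpace ℝ (Fin N) → ℝ} (hφ : ContDiff ℝ ∞ φ) (hφc : HasCompactSupport φ)
    {G : EuclideanSpace ℝ (Fin N) → EuclideanSpace ℝ (Fin N)} (hG : HasSigmaGradient σ φ G)
    (j : Fin N) :
    (fun x => G x j) =ᵐ[volume] rieszPotential (1 - σ)
      (fun x => fderiv ℝ φ x (EuclideanSpace.single j 1)) := by
  have hN' : (1 : ℝ) ≤ N := by exact_mod_cast hN
  set e : EuclideanSpace ℝ (Fin N) := EuclideanSpace.single j 1
  set K : EuclideanSpace ℝ (Fin N) → ℝ := fun x => (‖x‖ ^ ((N : ℝ) - (1 - σ)))⁻¹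
  have hK : LocallyIntegrable K := locallyIntegrable_inv_norm_rpow hN (by linarith)
  have hφ' : Continuous fun x => fderiv ℝ φ x e :=
    (hφ.continuous_fderiv (by simp)).clm_apply continuous_const
  -- As a convolution with a locally integrable kernel, the potential can be differentiated on the
  -- factor φ.
  have hconv : ∀ χ : EuclideanSpace ℝ (Fin N) → ℝ, rieszPotential (1 - σ) χ =
      fun x => rieszConst N (1 - σ) * (convolution K χ (ContinuousLinearMap.mul ℝ ℝ) volume) x := by
    intro χ
    funext x
    rw [rieszPotential, convolution_eq_swap]
    congr 2 with y
    simp [K, div_eq_mul_inv, mul_comm]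
  have hder : ∀ x, HasFDerivAt (rieszPotential (1 - σ) φ)
      (rieszConst N (1 - σ) • convolution K (fderiv ℝ φ)
        ((ContinuousLinearMap.mul ℝ ℝ).precompR (EuclideanSpace ℝ (Fin N))) volume x) x := by
    intro x
    rw [hconv]
    exact (hφc.hasFDerivAt_convolution_right _ hK (hφ.of_le (by simp)) x).const_mul _
  have hpd : ∀ x, fderiv ℝ (rieszPotential (1 - σ) φ) x e =
      rieszPotential (1 - σ) (fun x => fderiv ℝ φ x e) x := by
    intro x
    rw [(hder x).fderiv, hconv]
    change rieszConst N (1 - σ) * _ = _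
    congr 1
    exact convolution_precompR_apply _ hK (hφc.fderiv ℝ) (hφ.continuous_fderiv (by simp)) x e
  have hci : Integrable fun x => fderiv ℝ φ x e :=
    hφ'.integrable_of_hasCompactSupport (hφc.fderiv_apply ℝ e)
  have hl : LocallyIntegrable (rieszPotential (1 - σ) fun x => fderiv ℝ φ x e) :=
    locallyIntegrable_rieszPotential hN (by linarith) (by linarith) hci
  have hGl : LocallyIntegrable fun x => G x j := by
    intro x
    obtain ⟨s, hs, hsF⟩ := hG.locallyIntegrable_gradient x
    exact ⟨s, hs, (EuclideanSpace.proj (𝕜 := ℝ) j).integrable_comp hsF⟩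
  refine ae_eq_of_integral_contDiff_smul_eq hGl hl fun χ hχ hχc => ?_
  have hw : Differentiable ℝ (rieszPotential (1 - σ) φ) := fun x => (hder x).differentiableAt
  have hχd : Differentiable ℝ χ := hχ.differentiable (by simp)
  -- The potential of φ is classically differentiable, so integration by parts identifies the
  -- distributional derivative with the classical one.
  have ibp := integral_mul_fderiv_eq_neg_fderiv_mul_of_integrable (μ := volume) (v := e)
    (f := rieszPotential (1 - σ) φ) (g := χ) ?_ ?_ ?_ (fun x _ => hw x)
    (fun x _ => hχd x)
  · have h := hG.integral_eq χ hχ hχc j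
    rw [ibp, neg_neg] at h
    simp only [hpd] at h
    simpa only [smul_eq_mul, mul_comm] using h
  · simp only [hpd]
    have := hl.integrable_smul_left_of_hasCompactSupport hχ.continuous hχc
    exact this.congr (Eventually.of_forall fun x => by simp [mul_comm])
  · exact integrable_mul_fderiv hG.locallyIntegrable_potential hχ hχc e
  · have := hw.continuous.locallyIntegrable (μ := volume)
    have := this.integrable_smul_left_of_hasCompactSupport hχ.continuous hχc
    exact this.congr (Eventually.of_forall fun x => by simp [mul_comm])

theorem integral_smul_fourier_Lp (g : Lp ℂ 2 (volume : Measure (EuclideanSpace ℝ (Fin N))))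
    (ψ : 𝓢(EuclideanSpace ℝ (Fin N), ℂ)) :
    ∫ x, ψ x • (𝓕 g : Lp ℂ 2 (volume : Measure (EuclideanSpace ℝ (Fin N)))) x =
      ∫ x, 𝓕 ψ x • g x := by
  have h2 := DFunLike.congr_fun (MeasureTheory.Lp.fourier_toTemperedDistribution_eq g) ψ
  rw [TemperedDistribution.fourier_apply] at h2
  rw [Lp.toTemperedDistribution_apply] at h2
  rw [Lp.toTemperedDistribution_apply] at h2
  exact h2.symm

theorem integral_smul_fourierInv_Lp (g : Lp ℂ 2 (volume : Measure (EuclideanSpace ℝ (Fin N))))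
    (ψ : 𝓢(EuclideanSpace ℝ (Fin N), ℂ)) :
    ∫ x, ψ x • (𝓕⁻ g : Lp ℂ 2 (volume : Measure (EuclideanSpace ℝ (Fin N)))) x =
      ∫ x, 𝓕⁻ ψ x • g x := by
  have h2 := DFunLike.congr_fun (MeasureTheory.Lp.fourierInv_toTemperedDistribution_eq g) ψ
  rw [TemperedDistribution.fourierInv_apply] at h2
  rw [Lp.toTemperedDistribution_apply] at h2
  rw [Lp.toTemperedDistribution_apply] at h2
  exact h2.symm

theorem exists_schwartzMap_ofReal_eq {χ : EuclideanSpace ℝ (Fin N) → ℝ} (hχ : ContDiff ℝ ∞ χ)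
    (hχc : HasCompactSupport χ) :
    ∃ ψ : 𝓢(EuclideanSpace ℝ (Fin N), ℂ), ∀ x, ψ x = (χ x : ℂ) := by
  have hχ' : ContDiff ℝ ∞ (Complex.ofRealCLM ∘ χ) := Complex.ofRealCLM.contDiff.comp hχ
  have hχc' : HasCompactSupport (Complex.ofRealCLM ∘ χ) := hχc.comp_left (map_zero _)
  exact ⟨hχc'.toSchwartzMap hχ', fun x => rfl⟩

theorem integral_norm_sq_Lp {F : Type*} [NormedAddCommGroup F]
    (f : Lp F 2 (volume : Measure (EuclideanSpace ℝ (Fin N)))) :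
    ∫ x, ‖f x‖ ^ 2 = ‖f‖ ^ 2 := by
  rw [Lp.norm_def, (Lp.memLp f).eLpNorm_eq_integral_rpow_norm (by norm_num) (by norm_num),
    ENNReal.toReal_ofReal (by positivity)]
  simp only [ENNReal.toReal_ofNat, Real.rpow_ofNat]
  exact (Real.rpow_inv_natCast_pow (integral_nonneg fun x => by positivity) two_ne_zero).symm

theorem ae_eq_of_integral_schwartz_mul_eq {g m : EuclideanSpace ℝ (Fin N) → ℂ}
    (hg : LocallyIntegrable g) (hm : LocallyIntegrable m)
    (h : ∀ ψ : 𝓢(EuclideanSpace ℝ (Fin N), ℂ), ∫ x, ψ x • g x = ∫ x, ψ x • m x) :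
    g =ᵐ[volume] m := by
  refine ae_eq_of_integral_contDiff_smul_eq hg hm fun χ hχ hχc => ?_
  obtain ⟨ψ, hψ⟩ := exists_schwartzMap_ofReal_eq hχ hχc
  simpa only [hψ, smul_eq_mul, Complex.real_smul] using h ψ

theorem locallyIntegrable_Lp_two {F : Type*} [NormedAddCommGroup F]
    (g : Lp F 2 (volume : Measure (EuclideanSpace ℝ (Fin N)))) : LocallyIntegrable g :=
  (Lp.memLp g).locallyIntegrable (by norm_num)

theorem fourier_Lp_ae_eq {g : Lp ℂ 2 (volume : Measure (EuclideanSpace ℝ (Fin N)))}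
    {m : EuclideanSpace ℝ (Fin N) → ℂ} (hm : LocallyIntegrable m)
    (h : ∀ ψ : 𝓢(EuclideanSpace ℝ (Fin N), ℂ), ∫ x, 𝓕 ψ x • g x = ∫ ξ, ψ ξ • m ξ) :
    (𝓕 g : Lp ℂ 2 (volume : Measure (EuclideanSpace ℝ (Fin N)))) =ᵐ[volume] m :=
  ae_eq_of_integral_schwartz_mul_eq (locallyIntegrable_Lp_two _) hm fun ψ =>
    (integral_smul_fourier_Lp g ψ).trans (h ψ)

theorem fourierInv_Lp_ae_eq {g : Lp ℂ 2 (volume : Measure (EuclideanSpace ℝ (Fin N)))}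
    {m : EuclideanSpace ℝ (Fin N) → ℂ} (hm : LocallyIntegrable m)
    (h : ∀ ψ : 𝓢(EuclideanSpace ℝ (Fin N), ℂ), ∫ x, 𝓕⁻ ψ x • g x = ∫ ξ, ψ ξ • m ξ) :
    (𝓕⁻ g : Lp ℂ 2 (volume : Measure (EuclideanSpace ℝ (Fin N)))) =ᵐ[volume] m :=
  ae_eq_of_integral_schwartz_mul_eq (locallyIntegrable_Lp_two _) hm fun ψ =>
    (integral_smul_fourierInv_Lp g ψ).trans (h ψ)

/-- Plancherel's theorem for `D^σ`: the integral of `|ξ|^{2σ} |φ̂|²` is a multiple of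
`‖D^σ φ‖²`. -/
theorem exists_integral_norm_rpow_mul_fourier_sq_eq (hN : 1 ≤ N) (hσ0 : 0 < σ) (hσ1 : σ < 1) :
    ∃ C : ℝ, 0 ≤ C ∧ ∀ (φ : EuclideanSpace ℝ (Fin N) → ℝ) (_ : ContDiff ℝ ∞ φ)
      (_ : HasCompactSupport φ)
      (G : Lp (EuclideanSpace ℝ (Fin N)) 2 (volume : Measure (EuclideanSpace ℝ (Fin N))))
      (_ : HasSigmaGradient σ φ G),
      Integrable (fun ξ => ‖ξ‖ ^ (2 * σ) * ‖𝓕 (fun x => (φ x : ℂ)) ξ‖ ^ 2) ∧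
      ∫ ξ, ‖ξ‖ ^ (2 * σ) * ‖𝓕 (fun x => (φ x : ℂ)) ξ‖ ^ 2 = C * ‖G‖ ^ 2 := by
  have hN' : (1 : ℝ) ≤ N := by exact_mod_cast hN
  have hpi := Real.pi_pos
  obtain ⟨C, hC0, hC⟩ := exists_fourier_rieszPotential_eq (N := N) (α := 1 - σ) hN
    (by linarith) (by linarith)
  refine ⟨((C * (2 * Real.pi)) ^ 2)⁻¹, by positivity, fun φ hφ hφc G hG => ?_⟩
  obtain ⟨Φ, hΦ⟩ := exists_schwartzMap_ofReal_eq hφ hφc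
  have hΦc : (Φ : EuclideanSpace ℝ (Fin N) → ℂ) = fun x => (φ x : ℂ) := funext hΦ
  have hFΦ : 𝓕 (fun x => (φ x : ℂ)) = 𝓕 Φ := by rw [fourier_coe, hΦc]
  rw [hFΦ]
  have hdφ : ∀ j : Fin N, ∀ ξ, 𝓕 (fun x => ((fderiv ℝ φ x (EuclideanSpace.single j 1) : ℝ) : ℂ)) ξ
      = (2 * Real.pi * Complex.I) * ((ξ j : ℝ) : ℂ) * 𝓕 Φ ξ := by
    intro j ξ
    have h1 : (fun x => ((fderiv ℝ φ x (EuclideanSpace.single j 1) : ℝ) : ℂ)) =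
        (∂_{(EuclideanSpace.single j 1 : EuclideanSpace ℝ (Fin N))} Φ :
          𝓢(EuclideanSpace ℝ (Fin N), ℂ)) := by
      funext x
      rw [SchwartzMap.lineDerivOp_apply_eq_fderiv, hΦc]
      have := (Complex.ofRealCLM.hasFDerivAt (x := φ x)).comp x
        (hφ.differentiable (by simp) x).hasFDerivAt
      have h2 : fderiv ℝ (fun x => (φ x : ℂ)) x = _ := this.fderiv
      rw [h2]
      rfl
    have hg : (fun x : EuclideanSpace ℝ (Fin N) =>
        inner ℝ x (EuclideanSpace.single j 1)).HasTemperateGrowth := by fun_prop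
    rw [h1, ← fourier_coe, SchwartzMap.fourier_lineDerivOp_eq]
    rw [_root_.smul_apply, SchwartzMap.smulLeftCLM_apply_apply hg,
      EuclideanSpace.inner_single_right]
    simp only [smul_eq_mul, Complex.real_smul, one_mul, conj_trivial]
    ring
  -- The expected transform of I_{1-σ}∂_jφ: the multiplier C|ξ|^{-(1-σ)} times 2πiξ_j φ̂. Squared
  -- and summed over j it gives a multiple of |ξ|^{2σ}|φ̂|².
  set m : Fin N → EuclideanSpace ℝ (Fin N) → ℂ := fun j ξ =>
    ((C * (‖ξ‖ ^ (1 - σ))⁻¹ : ℝ) : ℂ) * ((2 * Real.pi * Complex.I) * ((ξ j : ℝ) : ℂ) * 𝓕 Φ ξ)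
    with hm
  have hml : ∀ j, LocallyIntegrable (m j) := by
    intro j
    have h1 : LocallyIntegrable fun ξ : EuclideanSpace ℝ (Fin N) => (‖ξ‖ ^ (1 - σ))⁻¹ :=
      locallyIntegrable_inv_norm_rpow hN (by linarith)
    have hc : Continuous fun ξ : EuclideanSpace ℝ (Fin N) =>
        (C : ℂ) * ((2 * Real.pi * Complex.I) * ((ξ j : ℝ) : ℂ) * 𝓕 Φ ξ) := by
      have := (𝓕 Φ).continuous
      fun_prop
    have h2 := (locallyIntegrableOn_univ.2 h1).smul_continuousOn
      isOpen_univ.isLocallyClosed hc.continuousOn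
    refine (locallyIntegrableOn_univ.1 h2).congr (Eventually.of_forall fun ξ => ?_)
    simp only [hm, Complex.real_smul]
    push_cast
    ring
  have hgm : ∀ j, MemLp (fun x => ((G x j : ℝ) : ℂ)) 2 := by
    intro j
    exact ((EuclideanSpace.proj (𝕜 := ℝ) j).comp_memLp' (Lp.memLp G)).ofReal
  have hFG : ∀ j, (𝓕 (hgm j).toLp : Lp ℂ 2 (volume : Measure (EuclideanSpace ℝ (Fin N))))
      =ᵐ[volume] m j := by
    intro j
    refine fourier_Lp_ae_eq (hml j) fun ψ => ?_
    have hdi : Integrable fun x => fderiv ℝ φ x (EuclideanSpace.single j 1) :=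
      ((hφ.continuous_fderiv (by simp)).clm_apply
        continuous_const).integrable_of_hasCompactSupport (hφc.fderiv_apply ℝ _)
    have h1 := hC _ hdi ψ
    have hae := hG.ae_eq_rieszPotential hN hσ0 hσ1 hφ hφc j
    calc ∫ x, 𝓕 ψ x • (hgm j).toLp _ x
        = ∫ x, (rieszPotential (1 - σ)
            (fun x => fderiv ℝ φ x (EuclideanSpace.single j 1)) x : ℂ) * 𝓕 ψ x := by
          refine integral_congr_ae ?_
          filter_upwards [(hgm j).coeFn_toLp, hae] with x hx hx'
          rw [hx, hx', smul_eq_mul, mul_comm]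
      _ = _ := by
          rw [h1]
          congr 1 with ξ
          rw [hdφ j ξ, smul_eq_mul, hm]
          ring
  have hmL : ∀ j, Integrable (fun ξ => ‖m j ξ‖ ^ 2) ∧
      ∫ ξ, ‖m j ξ‖ ^ 2 = ∫ x, (G x j) ^ 2 := by
    intro j
    have hae : (fun ξ => ‖(𝓕 (hgm j).toLp :
        Lp ℂ 2 (volume : Measure (EuclideanSpace ℝ (Fin N)))) ξ‖ ^ 2) =ᵐ[volume]
        fun ξ => ‖m j ξ‖ ^ 2 := by
      filter_upwards [hFG j] with ξ hξ
      rw [hξ]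
    refine ⟨((Lp.memLp _).integrable_norm_pow (by norm_num)).congr hae, ?_⟩
    rw [← integral_congr_ae hae, integral_norm_sq_Lp, MeasureTheory.Lp.norm_fourier_eq,
      ← integral_norm_sq_Lp]
    refine integral_congr_ae ?_
    filter_upwards [(hgm j).coeFn_toLp] with x hx
    rw [hx, Complex.norm_real, Real.norm_eq_abs, sq_abs]
  have hsum : ∀ᵐ ξ : EuclideanSpace ℝ (Fin N), ∑ j, ‖m j ξ‖ ^ 2 =
      (C * (2 * Real.pi)) ^ 2 * (‖ξ‖ ^ (2 * σ) * ‖𝓕 Φ ξ‖ ^ 2) := by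
    filter_upwards [ae_norm_pos hN] with ξ hξ
    have h1 : ∀ j, ‖m j ξ‖ ^ 2 =
        (C * (2 * Real.pi)) ^ 2 * (((‖ξ‖ ^ (1 - σ))⁻¹) ^ 2 * ‖𝓕 Φ ξ‖ ^ 2) * (ξ j) ^ 2 := by
      intro j
      simp only [hm, norm_mul, Complex.norm_real, Complex.norm_I, Complex.norm_ofNat, mul_pow,
        Real.norm_eq_abs, sq_abs]
      ring
    have h2 : ∑ j, (ξ j) ^ 2 = ‖ξ‖ ^ 2 := (EuclideanSpace.real_norm_sq_eq ξ).symm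
    simp only [h1]
    rw [← Finset.mul_sum, h2]
    have h3 : ((‖ξ‖ ^ (1 - σ))⁻¹) ^ 2 * ‖ξ‖ ^ 2 = ‖ξ‖ ^ (2 * σ) := by
      rw [← Real.rpow_neg hξ.le, ← Real.rpow_natCast, ← Real.rpow_mul hξ.le,
        ← Real.rpow_natCast ‖ξ‖ 2, ← Real.rpow_add hξ]
      congr 1
      push_cast
      ring
    rw [← h3]
    ring
  have hC2 : (C * (2 * Real.pi)) ^ 2 ≠ 0 := by positivity
  have hi : Integrable fun ξ => ∑ j, ‖m j ξ‖ ^ 2 :=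
    integrable_finsetSum _ fun j _ => (hmL j).1
  have hae : (fun ξ => ((C * (2 * Real.pi)) ^ 2)⁻¹ * ∑ j, ‖m j ξ‖ ^ 2) =ᵐ[volume]
      fun ξ => ‖ξ‖ ^ (2 * σ) * ‖𝓕 Φ ξ‖ ^ 2 := by
    filter_upwards [hsum] with ξ hξ
    rw [hξ, inv_mul_cancel_left₀ hC2]
  refine ⟨(hi.const_mul _).congr hae, ?_⟩
  rw [← integral_congr_ae hae, integral_const_mul, integral_finsetSum _ fun j _ => (hmL j).1]
  congr 1
  simp only [fun j => (hmL j).2]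
  rw [← integral_finsetSum, ← integral_norm_sq_Lp]
  · congr 1 with x
    exact (EuclideanSpace.real_norm_sq_eq _).symm
  · intro j _
    refine ((hgm j).integrable_norm_pow (by norm_num)).congr (Eventually.of_forall fun x => ?_)
    simp

end FourierGradient

/-! ### Inverse Fourier transform on L¹ ∩ L² and a level-set estimate. -/

section FractionalSobolev

open FourierTransform SchwartzMap

variable {N : ℕ} {s : ℝ}

theorem integral_fourierInv_smul_eq_of_integrable {f g : EuclideanSpace ℝ (Fin N) → ℂ}
    (hf : Integrable f) (hg : Integrable g) :
    ∫ ξ, 𝓕⁻ f ξ • g ξ = ∫ x, f x • 𝓕⁻ g x := by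
  have h := integral_fourier_smul_eq_of_integrable hf hg.comp_neg
  simp only [smul_eq_mul]
  rw [← integral_neg_eq_self]
  convert h using 1
  · congr 1 with x
    rw [Real.fourierInv_eq_fourier_neg, neg_neg]
  · congr 1 with x
    rw [Real.fourierInv_eq_fourier_comp_neg]

theorem continuous_fourierInv {F : EuclideanSpace ℝ (Fin N) → ℂ} (h1 : Integrable F) :
    Continuous (𝓕⁻ F) := by
  have h := VectorFourier.fourierIntegral_continuous (L := innerₗ (EuclideanSpace ℝ (Fin N)))
    Real.continuous_fourierChar continuous_inner h1
  have h' : Continuous (𝓕 F) := h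
  have e : 𝓕⁻ F = fun x => 𝓕 F (-x) := funext fun x => Real.fourierInv_eq_fourier_neg F x
  rw [e]
  exact h'.comp continuous_neg

/-- Plancherel's theorem on `L¹ ∩ L²`. -/
theorem eLpNorm_fourierInv_eq {F : EuclideanSpace ℝ (Fin N) → ℂ} (h1 : Integrable F)
    (h2 : MemLp F 2) : eLpNorm (𝓕⁻ F) 2 volume = eLpNorm F 2 volume := by
  have hc := continuous_fourierInv h1
  -- The L² transform and the integral transform agree when tested against Schwartz functions, hence
  -- almost everywhere.
  have hae : (𝓕⁻ h2.toLp : Lp ℂ 2 (volume : Measure (EuclideanSpace ℝ (Fin N))))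
      =ᵐ[volume] 𝓕⁻ F := by
    refine fourierInv_Lp_ae_eq (hc.locallyIntegrable) fun ψ => ?_
    have h := integral_fourierInv_smul_eq_of_integrable ψ.integrable h1
    rw [← h, ← fourierInv_coe]
    refine integral_congr_ae ?_
    filter_upwards [h2.coeFn_toLp] with x hx
    rw [hx]
  rw [← eLpNorm_congr_ae hae, ← eLpNorm_congr_ae h2.coeFn_toLp]
  have h3 : ‖(𝓕⁻ h2.toLp : Lp ℂ 2 (volume : Measure (EuclideanSpace ℝ (Fin N))))‖ =
      ‖h2.toLp‖ := (MeasureTheory.Lp.fourierTransformₗᵢ _ ℂ).symm.norm_map _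
  rw [Lp.norm_def, Lp.norm_def] at h3
  exact (ENNReal.toReal_eq_toReal_iff' (Lp.eLpNorm_ne_top _) (Lp.eLpNorm_ne_top _)).1 h3

theorem norm_fourierInv_le (F : EuclideanSpace ℝ (Fin N) → ℂ) (x : EuclideanSpace ℝ (Fin N)) :
    ‖𝓕⁻ F x‖ ≤ ∫ ξ, ‖F ξ‖ := by
  rw [Real.fourierInv_eq]
  refine (norm_integral_le_integral_norm _).trans (le_of_eq ?_)
  congr 1 with ξ
  rw [Circle.norm_smul]

/-- Distribution function estimate by splitting into low and high frequencies. -/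
theorem measure_lt_norm_le (Φ : 𝓢(EuclideanSpace ℝ (Fin N), ℂ)) {l : ℝ} (hl : 0 < l)
    {S : Set (EuclideanSpace ℝ (Fin N))} (hS : MeasurableSet S)
    (hlow : ∫ ξ in S, ‖𝓕 Φ ξ‖ ≤ l / 2) :
    volume {x | l < ‖Φ x‖} ≤ ENNReal.ofReal (4 * l ^ (-2 : ℝ)) * ∫⁻ ξ in Sᶜ, ‖𝓕 Φ ξ‖ₑ ^ 2 := by
  set Ψ : 𝓢(EuclideanSpace ℝ (Fin N), ℂ) := 𝓕 Φ with hΨd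
  have hΨ : Integrable Ψ := Ψ.integrable
  have hΨ2 : MemLp Ψ 2 := Ψ.memLp 2
  -- The sharp cut-offs are no longer Schwartz: the low part is bounded in sup norm by its L¹ norm,
  -- the high part in L² by Plancherel on L¹ ∩ L².
  set F1 := S.indicator Ψ with hF1
  set F2 := Sᶜ.indicator Ψ with hF2
  have i1 : Integrable F1 := hΨ.indicator hS
  have i2 : Integrable F2 := hΨ.indicator hS.compl
  have m2 : MemLp F2 2 := hΨ2.indicator hS.compl
  have hsplit : ∀ x, Φ x = 𝓕⁻ F1 x + 𝓕⁻ F2 x := by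
    intro x
    have h1 : Φ x = 𝓕⁻ (Ψ : EuclideanSpace ℝ (Fin N) → ℂ) x := by
      rw [← fourierInv_coe, hΨd, FourierTransform.fourierInv_fourier_eq]
    have hsum : (Ψ : EuclideanSpace ℝ (Fin N) → ℂ) =
      F1 + F2 := (indicator_self_add_compl S _).symm
    rw [h1, hsum]
    simp only [Real.fourierInv_eq, Pi.add_apply, smul_add]
    have hc : Continuous fun ξ : EuclideanSpace ℝ (Fin N) =>
        (Real.fourierChar (inner ℝ ξ x) : ℂ) :=
      continuous_subtype_val.comp (Real.continuous_fourierChar.comp (by fun_prop))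
    refine integral_add ?_ ?_
    · exact i1.bdd_mul (c := 1) hc.aestronglyMeasurable
        (Eventually.of_forall fun x => (Circle.norm_coe _).le)
    · exact i2.bdd_mul (c := 1) hc.aestronglyMeasurable
        (Eventually.of_forall fun x => (Circle.norm_coe _).le)
  have hb : ∀ x, ‖𝓕⁻ F1 x‖ ≤ l / 2 := by
    intro x
    refine (norm_fourierInv_le F1 x).trans ?_
    rw [← integral_indicator hS] at hlow
    refine le_of_eq_of_le ?_ hlow
    congr 1 with ξ
    rw [hF1, norm_indicator_eq_indicator_norm]
  have hsub : {x | l < ‖Φ x‖} ⊆ {x | ENNReal.ofReal (l / 2) ≤ ‖𝓕⁻ F2 x‖ₑ} := by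
    intro x hx
    have hx : l < ‖Φ x‖ := hx
    rw [hsplit x] at hx
    have := norm_add_le (𝓕⁻ F1 x) (𝓕⁻ F2 x)
    have := hb x
    change ENNReal.ofReal (l / 2) ≤ ‖𝓕⁻ F2 x‖ₑ
    rw [← ofReal_norm]
    exact ENNReal.ofReal_le_ofReal (by linarith)
  refine (measure_mono hsub).trans ?_
  have hl2 : ENNReal.ofReal (l / 2) ≠ 0 := by simpa using hl
  -- Chebyshev at level l/2 with exponent 2, whence the factor 4 l^{-2}.
  have hch := meas_ge_le_mul_pow_eLpNorm_enorm volume (p := 2) (by norm_num) (by norm_num)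
    (continuous_fourierInv i2).aestronglyMeasurable hl2 (by simp)
  refine hch.trans (le_of_eq ?_)
  rw [eLpNorm_fourierInv_eq i2 m2, ENNReal.toReal_ofNat, ENNReal.rpow_ofNat, ENNReal.rpow_ofNat]
  congr 1
  · rw [← ENNReal.ofReal_inv_of_pos (by positivity), ← ENNReal.ofReal_pow (by positivity),
      Real.rpow_neg hl.le]
    congr 1
    norm_cast
    field_simp
    norm_num
  · rw [eLpNorm_eq_lintegral_rpow_enorm_toReal (by norm_num) (by norm_num)]
    rw [← lintegral_indicator hS.compl]
    simp only [ENNReal.toReal_ofNat, ENNReal.rpow_ofNat, one_div]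
    rw [← ENNReal.rpow_natCast, ← ENNReal.rpow_mul]
    norm_num
    congr 1 with ξ
    by_cases hξ : ξ ∈ S <;> simp [hF2, hξ]

end FractionalSobolev

/-! ### The critical Sobolev inequality. -/

section FractionalSobolevCritical

open FourierTransform SchwartzMap

variable {N : ℕ} {s : ℝ}

/-- Dilation by A reduces to the unit ball. -/
theorem exists_setIntegral_ball_inv_norm_rpow_le :
    ∃ κ : ℝ, 0 < κ ∧ ∀ A : ℝ, 0 < A →
      ∫ ξ in Metric.ball (0 : EuclideanSpace ℝ (Fin N)) A, (‖ξ‖ ^ (2 * s))⁻¹ ≤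
        κ * A ^ (N - 2 * s) := by
  set κ := ∫ ξ in Metric.ball (0 : EuclideanSpace ℝ (Fin N)) 1, (‖ξ‖ ^ (2 * s))⁻¹
  have hκ : 0 ≤ κ := setIntegral_nonneg measurableSet_ball fun x _ => by positivity
  -- The added 1 only makes the constant positive, since it is divided by later.
  refine ⟨κ + 1, by linarith, fun A hA => ?_⟩
  have h := Measure.setIntegral_comp_smul_of_pos volume
    (fun ξ : EuclideanSpace ℝ (Fin N) => (‖ξ‖ ^ (2 * s))⁻¹) (Metric.ball 0 1) hA
  rw [smul_unitBall_of_pos hA, finrank_euclideanSpace_fin] at h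
  have h1 : ∫ x in Metric.ball (0 : EuclideanSpace ℝ (Fin N)) 1, (‖A • x‖ ^ (2 * s))⁻¹ =
      (A ^ (2 * s))⁻¹ * κ := by
    rw [← integral_const_mul]
    congr 1 with x
    rw [norm_smul, Real.norm_of_nonneg hA.le, Real.mul_rpow hA.le (norm_nonneg _), mul_inv]
  rw [h1, smul_eq_mul, eq_inv_mul_iff_mul_eq₀ (by positivity)] at h
  rw [← h]
  calc A ^ N * ((A ^ (2 * s))⁻¹ * κ) = κ * A ^ (N - 2 * s) := by
        rw [Real.rpow_sub hA, Real.rpow_natCast]; ring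
    _ ≤ _ := by gcongr; linarith

/-- Young's inequality |Ψ| ≤ (δ|ξ|^{2s}|Ψ|² + δ⁻¹|ξ|^{-2s})/2, integrated over the ball. The
parameter δ stays free so that it can be tuned to the level. -/
theorem setIntegral_ball_norm_le (hN : 1 ≤ N) (hs : 2 * s < N)
    {Ψ : EuclideanSpace ℝ (Fin N) → ℂ} (hΨ : Integrable Ψ)
    (hi : Integrable fun ξ => ‖ξ‖ ^ (2 * s) * ‖Ψ ξ‖ ^ 2) {A δ : ℝ} (hδ : 0 < δ) :
    ∫ ξ in Metric.ball 0 A, ‖Ψ ξ‖ ≤ (δ * (∫ ξ, ‖ξ‖ ^ (2 * s) * ‖Ψ ξ‖ ^ 2) +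
      δ⁻¹ * ∫ ξ in Metric.ball (0 : EuclideanSpace ℝ (Fin N)) A, (‖ξ‖ ^ (2 * s))⁻¹) / 2 := by
  have iK : IntegrableOn (fun ξ : EuclideanSpace ℝ (Fin N) => (‖ξ‖ ^ (2 * s))⁻¹)
      (Metric.ball 0 A) :=
    ((locallyIntegrable_inv_norm_rpow hN hs).integrableOn_isCompact
      (isCompact_closedBall 0 A)).mono_set Metric.ball_subset_closedBall
  have h1 : ∫ ξ in Metric.ball 0 A, ‖Ψ ξ‖ ≤ ∫ ξ in Metric.ball 0 A,
      (δ / 2 * (‖ξ‖ ^ (2 * s) * ‖Ψ ξ‖ ^ 2) + δ⁻¹ / 2 * (‖ξ‖ ^ (2 * s))⁻¹) := by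
    refine integral_mono_ae hΨ.norm.integrableOn
      ((hi.integrableOn.const_mul _).add (iK.const_mul _)) ?_
    filter_upwards [ae_restrict_of_ae (ae_norm_pos hN)] with ξ hξ
    set a := ‖ξ‖ ^ (2 * s)
    have ha : 0 < a := Real.rpow_pos_of_pos hξ _
    have e : δ / 2 * (a * ‖Ψ ξ‖ ^ 2) + δ⁻¹ / 2 * a⁻¹ - ‖Ψ ξ‖ =
        (δ * a * ‖Ψ ξ‖ - 1) ^ 2 / (2 * δ * a) := by
      field_simp
      ring
    have : 0 ≤ (δ * a * ‖Ψ ξ‖ - 1) ^ 2 / (2 * δ * a) := by positivity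
    linarith
  rw [integral_add (hi.integrableOn.const_mul _) (iK.const_mul _), integral_const_mul,
    integral_const_mul] at h1
  have h2 : ∫ ξ in Metric.ball 0 A, ‖ξ‖ ^ (2 * s) * ‖Ψ ξ‖ ^ 2 ≤
      ∫ ξ, ‖ξ‖ ^ (2 * s) * ‖Ψ ξ‖ ^ 2 :=
    setIntegral_le_integral hi (Eventually.of_forall fun ξ => by positivity)
  have h3 := mul_le_mul_of_nonneg_left h2 (show 0 ≤ δ / 2 by positivity)
  linarith

/-- The integral over levels left after Tonelli. The exponent q - 3 combines q - 1 from the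
layer-cake formula with -2 from Chebyshev; q > 2 gives convergence at 0. -/
theorem lintegral_Ioi_ite_rpow {q c : ℝ} (hq : 2 < q) (hc : 0 ≤ c) :
    ∫⁻ l in Ioi (0 : ℝ), (if l ^ 2 ≤ c then ENNReal.ofReal (4 * l ^ (q - 3)) else 0) =
      ENNReal.ofReal (4 * c ^ ((q - 2) / 2) / (q - 2)) := by
  have hset : ∀ l ∈ Ioi (0 : ℝ), (if l ^ 2 ≤ c then ENNReal.ofReal (4 * l ^ (q - 3)) else 0) =
      (Ioc 0 (√c)).indicator (fun l => ENNReal.ofReal (4 * l ^ (q - 3))) l := by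
    intro l hl
    have hl : 0 < l := hl
    by_cases h : l ^ 2 ≤ c
    · rw [if_pos h, indicator_of_mem]
      exact ⟨hl, Real.le_sqrt_of_sq_le h⟩
    · rw [if_neg h, indicator_of_notMem]
      exact fun h' => h ((Real.le_sqrt hl.le hc).1 h'.2)
  rw [setLIntegral_congr_fun measurableSet_Ioi hset, lintegral_indicator measurableSet_Ioc,
    Measure.restrict_restrict measurableSet_Ioc,
    inter_eq_left.2 (Ioc_subset_Ioi_self : Ioc 0 (√c) ⊆ Ioi 0)]
  have hint : IntegrableOn (fun l : ℝ => 4 * l ^ (q - 3)) (Ioc 0 (√c)) :=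
    ((intervalIntegral.intervalIntegrable_rpow' (a := 0) (b := √c)
      (by linarith : -1 < q - 3)).const_mul 4).1
  rw [← ofReal_integral_eq_lintegral_ofReal hint
    ((ae_restrict_iff' measurableSet_Ioc).2 (Eventually.of_forall fun l hl => by
      have : 0 < l := hl.1
      positivity)), ← intervalIntegral.integral_of_le (Real.sqrt_nonneg c),
    intervalIntegral.integral_const_mul, integral_rpow (Or.inl (by linarith)),
    Real.zero_rpow (by linarith), Real.sqrt_eq_rpow, ← Real.rpow_mul hc]
  congr 1
  rw [show q - 3 + 1 = q - 2 by ring, show 1 / 2 * (q - 2) = (q - 2) / 2 by ring]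
  ring

/-- The Sobolev inequality for fractional derivatives in `L²`, with the critical exponent. -/
theorem exists_lintegral_norm_rpow_le (hN : 1 ≤ N) (hs0 : 0 < s) (hs : 2 * s < N) :
    ∃ C : ℝ, 0 < C ∧ ∀ (Φ : 𝓢(EuclideanSpace ℝ (Fin N), ℂ)) (M : ℝ) (_ : 0 < M)
      (_ : Integrable fun ξ => ‖ξ‖ ^ (2 * s) * ‖𝓕 Φ ξ‖ ^ 2)
      (_ : ∫ ξ, ‖ξ‖ ^ (2 * s) * ‖𝓕 Φ ξ‖ ^ 2 ≤ M),
      ∫⁻ x, ENNReal.ofReal (‖Φ x‖ ^ (2 * N / (N - 2 * s))) ≤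
        ENNReal.ofReal (C * M ^ (2 * N / (N - 2 * s) / 2)) := by
  have hN' : (1 : ℝ) ≤ N := by exact_mod_cast hN
  obtain ⟨κ, hκ, hκA⟩ := exists_setIntegral_ball_inv_norm_rpow_le (N := N) (s := s)
  set d : ℝ := N - 2 * s with hd
  have hd0 : 0 < d := by linarith
  set q : ℝ := 2 * N / d with hq
  have hq2 : q - 2 = 4 * s / d := by rw [hq]; field_simp; linarith
  have hq2' : 0 < q - 2 := by rw [hq2]; positivity
  refine ⟨q * (4 * (4 * κ) ^ ((q - 2) / 2) / (q - 2)), by positivity, fun Φ M hM hi hIM => ?_⟩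
  set Ψ : 𝓢(EuclideanSpace ℝ (Fin N), ℂ) := 𝓕 Φ with hΨ
  rw [lintegral_rpow_eq_lintegral_meas_lt_mul volume
    (Eventually.of_forall fun x => norm_nonneg (Φ x)) Φ.continuous.norm.aemeasurable
    (show 0 < q by linarith)]
  set H : ℝ → EuclideanSpace ℝ (Fin N) → ℝ≥0∞ := fun l ξ =>
    ‖Ψ ξ‖ₑ ^ 2 * (if l ^ 2 ≤ 4 * κ * M * ‖ξ‖ ^ d then ENNReal.ofReal (4 * l ^ (q - 3)) else 0)
    with hH
  have hHm : Measurable (Function.uncurry H) := by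
    have hm : Measurable Ψ := Ψ.continuous.measurable
    refine ((hm.enorm.pow_const 2).comp measurable_snd).mul (Measurable.ite ?_ ?_ ?_)
    · exact measurableSet_le (by fun_prop) (by fun_prop)
    · fun_prop
    · exact measurable_const
  have h1 : ∀ l ∈ Ioi (0 : ℝ), volume {x | l < ‖Φ x‖} * ENNReal.ofReal (l ^ (q - 1)) ≤
      ∫⁻ ξ, H l ξ := by
    intro l hl
    have hl : 0 < l := hl
    -- The cut-off radius for level l. With δ = l/(2M), each of the two terms in Young's bound is at
    -- most l/2 before halving, so the low frequencies contribute at most l/2.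
    set A : ℝ := (l ^ 2 / (4 * κ * M)) ^ d⁻¹ with hA
    have hA0 : 0 < A := by positivity
    have hAd : A ^ d = l ^ 2 / (4 * κ * M) := Real.rpow_inv_rpow (by positivity) hd0.ne'
    have hlow : ∫ ξ in Metric.ball 0 A, ‖Ψ ξ‖ ≤ l / 2 := by
      have e1 := setIntegral_ball_norm_le hN hs Ψ.integrable hi (A := A)
        (show 0 < l / (2 * M) by positivity)
      have e2 := hκA A hA0
      rw [hAd] at e2
      have e3 := mul_le_mul_of_nonneg_left hIM (show 0 ≤ l / (2 * M) by positivity)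
      have e4 := mul_le_mul_of_nonneg_left e2 (show 0 ≤ (l / (2 * M))⁻¹ by positivity)
      have e5 : l / (2 * M) * M = l / 2 := by field_simp
      have e6 : (l / (2 * M))⁻¹ * (κ * (l ^ 2 / (4 * κ * M))) = l / 2 := by field_simp; norm_num
      rw [e5] at e3
      rw [e6] at e4
      linarith
    have hmeas := measure_lt_norm_le Φ hl measurableSet_ball hlow
    calc volume {x | l < ‖Φ x‖} * ENNReal.ofReal (l ^ (q - 1))
        ≤ ENNReal.ofReal (4 * l ^ (-2 : ℝ)) * (∫⁻ ξ in (Metric.ball 0 A)ᶜ, ‖Ψ ξ‖ₑ ^ 2) *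
            ENNReal.ofReal (l ^ (q - 1)) := by gcongr
      _ = ∫⁻ ξ in (Metric.ball 0 A)ᶜ, ‖Ψ ξ‖ₑ ^ 2 * ENNReal.ofReal (4 * l ^ (q - 3)) := by
          rw [lintegral_mul_const _ (Ψ.continuous.measurable.enorm.pow_const 2), mul_right_comm,
            ← ENNReal.ofReal_mul (by positivity), mul_assoc 4, ← Real.rpow_add hl, mul_comm]
          ring_nf
      _ = ∫⁻ ξ, H l ξ := by
          rw [← lintegral_indicator measurableSet_ball.compl]
          congr 1 with ξ
          have hiff : l ^ 2 ≤ 4 * κ * M * ‖ξ‖ ^ d ↔ ξ ∈ (Metric.ball 0 A)ᶜ := by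
            rw [mem_compl_iff, mem_ball_zero_iff, not_lt,
              ← Real.rpow_le_rpow_iff hA0.le (norm_nonneg _) hd0, hAd, div_le_iff₀' (by positivity)]
          by_cases hξ : ξ ∈ (Metric.ball 0 A)ᶜ
          · rw [indicator_of_mem hξ, hH]
            simp only
            rw [if_pos (hiff.2 hξ)]
          · rw [indicator_of_notMem hξ, hH]
            simp only
            rw [if_neg (fun h => hξ (hiff.1 h)), mul_zero]
  -- Since d(q - 2)/2 = 2s, integrating over the levels restores exactly the weight |ξ|^{2s}.
  have h2 : ∀ ξ, ∫⁻ l in Ioi (0 : ℝ), H l ξ =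
      ENNReal.ofReal (4 * (4 * κ * M) ^ ((q - 2) / 2) / (q - 2) *
        (‖ξ‖ ^ (2 * s) * ‖Ψ ξ‖ ^ 2)) := by
    intro ξ
    rw [lintegral_const_mul' _ _ (by simp), lintegral_Ioi_ite_rpow (by linarith) (by positivity),
      Real.mul_rpow (by positivity) (by positivity), ← Real.rpow_mul (norm_nonneg _),
      show d * ((q - 2) / 2) = 2 * s by rw [hq2]; field_simp; ring, ← ofReal_norm,
      ← ENNReal.ofReal_pow (norm_nonneg _), ← ENNReal.ofReal_mul (by positivity)]
    congr 1
    ring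
  calc ENNReal.ofReal q * ∫⁻ l in Ioi 0,
        volume {x | l < ‖Φ x‖} * ENNReal.ofReal (l ^ (q - 1))
      ≤ ENNReal.ofReal q * ∫⁻ l in Ioi 0, ∫⁻ ξ, H l ξ := by
        gcongr 1
        exact setLIntegral_mono' measurableSet_Ioi h1
    _ = ENNReal.ofReal q * ∫⁻ ξ, ENNReal.ofReal (4 * (4 * κ * M) ^ ((q - 2) / 2) / (q - 2) *
          (‖ξ‖ ^ (2 * s) * ‖Ψ ξ‖ ^ 2)) := by
        rw [lintegral_lintegral_swap hHm.aemeasurable]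
        simp only [h2]
    _ = ENNReal.ofReal (q * (4 * (4 * κ * M) ^ ((q - 2) / 2) / (q - 2) *
          ∫ ξ, ‖ξ‖ ^ (2 * s) * ‖Ψ ξ‖ ^ 2)) := by
        rw [← ofReal_integral_eq_lintegral_ofReal (hi.const_mul _)
          (Eventually.of_forall fun ξ => by positivity), integral_const_mul,
          ← ENNReal.ofReal_mul (by linarith)]
    _ ≤ ENNReal.ofReal (q * (4 * (4 * κ * M) ^ ((q - 2) / 2) / (q - 2) * M)) := by
        refine ENNReal.ofReal_le_ofReal ?_
        have : 0 ≤ q := by linarith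
        gcongr
    _ = _ := by
        congr 1
        rw [Real.mul_rpow (by positivity) hM.le, show q / 2 = (q - 2) / 2 + 1 by ring,
          Real.rpow_add hM, Real.rpow_one]
        ring

end FractionalSobolevCritical

/-! ### Poincaré inequality and frequency bounds for test functions. -/

section Embedding

open FourierTransform SchwartzMap

variable {N : ℕ} {s σ : ℝ} {Ω : Set (EuclideanSpace ℝ (Fin N))}

/-- Cauchy–Schwarz against 1, from expanding ∫_Ω (|Φ| - t)² ≥ 0 at a near-optimal t. The added 1
keeps the divisor in t positive when Ω is null. -/
theorem sq_setIntegral_norm_le (hΩ : Bornology.IsBounded Ω)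
    {Φ : EuclideanSpace ℝ (Fin N) → ℂ} (h1 : IntegrableOn Φ Ω) (h2 : Integrable fun x => ‖Φ x‖ ^ 2) :
    (∫ x in Ω, ‖Φ x‖) ^ 2 ≤ (volume.real Ω + 1) * ∫ x, ‖Φ x‖ ^ 2 := by
  have : IsFiniteMeasure (volume.restrict Ω) := ⟨by simpa using hΩ.measure_lt_top⟩
  set J := ∫ x in Ω, ‖Φ x‖
  set I := ∫ x, ‖Φ x‖ ^ 2
  set V := volume.real Ω + 1 with hV
  have hV0 : 0 ≤ volume.real Ω := measureReal_nonneg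
  have hV1 : 0 < V := by linarith
  set t := J / V with ht
  have hle : ∫ x in Ω, ‖Φ x‖ ^ 2 ≤ I :=
    setIntegral_le_integral h2 (Eventually.of_forall fun x => by positivity)
  have h0 : 0 ≤ ∫ x in Ω, (‖Φ x‖ - t) ^ 2 := integral_nonneg fun x => by positivity
  have e : ∫ x in Ω, (‖Φ x‖ - t) ^ 2 =
      (∫ x in Ω, ‖Φ x‖ ^ 2) - 2 * t * J + volume.real Ω * t ^ 2 := by
    have : ∀ x, (‖Φ x‖ - t) ^ 2 = ‖Φ x‖ ^ 2 - 2 * t * ‖Φ x‖ + t ^ 2 := fun x => by ring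
    simp only [this]
    have h3 : IntegrableOn (fun x => ‖Φ x‖ ^ 2 - 2 * t * ‖Φ x‖) Ω :=
      h2.integrableOn.sub (h1.norm.const_mul _)
    rw [integral_add h3 (integrable_const _),
      integral_sub h2.integrableOn (h1.norm.const_mul _), integral_const_mul, integral_const,
      measureReal_restrict_apply_univ, smul_eq_mul]
  rw [e] at h0
  have hJ : J = t * V := by rw [ht]; field_simp
  rw [hJ] at h0 ⊢
  nlinarith [sq_nonneg t]

/-- Frequency bounds for test functions in terms of `‖D^σ φ‖`, including the Poincaré inequality. -/
theorem exists_frequency_bounds (hN : 1 ≤ N) (hσ0 : 0 < σ) (hσ1 : σ < 1)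
    (hΩ : Bornology.IsBounded Ω) :
    ∃ C : ℝ, 0 < C ∧ ∀ (φ : EuclideanSpace ℝ (Fin N) → ℝ) (_ : ContDiff ℝ ∞ φ)
      (_ : HasCompactSupport φ) (_ : tsupport φ ⊆ Ω)
      (G : Lp (EuclideanSpace ℝ (Fin N)) 2 (volume : Measure (EuclideanSpace ℝ (Fin N))))
      (_ : HasSigmaGradient σ φ G), ∃ Φ : 𝓢(EuclideanSpace ℝ (Fin N), ℂ),
        (∀ x, Φ x = (φ x : ℂ)) ∧
        Integrable (fun ξ => ‖ξ‖ ^ (2 * σ) * ‖𝓕 Φ ξ‖ ^ 2) ∧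
        ∫ ξ, ‖ξ‖ ^ (2 * σ) * ‖𝓕 Φ ξ‖ ^ 2 ≤ C * ‖G‖ ^ 2 ∧
        ∫ ξ, ‖𝓕 Φ ξ‖ ^ 2 ≤ C * ‖G‖ ^ 2 ∧ ∫ x, ‖Φ x‖ ^ 2 ≤ C * ‖G‖ ^ 2 := by
  obtain ⟨C, hC0, hC⟩ := exists_integral_norm_rpow_mul_fourier_sq_eq hN hσ0 hσ1
  set V := volume.real Ω + 1 with hV
  have hV1 : 0 < V := by have : 0 ≤ volume.real Ω := measureReal_nonneg; linarith
  set B := volume.real (Metric.ball (0 : EuclideanSpace ℝ (Fin N)) 1) with hB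
  have hB0 : 0 ≤ B := measureReal_nonneg
  -- Small enough that the frequencies |ξ| < R carry at most half of ‖φ‖², given |φ̂|² ≤ V‖φ‖²; R ≤
  -- 1 allows R^N ≤ R.
  set R : ℝ := min 1 (1 / (2 * (V * B + 1))) with hR
  have hR0 : 0 < R := by positivity
  have hRV : R ^ N * B * V ≤ 1 / 2 := by
    have h1 : R ^ N ≤ R := pow_le_of_le_one hR0.le (min_le_left _ _) (by omega)
    have h2 : R ≤ 1 / (2 * (V * B + 1)) := min_le_right _ _
    have h3 : 0 ≤ V * B := by positivity
    calc R ^ N * B * V = R ^ N * (V * B) := by ring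
      _ ≤ 1 / (2 * (V * B + 1)) * (V * B) := by gcongr; exact h1.trans h2
      _ ≤ 1 / 2 := by
        rw [one_div, inv_mul_le_iff₀ (by positivity)]
        linarith
  refine ⟨C + 2 * (R ^ (2 * σ))⁻¹ * C + 1, by positivity, fun φ hφ hφc hφΩ G hG => ?_⟩
  obtain ⟨hi, hI⟩ := hC φ hφ hφc G hG
  obtain ⟨Φ, hΦ⟩ := exists_schwartzMap_ofReal_eq hφ hφc
  have hFΦ : 𝓕 (fun x => (φ x : ℂ)) = 𝓕 Φ := by rw [fourier_coe, funext hΦ]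
  rw [hFΦ] at hi hI
  set Ψ : 𝓢(EuclideanSpace ℝ (Fin N), ℂ) := 𝓕 Φ with hΨ
  have hpl : ∫ ξ, ‖Ψ ξ‖ ^ 2 = ∫ x, ‖Φ x‖ ^ 2 := integral_norm_sq_fourier Φ
  have hΦ2 : Integrable fun x => ‖Φ x‖ ^ 2 := (Φ.memLp 2).integrable_norm_pow (by norm_num)
  have hΨ2 : Integrable fun x => ‖Ψ x‖ ^ 2 := (Ψ.memLp 2).integrable_norm_pow (by norm_num)
  set I0 := ∫ x, ‖Φ x‖ ^ 2 with hI0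
  have hsup : ∀ ξ, ‖Ψ ξ‖ ^ 2 ≤ V * I0 := by
    intro ξ
    have h1 : ‖Ψ ξ‖ ≤ ∫ x, ‖Φ x‖ := by
      rw [hΨ, fourier_coe, Real.fourier_eq]
      refine (norm_integral_le_integral_norm _).trans (le_of_eq ?_)
      congr 1 with x
      rw [Circle.norm_smul]
    have h2 : ∫ x, ‖Φ x‖ = ∫ x in Ω, ‖Φ x‖ := by
      refine (setIntegral_eq_integral_of_forall_compl_eq_zero fun x hx => ?_).symm
      rw [hΦ, image_eq_zero_of_notMem_tsupport fun h => hx (hφΩ h)]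
      simp
    rw [h2] at h1
    exact (pow_le_pow_left₀ (norm_nonneg _) h1 2).trans
      (sq_setIntegral_norm_le hΩ Φ.integrable.integrableOn hΦ2)
  have hlow : ∫ ξ in Metric.ball 0 R, ‖Ψ ξ‖ ^ 2 ≤ I0 / 2 := by
    have hfin : volume (Metric.ball (0 : EuclideanSpace ℝ (Fin N)) R) ≠ ⊤ :=
      Metric.isBounded_ball.measure_lt_top.ne
    have h1 : ∫ ξ in Metric.ball 0 R, ‖Ψ ξ‖ ^ 2 ≤
        ∫ ξ in Metric.ball (0 : EuclideanSpace ℝ (Fin N)) R, V * I0 :=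
      setIntegral_mono_on hΨ2.integrableOn (integrableOn_const hfin) measurableSet_ball
        fun ξ _ => hsup ξ
    have h2 : volume.real (Metric.ball (0 : EuclideanSpace ℝ (Fin N)) R) = R ^ N * B := by
      rw [hB, measureReal_def, Measure.addHaar_ball_of_pos _ _ hR0, ENNReal.toReal_mul,
        ENNReal.toReal_ofReal (by positivity), finrank_euclideanSpace_fin, measureReal_def]
    rw [setIntegral_const, h2, smul_eq_mul] at h1
    have h3 : 0 ≤ I0 := integral_nonneg fun x => by positivity
    nlinarith
  have hhigh : ∫ ξ in (Metric.ball 0 R)ᶜ, ‖Ψ ξ‖ ^ 2 ≤ (R ^ (2 * σ))⁻¹ * (C * ‖G‖ ^ 2) := by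
    have h1 : ∫ ξ in (Metric.ball 0 R)ᶜ, ‖Ψ ξ‖ ^ 2 ≤
        ∫ ξ in (Metric.ball 0 R)ᶜ, (R ^ (2 * σ))⁻¹ * (‖ξ‖ ^ (2 * σ) * ‖Ψ ξ‖ ^ 2) := by
      refine setIntegral_mono_on hΨ2.integrableOn (hi.const_mul _).integrableOn
        measurableSet_ball.compl fun ξ hξ => ?_
      have hξ : R ≤ ‖ξ‖ := by simpa using hξ
      have h2 : R ^ (2 * σ) ≤ ‖ξ‖ ^ (2 * σ) := Real.rpow_le_rpow hR0.le hξ (by linarith)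
      rw [← mul_assoc]
      refine le_mul_of_one_le_left (by positivity) ?_
      rw [inv_mul_eq_div, one_le_div (by positivity)]
      exact h2
    refine h1.trans ?_
    rw [integral_const_mul, ← hI]
    exact mul_le_mul_of_nonneg_left
      (setIntegral_le_integral hi (Eventually.of_forall fun ξ => by positivity)) (by positivity)
  have hadd := integral_add_compl (measurableSet_ball (x := (0 : EuclideanSpace ℝ (Fin N)))
    (ε := R)) hΨ2
  -- The low-frequency half is absorbed on the left.
  have hP : I0 ≤ 2 * (R ^ (2 * σ))⁻¹ * C * ‖G‖ ^ 2 := by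
    rw [hpl] at hadd
    nlinarith
  have hG0 : 0 ≤ ‖G‖ ^ 2 := by positivity
  have hR2 : 0 ≤ 2 * (R ^ (2 * σ))⁻¹ * C * ‖G‖ ^ 2 := by positivity
  have hCG : 0 ≤ C * ‖G‖ ^ 2 := by positivity
  refine ⟨Φ, hΦ, hi, ?_, ?_, ?_⟩
  · rw [hI]; nlinarith
  · rw [hpl]; nlinarith
  · nlinarith

end Embedding

/-! ### Sobolev embeddings of test functions in the three regimes of σ. -/

section Duality

open FourierTransform SchwartzMap

variable {N : ℕ} {s σ : ℝ} {Ω : Set (EuclideanSpace ℝ (Fin N))}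

theorem eq_zero_of_integral_norm_sq_le_zero {φ : EuclideanSpace ℝ (Fin N) → ℝ}
    {Φ : 𝓢(EuclideanSpace ℝ (Fin N), ℂ)} (hΦ : ∀ x, Φ x = (φ x : ℂ))
    (h : ∫ x, ‖Φ x‖ ^ 2 ≤ 0) (x : EuclideanSpace ℝ (Fin N)) : φ x = 0 := by
  have hi : Integrable fun x => ‖Φ x‖ ^ 2 := (Φ.memLp 2).integrable_norm_pow (by norm_num)
  have h0 : ∫ x, ‖Φ x‖ ^ 2 = 0 := le_antisymm h (integral_nonneg fun x => by positivity)
  have hc : Continuous fun x => ‖Φ x‖ ^ 2 := by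
    have := Φ.continuous
    fun_prop
  have hae := (integral_eq_zero_iff_of_nonneg (fun x => by positivity) hi).1 h0
  have h1 := congrFun ((hc.ae_eq_iff_eq volume continuous_zero).1 hae) x
  simpa [hΦ] using h1

/-- Since |ξ|^{2s} ≤ |ξ|^{2σ} + 1, the critical inequality holds for every order s ≤ σ with 2s < N.
The order s = σ serves the case 2σ < N; smaller s serve the borderline 2σ = N. -/
theorem exists_eLpNorm_critical_le (hN : 1 ≤ N) (hσ0 : 0 < σ) (hσ1 : σ < 1)
    (hΩ : Bornology.IsBounded Ω) (hs0 : 0 < s) (hsσ : s ≤ σ) (hs : 2 * s < N) :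
    ∃ C : ℝ, 0 ≤ C ∧ ∀ (φ : EuclideanSpace ℝ (Fin N) → ℝ) (_ : ContDiff ℝ ∞ φ)
      (_ : HasCompactSupport φ) (_ : tsupport φ ⊆ Ω)
      (G : Lp (EuclideanSpace ℝ (Fin N)) 2 (volume : Measure (EuclideanSpace ℝ (Fin N))))
      (_ : HasSigmaGradient σ φ G),
      eLpNorm φ (ENNReal.ofReal (2 * N / (N - 2 * s))) volume ≤ ENNReal.ofReal (C * ‖G‖) := by
  have hN' : (1 : ℝ) ≤ N := by exact_mod_cast hN
  obtain ⟨C1, hC1, h1⟩ := exists_frequency_bounds hN hσ0 hσ1 hΩ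
  obtain ⟨C2, hC2, h2⟩ := exists_lintegral_norm_rpow_le hN hs0 hs
  set q : ℝ := 2 * N / (N - 2 * s) with hq
  have hq0 : 0 < q := by
    have : 0 < N - 2 * s := by linarith
    positivity
  refine ⟨C2 ^ q⁻¹ * (2 * C1) ^ (1 / 2 : ℝ), by positivity, fun φ hφ hφc hφΩ G hG => ?_⟩
  obtain ⟨Φ, hΦ, hi, hI1, hI2, hI3⟩ := h1 φ hφ hφc hφΩ G hG
  -- The critical inequality requires a positive bound M, so ‖G‖ = 0 is treated apart; there
  -- Poincaré forces φ = 0.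
  rcases (norm_nonneg G).eq_or_lt with hG0 | hG0
  · have : φ = 0 := by
      funext x
      refine eq_zero_of_integral_norm_sq_le_zero hΦ ?_ x
      rw [← hG0] at hI3
      simpa using hI3
    rw [this]
    simp
  set Ψ : 𝓢(EuclideanSpace ℝ (Fin N), ℂ) := 𝓕 Φ with hΨ
  have hΨ2 : Integrable fun x => ‖Ψ x‖ ^ 2 := (Ψ.memLp 2).integrable_norm_pow (by norm_num)
  have hpt : ∀ ξ, ‖ξ‖ ^ (2 * s) * ‖Ψ ξ‖ ^ 2 ≤ ‖ξ‖ ^ (2 * σ) * ‖Ψ ξ‖ ^ 2 + ‖Ψ ξ‖ ^ 2 := by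
    intro ξ
    have : ‖ξ‖ ^ (2 * s) ≤ ‖ξ‖ ^ (2 * σ) + 1 := by
      rcases le_total 1 ‖ξ‖ with h | h
      · have := Real.rpow_le_rpow_of_exponent_le h (show 2 * s ≤ 2 * σ by linarith)
        linarith
      · have := Real.rpow_le_one (norm_nonneg ξ) h (show 0 ≤ 2 * s by linarith)
        have := Real.rpow_nonneg (norm_nonneg ξ) (2 * σ)
        linarith
    nlinarith [sq_nonneg ‖Ψ ξ‖]
  have his : Integrable fun ξ => ‖ξ‖ ^ (2 * s) * ‖Ψ ξ‖ ^ 2 := by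
    refine (hi.add hΨ2).mono' ?_ (Eventually.of_forall fun ξ => ?_)
    · have := Ψ.continuous
      exact (Measurable.aestronglyMeasurable (by fun_prop))
    · rw [Real.norm_of_nonneg (by positivity)]
      exact hpt ξ
  have hIs : ∫ ξ, ‖ξ‖ ^ (2 * s) * ‖Ψ ξ‖ ^ 2 ≤ 2 * C1 * ‖G‖ ^ 2 := by
    refine (integral_mono his (hi.add hΨ2) hpt).trans ?_
    have := integral_add hi hΨ2
    simp only [Pi.add_apply]
    linarith
  have h3 := h2 Φ (2 * C1 * ‖G‖ ^ 2) (by positivity) his hIs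
  have hqn : ENNReal.ofReal q ≠ 0 := by simpa using hq0
  rw [eLpNorm_eq_lintegral_rpow_enorm_toReal hqn ENNReal.ofReal_ne_top,
    ENNReal.toReal_ofReal hq0.le]
  have h4 : ∫⁻ x, ‖φ x‖ₑ ^ q = ∫⁻ x, ENNReal.ofReal (‖Φ x‖ ^ q) := by
    congr 1 with x
    rw [hΦ, Complex.norm_real, ← ofReal_norm, ENNReal.ofReal_rpow_of_nonneg (norm_nonneg _) hq0.le]
  rw [h4]
  refine (ENNReal.rpow_le_rpow h3 (by positivity)).trans (le_of_eq ?_)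
  rw [ENNReal.ofReal_rpow_of_nonneg (by positivity) (by positivity)]
  congr 1
  rw [Real.mul_rpow (by positivity) (by positivity), ← Real.rpow_mul (by positivity),
    show q / 2 * (1 / q) = 1 / 2 by field_simp, Real.mul_rpow (by positivity) (by positivity),
    ← Real.sqrt_eq_rpow (‖G‖ ^ 2), Real.sqrt_sq hG0.le, one_div q]
  ring

/-- φ is bounded by ‖φ̂‖_{L¹}, and Young's inequality is applied with the weight (1 + |ξ|)^{2σ},
whose inverse is integrable because N < 2σ. Balancing the two terms by ‖G‖ makes the bound linear in
‖G‖. -/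
theorem exists_norm_le_of_lt_two_mul (hN : 1 ≤ N) (hσ0 : 0 < σ) (hσ1 : σ < 1)
    (hΩ : Bornology.IsBounded Ω) (hσN : N < 2 * σ) :
    ∃ C : ℝ, 0 ≤ C ∧ ∀ (φ : EuclideanSpace ℝ (Fin N) → ℝ) (_ : ContDiff ℝ ∞ φ)
      (_ : HasCompactSupport φ) (_ : tsupport φ ⊆ Ω)
      (G : Lp (EuclideanSpace ℝ (Fin N)) 2 (volume : Measure (EuclideanSpace ℝ (Fin N))))
      (_ : HasSigmaGradient σ φ G) (x : EuclideanSpace ℝ (Fin N)), ‖φ x‖ ≤ C * ‖G‖ := by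
  obtain ⟨C1, hC1, h1⟩ := exists_frequency_bounds hN hσ0 hσ1 hΩ
  have hw : Integrable fun ξ : EuclideanSpace ℝ (Fin N) => (1 + ‖ξ‖) ^ (-(2 * σ)) :=
    integrable_one_add_norm (by simpa using hσN)
  set b := ∫ ξ : EuclideanSpace ℝ (Fin N), (1 + ‖ξ‖) ^ (-(2 * σ)) with hb
  have hb0 : 0 ≤ b := integral_nonneg fun ξ => by positivity
  refine ⟨(8 * C1 + b) / 2, by positivity, fun φ hφ hφc hφΩ G hG x => ?_⟩
  obtain ⟨Φ, hΦ, hi, hI1, hI2, hI3⟩ := h1 φ hφ hφc hφΩ G hG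
  rcases (norm_nonneg G).eq_or_lt with hG0 | hG0
  · rw [eq_zero_of_integral_norm_sq_le_zero hΦ (by rw [← hG0] at hI3; simpa using hI3) x, ← hG0]
    simp
  set Ψ : 𝓢(EuclideanSpace ℝ (Fin N), ℂ) := 𝓕 Φ with hΨ
  have hΨ2 : Integrable fun x => ‖Ψ x‖ ^ 2 := (Ψ.memLp 2).integrable_norm_pow (by norm_num)
  have h2 : ‖φ x‖ ≤ ∫ ξ, ‖Ψ ξ‖ := by
    have h3 : Φ x = 𝓕⁻ (Ψ : EuclideanSpace ℝ (Fin N) → ℂ) x := by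
      rw [← fourierInv_coe, hΨ, FourierTransform.fourierInv_fourier_eq]
    have h4 := norm_fourierInv_le Ψ x
    rw [← h3, hΦ, Complex.norm_real] at h4
    exact h4
  have hpt : ∀ ξ, ‖Ψ ξ‖ ≤ ‖G‖⁻¹ * 2 * (‖ξ‖ ^ (2 * σ) * ‖Ψ ξ‖ ^ 2 + ‖Ψ ξ‖ ^ 2) +
      ‖G‖ / 2 * (1 + ‖ξ‖) ^ (-(2 * σ)) := by
    intro ξ
    set w := (1 + ‖ξ‖) ^ (2 * σ) with hwd
    have hw0 : 0 < w := by positivity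
    have hw4 : w ≤ 4 * (‖ξ‖ ^ (2 * σ) + 1) := by
      have hmax : 1 + ‖ξ‖ ≤ 2 * max 1 ‖ξ‖ := by
        have := le_max_left 1 ‖ξ‖
        have := le_max_right 1 ‖ξ‖
        linarith
      have h1 : w ≤ (2 * max 1 ‖ξ‖) ^ (2 * σ) :=
        Real.rpow_le_rpow (by positivity) hmax (by linarith)
      rw [Real.mul_rpow (by norm_num) (by positivity)] at h1
      have h2 : (2 : ℝ) ^ (2 * σ) ≤ 4 := by
        calc (2 : ℝ) ^ (2 * σ) ≤ 2 ^ (2 : ℝ) :=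
              Real.rpow_le_rpow_of_exponent_le (by norm_num) (by linarith)
          _ = 4 := by norm_num
      have h3 : (max 1 ‖ξ‖) ^ (2 * σ) ≤ ‖ξ‖ ^ (2 * σ) + 1 := by
        have := Real.rpow_nonneg (norm_nonneg ξ) (2 * σ)
        rcases max_choice 1 ‖ξ‖ with h | h <;> rw [h]
        · rw [Real.one_rpow]; linarith
        · linarith
      exact h1.trans (mul_le_mul h2 h3 (by positivity) (by norm_num))
    rw [Real.rpow_neg (by positivity), ← hwd]
    have e : ‖G‖⁻¹ / 2 * (w * ‖Ψ ξ‖ ^ 2) + ‖G‖ / 2 * w⁻¹ - ‖Ψ ξ‖ =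
        (w * ‖Ψ ξ‖ - ‖G‖) ^ 2 / (2 * ‖G‖ * w) := by
      field_simp
      ring
    have h5 : 0 ≤ (w * ‖Ψ ξ‖ - ‖G‖) ^ 2 / (2 * ‖G‖ * w) := by positivity
    have h6 : ‖G‖⁻¹ / 2 * (w * ‖Ψ ξ‖ ^ 2) ≤
        ‖G‖⁻¹ / 2 * (4 * (‖ξ‖ ^ (2 * σ) + 1) * ‖Ψ ξ‖ ^ 2) := by gcongr
    linarith
  have hint : Integrable fun ξ => ‖ξ‖ ^ (2 * σ) * ‖Ψ ξ‖ ^ 2 + ‖Ψ ξ‖ ^ 2 := hi.add hΨ2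
  have h7 := integral_mono Ψ.integrable.norm
    ((hint.const_mul (‖G‖⁻¹ * 2)).add (hw.const_mul (‖G‖ / 2))) hpt
  have h8 := integral_add (hint.const_mul (‖G‖⁻¹ * 2)) (hw.const_mul (‖G‖ / 2))
  simp only [Pi.add_apply] at h7
  rw [h8, integral_const_mul, integral_const_mul, integral_add hi hΨ2, ← hb] at h7
  have h9 : ‖G‖⁻¹ * 2 * ((∫ ξ, ‖ξ‖ ^ (2 * σ) * ‖Ψ ξ‖ ^ 2) + ∫ ξ, ‖Ψ ξ‖ ^ 2) ≤
      ‖G‖⁻¹ * 2 * (2 * C1 * ‖G‖ ^ 2) := by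
    gcongr
    linarith
  have h10 : ‖G‖⁻¹ * 2 * (2 * C1 * ‖G‖ ^ 2) = 4 * C1 * ‖G‖ := by field_simp; ring
  linarith

/-- The Sobolev embedding in the exponent conjugate to `2^#`. -/
theorem exists_eLpNorm_conjugate_le (hN : 1 ≤ N) (hσ0 : 0 < σ) (hσ1 : σ < 1)
    (hΩ : Bornology.IsBounded Ω) {p : ℝ≥0∞} (hp : IsTwoSharp N σ p) :
    ∃ r : ℝ≥0∞, ENNReal.HolderConjugate p r ∧ ∃ C : ℝ, 0 ≤ C ∧
      ∀ (φ : EuclideanSpace ℝ (Fin N) → ℝ) (_ : ContDiff ℝ ∞ φ)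
      (_ : HasCompactSupport φ) (_ : tsupport φ ⊆ Ω)
      (G : Lp (EuclideanSpace ℝ (Fin N)) 2 (volume : Measure (EuclideanSpace ℝ (Fin N))))
      (_ : HasSigmaGradient σ φ G),
      eLpNorm φ r (volume.restrict Ω) ≤ ENNReal.ofReal (C * ‖G‖) := by
  have hN' : (1 : ℝ) ≤ N := by exact_mod_cast hN
  have hfin : IsFiniteMeasure (volume.restrict Ω) := ⟨by simpa using hΩ.measure_lt_top⟩
  rcases hp with ⟨h, rfl⟩ | ⟨h, q, hq, rfl⟩ | ⟨h, rfl⟩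
  · obtain ⟨C, hC, h1⟩ := exists_eLpNorm_critical_le hN hσ0 hσ1 hΩ hσ0 le_rfl h
    refine ⟨ENNReal.ofReal (2 * N / (N - 2 * σ)), ?_, C, hC, fun φ hφ hφc hφΩ G hG =>
      (eLpNorm_mono_measure _ Measure.restrict_le_self).trans (h1 φ hφ hφc hφΩ G hG)⟩
    refine Real.HolderConjugate.ennrealOfReal ?_
    have : 0 < N - 2 * σ := by linarith
    have h2 : 1 < 2 * N / (N + 2 * σ) := by rw [one_lt_div (by positivity)]; linarith
    rw [Real.holderConjugate_iff]
    refine ⟨h2, ?_⟩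
    field_simp
    ring
  -- Borderline case: the exponent r is critical for the order s = N/2 - N/r, which is below σ = N/2
  -- and is positive because r ≥ 3 > 2. Finite measure of Ω leads from r down to q.
  · set r := max q 3 with hr
    have hr3 : 3 ≤ r := le_max_right _ _
    have hqr : q ≤ r := le_max_left _ _
    set s : ℝ := N / 2 - N / r with hs
    have hNr : (N : ℝ) / r ≤ N / 3 := by gcongr
    have hNr0 : 0 < (N : ℝ) / r := by positivity
    obtain ⟨C, hC, h1⟩ := exists_eLpNorm_critical_le hN hσ0 hσ1 hΩ (s := s) (by linarith)
      (by linarith) (by linarith)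
    have hre : 2 * (N : ℝ) / (N - 2 * s) = r := by
      rw [hs, show (N : ℝ) - 2 * (N / 2 - N / r) = 2 * (N / r) by ring]
      field_simp
    rw [hre] at h1
    set V := (volume.restrict Ω) univ ^
      (1 / (ENNReal.ofReal q).toReal - 1 / (ENNReal.ofReal r).toReal) with hV
    have hVt : V ≠ ⊤ := by
      refine ENNReal.rpow_ne_top_of_nonneg ?_ (measure_ne_top _ _)
      rw [ENNReal.toReal_ofReal (by linarith), ENNReal.toReal_ofReal (by linarith), sub_nonneg]
      gcongr
    refine ⟨ENNReal.ofReal q, ?_, C * V.toReal, by positivity, fun φ hφ hφc hφΩ G hG => ?_⟩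
    · refine Real.HolderConjugate.ennrealOfReal ?_
      exact (Real.HolderConjugate.conjExponent hq).symm
    · refine (eLpNorm_le_eLpNorm_mul_rpow_measure_univ (ENNReal.ofReal_le_ofReal hqr)
        hφ.continuous.aestronglyMeasurable).trans ?_
      rw [mul_right_comm, ENNReal.ofReal_mul (by positivity), ENNReal.ofReal_toReal hVt]
      gcongr
      exact (eLpNorm_mono_measure _ Measure.restrict_le_self).trans (h1 φ hφ hφc hφΩ G hG)
  · obtain ⟨C, hC, h1⟩ := exists_norm_le_of_lt_two_mul hN hσ0 hσ1 hΩ h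
    refine ⟨⊤, inferInstance, C, hC, fun φ hφ hφc hφΩ G hG => ?_⟩
    rw [eLpNorm_exponent_top]
    exact eLpNormEssSup_le_of_ae_bound (Eventually.of_forall (h1 φ hφ hφc hφΩ G hG))

end Duality

/-! ### From test functions to H^σ_0(Ω): Poincaré, closed range, representation of f. -/

section ClosureEstimates

variable {N : ℕ} {σ : ℝ} {Ω : Set (EuclideanSpace ℝ (Fin N))}

theorem exists_lintegral_mul_testFunction_le (hN : 1 ≤ N) (hσ0 : 0 < σ) (hσ1 : σ < 1)
    (hΩ : Bornology.IsBounded Ω) {p : ℝ≥0∞} (hp : IsTwoSharp N σ p)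
    {f : EuclideanSpace ℝ (Fin N) → ℝ} (hf : MemLp f p (volume.restrict Ω)) :
    ∃ C : ℝ, 0 ≤ C ∧ ∀ q ∈ sigmaTestGraph σ Ω,
      ∫⁻ x in Ω, ‖f x * q.1 x‖ₑ ≤ ENNReal.ofReal (C * ‖q.2‖) := by
  obtain ⟨r, hr, C, hC, h1⟩ := exists_eLpNorm_conjugate_le hN hσ0 hσ1 hΩ hp
  refine ⟨(eLpNorm f p (volume.restrict Ω)).toReal * C, by positivity, ?_⟩
  rintro q ⟨φ, hφ, hφc, hφΩ, h4, h5⟩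
  have e : ∫⁻ x in Ω, ‖f x * q.1 x‖ₑ = eLpNorm (f • φ) 1 (volume.restrict Ω) := by
    rw [eLpNorm_one_eq_lintegral_enorm]
    refine lintegral_congr_ae ?_
    filter_upwards [ae_restrict_of_ae h4] with x hx
    simp [hx]
  rw [e, mul_assoc, ENNReal.ofReal_mul ENNReal.toReal_nonneg, ENNReal.ofReal_toReal hf.2.ne]
  refine (eLpNorm_smul_le_mul_eLpNorm (p := p) (q := r) (r := 1)
    hφ.continuous.aestronglyMeasurable hf.1).trans ?_
  gcongr
  exact h1 φ hφ hφc hφΩ _ h5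

/-- Fatou's lemma along an almost everywhere convergent subsequence. It bounds f v directly, without
first placing v in the conjugate Lebesgue space. -/
theorem lintegral_mul_le_of_mem_closure {f : EuclideanSpace ℝ (Fin N) → ℝ}
    (hf : AEMeasurable f (volume.restrict Ω)) {C : ℝ}
    (h : ∀ q ∈ sigmaTestGraph σ Ω, ∫⁻ x in Ω, ‖f x * q.1 x‖ₑ ≤ ENNReal.ofReal (C * ‖q.2‖))
    {q : Lp ℝ 2 (volume : Measure (EuclideanSpace ℝ (Fin N))) ×
      Lp (EuclideanSpace ℝ (Fin N)) 2 (volume : Measure (EuclideanSpace ℝ (Fin N)))}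
    (hq : q ∈ closure (sigmaTestGraph σ Ω : Set _)) :
    ∫⁻ x in Ω, ‖f x * q.1 x‖ₑ ≤ ENNReal.ofReal (C * ‖q.2‖) := by
  obtain ⟨w, hw, hlim⟩ := mem_closure_iff_seq_limit.1 hq
  have h1 : Tendsto (fun n => (w n).1) atTop (𝓝 q.1) := (continuous_fst.tendsto q).comp hlim
  have h2 : Tendsto (fun n => (w n).2) atTop (𝓝 q.2) := (continuous_snd.tendsto q).comp hlim
  obtain ⟨ns, hmono, hns⟩ := (tendstoInMeasure_of_tendsto_Lp h1).exists_seq_tendsto_ae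
  have h3 : Tendsto (fun n => ENNReal.ofReal (C * ‖(w (ns n)).2‖)) atTop
      (𝓝 (ENNReal.ofReal (C * ‖q.2‖))) :=
    (ENNReal.continuous_ofReal.tendsto _).comp
      (((h2.comp hmono.tendsto_atTop).norm).const_mul C)
  calc ∫⁻ x in Ω, ‖f x * q.1 x‖ₑ
      = ∫⁻ x in Ω, liminf (fun n => ‖f x * (w (ns n)).1 x‖ₑ) atTop := by
        refine lintegral_congr_ae ?_
        filter_upwards [ae_restrict_of_ae hns] with x hx
        exact ((hx.const_mul (f x)).enorm.liminf_eq).symm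
    _ ≤ liminf (fun n => ∫⁻ x in Ω, ‖f x * (w (ns n)).1 x‖ₑ) atTop := by
        refine lintegral_liminf_le' fun n => ?_
        exact (hf.mul (Lp.aestronglyMeasurable (w (ns n)).1).aemeasurable.restrict).enorm
    _ ≤ liminf (fun n => ENNReal.ofReal (C * ‖(w (ns n)).2‖)) atTop :=
        liminf_le_liminf (Eventually.of_forall fun n => h _ (hw (ns n)))
    _ = ENNReal.ofReal (C * ‖q.2‖) := h3.liminf_eq

/-- The fractional Poincaré inequality. -/
theorem exists_norm_le_mul_norm_of_mem_closure (hN : 1 ≤ N) (hσ0 : 0 < σ) (hσ1 : σ < 1)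
    (hΩ : Bornology.IsBounded Ω) :
    ∃ C : ℝ, 0 ≤ C ∧ ∀ q : Lp ℝ 2 (volume : Measure (EuclideanSpace ℝ (Fin N))) ×
      Lp (EuclideanSpace ℝ (Fin N)) 2 (volume : Measure (EuclideanSpace ℝ (Fin N))),
      q ∈ closure (sigmaTestGraph σ Ω : Set _) → ‖q.1‖ ≤ C * ‖q.2‖ := by
  obtain ⟨C, hC, h1⟩ := exists_frequency_bounds hN hσ0 hσ1 hΩ
  refine ⟨√C, by positivity, fun q hq => ?_⟩
  refine (isClosed_le (f := fun q : Lp ℝ 2 (volume : Measure (EuclideanSpace ℝ (Fin N))) ×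
      Lp (EuclideanSpace ℝ (Fin N)) 2 (volume : Measure (EuclideanSpace ℝ (Fin N))) => ‖q.1‖)
    (g := fun q => √C * ‖q.2‖) (by fun_prop) (by fun_prop)).closure_subset_iff.2 ?_ hq
  rintro w ⟨φ, hφ, hφc, hφΩ, h4, h5⟩
  obtain ⟨Φ, hΦ, -, -, -, h⟩ := h1 φ hφ hφc hφΩ _ h5
  have e : ∫ x, ‖Φ x‖ ^ 2 = ‖w.1‖ ^ 2 := by
    rw [← integral_norm_sq_Lp]
    refine integral_congr_ae ?_
    filter_upwards [h4] with x hx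
    rw [hx, hΦ, Complex.norm_real]
  rw [e] at h
  have := Real.sqrt_le_sqrt h
  rwa [Real.sqrt_sq (norm_nonneg _), Real.sqrt_mul hC.le, Real.sqrt_sq (norm_nonneg _)] at this

/-- By uniqueness of distributional gradients, the chosen gradient is the one witnessing membership
in the space. -/
theorem SigmaSobolev.mem_closure_graph (u : SigmaSobolev σ Ω) :
    (u.toL2, u.grad) ∈ closure (sigmaTestGraph σ Ω : Set _) := by
  obtain ⟨G, hG, hcl⟩ := u.2
  have : u.grad = G := Lp.ext (u.hasSigmaGradient_grad.unique hG)
  rw [this]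
  exact hcl

theorem exists_sigmaSobolev_of_mem_closure (hN : 1 ≤ N) (hσ0 : 0 < σ) (hσ1 : σ < 1)
    (hΩo : IsOpen Ω) (hΩ : Bornology.IsBounded Ω)
    {q : Lp ℝ 2 (volume : Measure (EuclideanSpace ℝ (Fin N))) ×
      Lp (EuclideanSpace ℝ (Fin N)) 2 (volume : Measure (EuclideanSpace ℝ (Fin N)))}
    (hq : q ∈ closure (sigmaTestGraph σ Ω : Set _)) :
    ∃ u : SigmaSobolev σ Ω, u.toL2 = q.1 ∧ u.grad = q.2 := by
  have hG := (hasSigmaGradient_of_mem_closure hN hσ0 hσ1 hΩo hΩ hq).1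
  refine ⟨⟨q.1, q.2, hG, hq⟩, rfl, ?_⟩
  exact Lp.ext ((SigmaSobolev.hasSigmaGradient_grad _).unique hG)

theorem SigmaSobolev.grad_injective (hN : 1 ≤ N) (hσ0 : 0 < σ) (hσ1 : σ < 1)
    (hΩ : Bornology.IsBounded Ω) :
    Function.Injective (SigmaSobolev.grad : SigmaSobolev σ Ω →ₗ[ℝ] _) := by
  obtain ⟨C, -, hC⟩ := exists_norm_le_mul_norm_of_mem_closure hN hσ0 hσ1 hΩ
  rw [← LinearMap.ker_eq_bot, LinearMap.ker_eq_bot']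
  intro u hu
  have h := hC _ u.mem_closure_graph
  simp only [hu, norm_zero, mul_zero] at h
  have h0 : u.toL2 = 0 := norm_le_zero_iff.1 h
  exact Subtype.ext h0

/-- By Poincaré, convergence of the gradients makes the functions Cauchy in L². The limit pair lies
in the closed graph, whose points are functions of the space paired with their gradients. -/
theorem SigmaSobolev.isClosed_range_grad (hN : 1 ≤ N) (hσ0 : 0 < σ) (hσ1 : σ < 1)
    (hΩo : IsOpen Ω) (hΩ : Bornology.IsBounded Ω) :
    IsClosed (LinearMap.range (SigmaSobolev.grad : SigmaSobolev σ Ω →ₗ[ℝ] _) :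
      Set (Lp (EuclideanSpace ℝ (Fin N)) 2
        (volume : Measure (EuclideanSpace ℝ (Fin N))))) := by
  obtain ⟨C, hC0, hC⟩ := exists_norm_le_mul_norm_of_mem_closure hN hσ0 hσ1 hΩ
  refine IsSeqClosed.isClosed fun G H hG hlim => ?_
  choose u hu using hG
  have hcauchy : CauchySeq fun n => (u n).toL2 := by
    rw [Metric.cauchySeq_iff']
    intro ε hε
    obtain ⟨n0, hn0⟩ := Metric.cauchySeq_iff'.1 hlim.cauchySeq (ε / (C + 1)) (by positivity)
    refine ⟨n0, fun n hn => ?_⟩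
    have h1 := hC _ (u n - u n0).mem_closure_graph
    rw [map_sub, map_sub, hu, hu, ← dist_eq_norm, ← dist_eq_norm] at h1
    have h2 := hn0 n hn
    rw [lt_div_iff₀ (by positivity)] at h2
    have : 0 ≤ dist (G n) (G n0) := dist_nonneg
    linarith
  obtain ⟨v, hv⟩ := cauchySeq_tendsto_of_complete hcauchy
  have hmem : (v, H) ∈ closure (sigmaTestGraph σ Ω : Set _) := by
    refine isClosed_closure.mem_of_tendsto (hv.prodMk_nhds hlim) (Eventually.of_forall fun n => ?_)
    rw [← hu n]
    exact (u n).mem_closure_graph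
  obtain ⟨w, -, hw⟩ := exists_sigmaSobolev_of_mem_closure hN hσ0 hσ1 hΩo hΩ hmem
  exact ⟨w, hw⟩

/-- T ∘ D⁻¹ is bounded on the range of D; Hahn–Banach extends it to Y and Riesz represents it. -/
theorem exists_inner_eq_of_norm_le {V Y : Type*} [AddCommGroup V] [Module ℝ V]
    [NormedAddCommGroup Y] [InnerProductSpace ℝ Y] [CompleteSpace Y] {D : V →ₗ[ℝ] Y}
    (hD : Function.Injective D) (T : V →ₗ[ℝ] ℝ) {C : ℝ} (hT : ∀ v, ‖T v‖ ≤ C * ‖D v‖) :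
    ∃ F : Y, ∀ v, T v = inner ℝ F (D v) := by
  set e := LinearEquiv.ofInjective D hD
  have he : ∀ y, D (e.symm y) = y := fun y => congrArg Subtype.val (e.apply_symm_apply y)
  set S : StrongDual ℝ (LinearMap.range D) := (T.comp e.symm.toLinearMap).mkContinuous C
    fun y => by
      have h1 := hT (e.symm y)
      rw [he] at h1
      exact h1
  obtain ⟨g, hg, -⟩ := exists_extension_norm_eq _ S
  refine ⟨(InnerProductSpace.toDual ℝ Y).symm g, fun v => ?_⟩
  rw [InnerProductSpace.toDual_symm_apply]
  have h1 := hg (e v)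
  have h2 : S (e v) = T v := by
    change T (e.symm (e v)) = T v
    rw [e.symm_apply_apply]
  rw [h2] at h1
  exact h1.symm

/-- The functional `v ↦ ∫_Ω f v` is represented by an element of `L²(ℝ^N)^N`. -/
theorem exists_inner_grad_eq_setIntegral (hN : 1 ≤ N) (hσ0 : 0 < σ) (hσ1 : σ < 1)
    (hΩ : Bornology.IsBounded Ω) {p : ℝ≥0∞} (hp : IsTwoSharp N σ p)
    {f : EuclideanSpace ℝ (Fin N) → ℝ} (hf : MemLp f p (volume.restrict Ω)) :
    ∃ F : Lp (EuclideanSpace ℝ (Fin N)) 2 (volume : Measure (EuclideanSpace ℝ (Fin N))),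
      ∀ v : SigmaSobolev σ Ω, IntegrableOn (fun x => f x * v.toL2 x) Ω ∧
        ∫ x in Ω, f x * v.toL2 x = inner ℝ F v.grad := by
  obtain ⟨C, hC0, hC⟩ := exists_lintegral_mul_testFunction_le hN hσ0 hσ1 hΩ hp hf
  have hbd : ∀ v : SigmaSobolev σ Ω,
      ∫⁻ x in Ω, ‖f x * v.toL2 x‖ₑ ≤ ENNReal.ofReal (C * ‖v.grad‖) := by
    intro v
    have h := lintegral_mul_le_of_mem_closure (q := (v.toL2, v.grad)) hf.1.aemeasurable hC
      v.mem_closure_graph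
    exact h
  have hint : ∀ v : SigmaSobolev σ Ω, IntegrableOn (fun x => f x * v.toL2 x) Ω := fun v =>
    ⟨hf.1.mul (Lp.aestronglyMeasurable v.toL2).restrict, (hbd v).trans_lt ENNReal.ofReal_lt_top⟩
  have hle : ∀ v : SigmaSobolev σ Ω, ‖∫ x in Ω, f x * v.toL2 x‖ ≤ C * ‖v.grad‖ := by
    intro v
    refine (norm_integral_le_lintegral_norm _).trans ?_
    refine ENNReal.toReal_le_of_le_ofReal (by positivity) ?_
    simpa only [ofReal_norm] using hbd v
  have hadd : ∀ v w : SigmaSobolev σ Ω, ∫ x in Ω, f x * (v + w).toL2 x =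
      (∫ x in Ω, f x * v.toL2 x) + ∫ x in Ω, f x * w.toL2 x := by
    intro v w
    rw [← integral_add (hint v) (hint w)]
    refine integral_congr_ae ?_
    rw [map_add]
    filter_upwards [ae_restrict_of_ae (Lp.coeFn_add v.toL2 w.toL2)] with x hx
    rw [hx, Pi.add_apply, mul_add]
  have hsmul : ∀ (c : ℝ) (v : SigmaSobolev σ Ω), ∫ x in Ω, f x * (c • v).toL2 x =
      c * ∫ x in Ω, f x * v.toL2 x := by
    intro c v
    rw [← integral_const_mul]
    refine integral_congr_ae ?_
    rw [map_smul]
    filter_upwards [ae_restrict_of_ae (Lp.coeFn_smul c v.toL2)] with x hx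
    rw [hx, Pi.smul_apply, smul_eq_mul]
    ring
  set T : SigmaSobolev σ Ω →ₗ[ℝ] ℝ :=
    { toFun := fun v => ∫ x in Ω, f x * v.toL2 x
      map_add' := hadd
      map_smul' := hsmul } with hT
  obtain ⟨F, hF⟩ := exists_inner_eq_of_norm_le (SigmaSobolev.grad_injective hN hσ0 hσ1 hΩ) T hle
  exact ⟨F, fun v => ⟨hint v, hF v⟩⟩

end ClosureEstimates

/-! ### Variational inequalities and decreasing convex sets in Hilbert space. -/

section HilbertSpace

variable {Y : Type*} [NormedAddCommGroup Y] [InnerProductSpace ℝ Y] [CompleteSpace Y]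

theorem exists_projection_convex {C : Set Y} (hne : C.Nonempty) (hcl : IsClosed C)
    (hcv : Convex ℝ C) (x : Y) : ∃ y ∈ C, ∀ w ∈ C, inner ℝ (x - y) (w - y) ≤ 0 := by
  obtain ⟨y, hy, h⟩ := exists_norm_eq_iInf_of_complete_convex hne hcl.isComplete hcv x
  exact ⟨y, hy, (norm_eq_iInf_iff_real_inner_le_zero hcv hy).1 h⟩

/-- Stampacchia's theorem for Lipschitz, strongly monotone operators. -/
theorem exists_variational_inequality {C : Set Y} (hne : C.Nonempty) (hcl : IsClosed C)
    (hcv : Convex ℝ C) {T : Y → Y} {m L : ℝ} (hm : 0 < m)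
    (hmono : ∀ x y, m * ‖x - y‖ ^ 2 ≤ inner ℝ (T x - T y) (x - y))
    (hlip : ∀ x y, ‖T x - T y‖ ≤ L * ‖x - y‖) :
    ∃ u ∈ C, ∀ v ∈ C, 0 ≤ inner ℝ (T u) (v - u) := by
  choose P hPC hP using exists_projection_convex hne hcl hcv
  -- The projection is nonexpansive, so x ↦ P(x - tTx) contracts as soon as x ↦ x - tTx does.
  have hPn : ∀ x y, ‖P x - P y‖ ≤ ‖x - y‖ := by
    intro x y
    have h1 := hP x (P y) (hPC y)
    have h2 := hP y (P x) (hPC x)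
    have h3 : ‖P x - P y‖ ^ 2 ≤ inner ℝ (x - y) (P x - P y) := by
      have e : inner ℝ (x - y) (P x - P y) - ‖P x - P y‖ ^ 2 =
          -(inner ℝ (x - P x) (P y - P x)) - inner ℝ (y - P y) (P x - P y) := by
        rw [← real_inner_self_eq_norm_sq]
        simp only [inner_sub_left, inner_sub_right]
        ring
      linarith
    have h4 := real_inner_le_norm (x - y) (P x - P y)
    rcases (norm_nonneg (P x - P y)).eq_or_lt with h | h
    · rw [← h]; exact norm_nonneg _
    · exact le_of_mul_le_mul_right (by nlinarith) h
  -- Enlarging L to at least m ensures L' > 0 and 1 - m²/L'² ≥ 0.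
  set L' := max L m with hL'
  have hLm : m ≤ L' := le_max_right _ _
  have hL0 : 0 < L' := hm.trans_le hLm
  -- The minimiser of 1 - 2tm + t²L'², with minimum K² = 1 - m²/L'².
  set t := m / L' ^ 2 with ht
  have ht0 : 0 < t := by positivity
  set K := √(1 - m ^ 2 / L' ^ 2) with hK
  have hK0 : 0 ≤ 1 - m ^ 2 / L' ^ 2 := by
    rw [sub_nonneg, div_le_one (by positivity)]
    exact pow_le_pow_left₀ hm.le hLm 2
  have hK1 : K < 1 := by
    rw [hK, Real.sqrt_lt' one_pos]
    have : 0 < m ^ 2 / L' ^ 2 := by positivity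
    linarith
  have hcontr : ContractingWith ⟨K, Real.sqrt_nonneg _⟩ fun x => P (x - t • T x) := by
    refine ⟨hK1, LipschitzWith.of_dist_le_mul fun x y => ?_⟩
    rw [dist_eq_norm, dist_eq_norm]
    refine (hPn _ _).trans ?_
    change _ ≤ K * ‖x - y‖
    refine le_of_sq_le_sq ?_ (by positivity)
    have e : x - t • T x - (y - t • T y) = (x - y) - t • (T x - T y) := by
      rw [smul_sub]; abel
    rw [e, norm_sub_sq_real, mul_pow, hK, Real.sq_sqrt hK0, real_inner_smul_right,
      real_inner_comm, norm_smul, Real.norm_of_nonneg ht0.le, mul_pow]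
    have h1 := hmono x y
    have h2 : ‖T x - T y‖ ^ 2 ≤ L' ^ 2 * ‖x - y‖ ^ 2 := by
      rw [← mul_pow]
      refine pow_le_pow_left₀ (norm_nonneg _) ((hlip x y).trans ?_) 2
      exact mul_le_mul_of_nonneg_right (le_max_left _ _) (norm_nonneg _)
    have h3 : t * (m * ‖x - y‖ ^ 2) = m ^ 2 / L' ^ 2 * ‖x - y‖ ^ 2 := by rw [ht]; ring
    have h4 : t ^ 2 * (L' ^ 2 * ‖x - y‖ ^ 2) = m ^ 2 / L' ^ 2 * ‖x - y‖ ^ 2 := by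
      rw [ht]; field_simp
    have h5 := mul_le_mul_of_nonneg_left h1 ht0.le
    have h6 := mul_le_mul_of_nonneg_left h2 (sq_nonneg t)
    rw [h3] at h5
    rw [h4] at h6
    linarith
  have hfix : P (ContractingWith.fixedPoint _ hcontr - t • T (ContractingWith.fixedPoint _ hcontr))
      = ContractingWith.fixedPoint _ hcontr := hcontr.fixedPoint_isFixedPt
  set u := ContractingWith.fixedPoint _ hcontr
  have huC : u ∈ C := by rw [← hfix]; exact hPC _
  refine ⟨u, huC, fun v hv => ?_⟩
  have h := hP (u - t • T u) v hv
  rw [hfix, sub_sub_cancel_left, inner_neg_left, real_inner_smul_left] at h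
  by_contra! hneg
  nlinarith

/-- A decreasing sequence of nonempty bounded closed convex sets has a common point. -/
theorem exists_mem_of_antitone_convex {D : ℕ → Set Y} (hD : Antitone D)
    (hne : ∀ n, (D n).Nonempty) (hcl : ∀ n, IsClosed (D n)) (hcv : ∀ n, Convex ℝ (D n))
    {R : ℝ} (hR : ∀ n, ∀ x ∈ D n, ‖x‖ ≤ R) : ∃ x, ∀ n, x ∈ D n := by
  -- The points of least norm. Their norms increase and are bounded, and `key` turns this into a
  -- Cauchy sequence; this replaces weak compactness.
  choose x hx hmin using fun n => exists_projection_convex (hne n) (hcl n) (hcv n) 0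
  have key : ∀ n k, n ≤ k → ‖x k - x n‖ ^ 2 ≤ ‖x k‖ ^ 2 - ‖x n‖ ^ 2 := by
    intro n k hnk
    have h := hmin n (x k) (hD hnk (hx k))
    rw [zero_sub, inner_neg_left, inner_sub_right, real_inner_self_eq_norm_sq] at h
    rw [norm_sub_sq_real, real_inner_comm]
    linarith
  have hmono : Monotone fun n => ‖x n‖ ^ 2 := fun n k hnk => by
    have h1 := key n k hnk
    have h2 := sq_nonneg ‖x k - x n‖
    simp only
    linarith
  have hbdd : BddAbove (range fun n => ‖x n‖ ^ 2) := by
    refine ⟨R ^ 2, ?_⟩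
    rintro _ ⟨n, rfl⟩
    exact pow_le_pow_left₀ (norm_nonneg _) (hR n _ (hx n)) 2
  have hc := (tendsto_atTop_ciSup hmono hbdd).cauchySeq
  have hcx : CauchySeq x := by
    rw [Metric.cauchySeq_iff'] at hc ⊢
    intro ε hε
    obtain ⟨n, hn⟩ := hc (ε ^ 2) (by positivity)
    refine ⟨n, fun k hk => ?_⟩
    have h1 := hn k hk
    rw [Real.dist_eq] at h1
    have h2 := key n k hk
    have h3 := le_abs_self (‖x k‖ ^ 2 - ‖x n‖ ^ 2)
    rw [dist_eq_norm]
    exact lt_of_pow_lt_pow_left₀ 2 hε.le (by linarith)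
  obtain ⟨y, hy⟩ := cauchySeq_tendsto_of_complete hcx
  refine ⟨y, fun n => (hcl n).mem_of_tendsto hy ?_⟩
  filter_upwards [eventually_ge_atTop n] with k hk
  exact hD hk (hx k)

/-- If `⟪w, x - u⟫ ≥ 0` on `X ∩ C`, for closed convex sets `X` and `C`, then `⟪w, x - u⟫` is almost
nonnegative at the points of bounded subsets of `X` that are close to `C`. -/
theorem exists_pos_inner_gt_of_mem_cthickening {C X : Set Y} (hC : IsClosed C) (hCv : Convex ℝ C)
    (hX : IsClosed X) (hXv : Convex ℝ X) {w u : Y}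
    (hw : ∀ x ∈ X ∩ C, 0 ≤ inner ℝ w (x - u)) (R : ℝ) {η : ℝ} (hη : 0 < η) :
    ∃ δ > 0, ∀ x ∈ X, ‖x‖ ≤ R → x ∈ Metric.cthickening δ C → -η < inner ℝ w (x - u) := by
  by_contra! hcon
  -- The counterexamples at scale δ = 1/(n+1). All constraints, including the thickening of C, are
  -- closed and convex, so a common point exists; it lies in X ∩ C and contradicts `hw`.
  set D : ℕ → Set Y := fun n => (X ∩ Metric.closedBall 0 R) ∩
    (Metric.cthickening (1 / ((n : ℝ) + 1)) C ∩ {x | inner ℝ w x ≤ -η + inner ℝ w u})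
  have hD : Antitone D := by
    intro n k hnk
    refine inter_subset_inter_right _ (inter_subset_inter_left _
      (Metric.cthickening_mono ?_ _))
    exact one_div_le_one_div_of_le (by positivity) (by gcongr)
  have hDne : ∀ n, (D n).Nonempty := by
    intro n
    obtain ⟨x, hxX, hxR, hxC, hxw⟩ := hcon (1 / ((n : ℝ) + 1)) (by positivity)
    refine ⟨x, ⟨hxX, by simpa using hxR⟩, hxC, ?_⟩
    rw [inner_sub_right] at hxw
    change inner ℝ w x ≤ _
    linarith
  have hDc : ∀ n, IsClosed (D n) := fun n => (hX.inter Metric.isClosed_closedBall).inter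
    (Metric.isClosed_cthickening.inter (isClosed_le (by fun_prop) continuous_const))
  have hDv : ∀ n, Convex ℝ (D n) := fun n => (hXv.inter (convex_closedBall _ _)).inter
    ((hCv.cthickening _).inter (convex_halfSpace_le (innerSL ℝ w).toLinearMap.isLinear _))
  have hDR : ∀ n, ∀ x ∈ D n, ‖x‖ ≤ R := fun n x hx => by simpa using hx.1.2
  obtain ⟨x, hx⟩ := exists_mem_of_antitone_convex hD hDne hDc hDv hDR
  have hxC : x ∈ C := by
    rw [← hC.closure_eq, Metric.closure_eq_iInter_cthickening, mem_iInter₂]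
    intro δ hδ
    obtain ⟨n, hn⟩ := exists_nat_one_div_lt hδ
    exact Metric.cthickening_mono hn.le _ (hx n).2.1
  have h1 := hw x ⟨(hx 0).1.1, hxC⟩
  have h2 : inner ℝ w x ≤ -η + inner ℝ w u := (hx 0).2.2
  rw [inner_sub_right] at h1
  linarith

end HilbertSpace

/-! ### Pointwise properties of the penalty. -/

section Penalty

variable {ε : ℝ}

theorem penalty_eq (hε : 0 < ε) (s : ℝ) :
    penalty ε s = Real.exp (min (max s 0) (1 / ε) / ε) - 1 := by
  have h0 : 0 < 1 / ε := by positivity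
  unfold penalty
  split_ifs with h1 h2
  · rw [max_eq_right h1.le, min_eq_left h0.le]
    simp
  · rw [max_eq_left (not_lt.1 h1), min_eq_left h2]
  · rw [max_eq_left (not_lt.1 h1), min_eq_right (not_le.1 h2).le]
    congr 2
    field_simp

theorem continuous_penalty (hε : 0 < ε) : Continuous (penalty ε) := by
  rw [funext (penalty_eq hε)]
  fun_prop

theorem penalty_mono (hε : 0 < ε) : Monotone (penalty ε) := by
  intro s t hst
  rw [penalty_eq hε, penalty_eq hε]
  gcongr

theorem penalty_nonneg (hε : 0 < ε) (s : ℝ) : 0 ≤ penalty ε s := by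
  rw [penalty_eq hε, sub_nonneg]
  exact Real.one_le_exp (by positivity)

theorem penalty_le (hε : 0 < ε) (s : ℝ) : penalty ε s ≤ Real.exp (1 / ε / ε) := by
  rw [penalty_eq hε]
  have : Real.exp (min (max s 0) (1 / ε) / ε) ≤ Real.exp (1 / ε / ε) := by
    gcongr
    exact min_le_right _ _
  linarith

theorem penalty_eq_of_le (hε : 0 < ε) {s t : ℝ} (hs : 1 / ε ≤ s) (ht : 1 / ε ≤ t) :
    penalty ε s = penalty ε t := by
  have h0 : 0 < 1 / ε := by positivity
  rw [penalty_eq hε, penalty_eq hε, min_eq_right (hs.trans (le_max_left _ _)),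
    min_eq_right (ht.trans (le_max_left _ _))]

/-- Clamping is 1-Lipschitz, and e^x - e^y ≤ e^x (x - y). -/
theorem penalty_sub_le (hε : 0 < ε) {s t : ℝ} (hst : s ≤ t) :
    penalty ε t - penalty ε s ≤ Real.exp (1 / ε / ε) / ε * (t - s) := by
  rw [penalty_eq hε, penalty_eq hε]
  set a := min (max t 0) (1 / ε) with ha
  set b := min (max s 0) (1 / ε) with hb
  have hab : a - b ≤ t - s := by
    rw [ha, hb, min_def, min_def, max_def, max_def]
    split_ifs <;> linarith
  have h1 : Real.exp (a / ε) - Real.exp (b / ε) ≤ Real.exp (a / ε) * (a / ε - b / ε) := by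
    have h2 := Real.add_one_le_exp (b / ε - a / ε)
    have h3 : Real.exp (b / ε) = Real.exp (a / ε) * Real.exp (b / ε - a / ε) := by
      rw [← Real.exp_add]; congr 1; ring
    rw [h3]
    have := mul_le_mul_of_nonneg_left h2 (Real.exp_pos (a / ε)).le
    nlinarith
  have h4 : Real.exp (a / ε) ≤ Real.exp (1 / ε / ε) := by
    gcongr
    exact min_le_right _ _
  have hba : b ≤ a := by rw [ha, hb]; gcongr
  have h5 : a / ε - b / ε = (a - b) / ε := by ring
  have h6 : 0 ≤ (a - b) / ε := div_nonneg (by linarith) hε.le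
  calc Real.exp (a / ε) - 1 - (Real.exp (b / ε) - 1)
      ≤ Real.exp (a / ε) * ((a - b) / ε) := by rw [← h5]; linarith
    _ ≤ Real.exp (1 / ε / ε) * ((t - s) / ε) :=
        mul_le_mul h4 (by gcongr) h6 (Real.exp_pos _).le
    _ = _ := by ring

/-- Let s = r - g > 0. If s ≤ 1/ε, then k_ε(s) ≥ s/ε and r² ≥ sν, because r ≥ s + ν. If s ≥ 1/ε,
then k_ε(s) ≥ 1/ε², so εk_ε(s) ≥ 1 as ε < 1, and s² ≤ r². -/
theorem sq_posPart_le_penalty (hε : 0 < ε) (hε1 : ε < 1) {ν g r : ℝ} (hν : 0 < ν) (hg : ν ≤ g) :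
    (max (r - g) 0) ^ 2 ≤ ε * (1 + 1 / ν) * (penalty ε (r - g) * r ^ 2) := by
  set s := r - g with hs
  have hk := penalty_nonneg hε s
  rcases le_total s 0 with h0 | h0
  · rw [max_eq_right h0, zero_pow two_ne_zero]
    positivity
  rw [max_eq_left h0]
  have hr : s + ν ≤ r := by rw [hs]; linarith
  rcases le_total s (1 / ε) with h1 | h1
  · have h2 : s / ε ≤ penalty ε s := by
      rw [penalty_eq hε, max_eq_left h0, min_eq_left h1]
      have := Real.add_one_le_exp (s / ε)
      linarith
    have h3 : s * ν ≤ r ^ 2 := by nlinarith [mul_nonneg h0 hν.le]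
    have h4 : s / ε * (s * ν) ≤ penalty ε s * r ^ 2 :=
      mul_le_mul h2 h3 (by positivity) hk
    have h5 : s ^ 2 = ε * (1 / ν) * (s / ε * (s * ν)) := by field_simp
    have h6 : 0 ≤ penalty ε s * r ^ 2 := by positivity
    calc s ^ 2 = ε * (1 / ν) * (s / ε * (s * ν)) := h5
      _ ≤ ε * (1 / ν) * (penalty ε s * r ^ 2) := by gcongr
      _ ≤ _ := by gcongr; linarith
  · have h2 : 1 / ε / ε ≤ penalty ε s := by
      rw [penalty_eq hε, max_eq_left h0, min_eq_right h1]
      have := Real.add_one_le_exp (1 / ε / ε)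
      linarith
    have h3 : s ^ 2 ≤ r ^ 2 := pow_le_pow_left₀ h0 (by linarith) 2
    have h4 : 1 ≤ ε * penalty ε s := by
      have h5 : 1 / ε ≤ ε * penalty ε s := by
        have := mul_le_mul_of_nonneg_left h2 hε.le
        rwa [mul_div_cancel₀ _ hε.ne'] at this
      exact ((one_le_div hε).2 hε1.le).trans h5
    have h6 : (0 : ℝ) ≤ 1 / ν := by positivity
    calc s ^ 2 ≤ 1 * r ^ 2 := by linarith
      _ ≤ (ε * penalty ε s) * r ^ 2 := by gcongr
      _ = ε * 1 * (penalty ε s * r ^ 2) := by ring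
      _ ≤ _ := by gcongr; linarith

variable {E : Type*} [NormedAddCommGroup E] [InnerProductSpace ℝ E]

/-- The increment of the coefficient is paired with the shorter vector η. Either the penalty is
saturated at both points and the increment vanishes, or |η| ≤ |M| + 1/ε; this is where the upper
bound on g enters. The constant blows up as ε → 0, which is harmless as it serves existence only. -/
theorem norm_penalty_smul_sub_le (hε : 0 < ε) {g M : ℝ} (hgM : g ≤ M) (ξ η : E) :
    ‖penalty ε (‖ξ‖ - g) • ξ - penalty ε (‖η‖ - g) • η‖ ≤
      (Real.exp (1 / ε / ε) + Real.exp (1 / ε / ε) / ε * (|M| + 1 / ε)) * ‖ξ - η‖ := by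
  wlog h : ‖η‖ ≤ ‖ξ‖ generalizing ξ η
  · have := this η ξ (not_le.1 h).le
    rwa [norm_sub_rev, norm_sub_rev η] at this
  have hk0 := penalty_nonneg hε (‖ξ‖ - g)
  have hkm : penalty ε (‖η‖ - g) ≤ penalty ε (‖ξ‖ - g) := penalty_mono hε (by linarith)
  have e : penalty ε (‖ξ‖ - g) • ξ - penalty ε (‖η‖ - g) • η =
      penalty ε (‖ξ‖ - g) • (ξ - η) + (penalty ε (‖ξ‖ - g) - penalty ε (‖η‖ - g)) • η := by
    rw [smul_sub, sub_smul]; abel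
  rw [e, add_mul]
  refine (norm_add_le _ _).trans (add_le_add ?_ ?_)
  · rw [norm_smul, Real.norm_of_nonneg hk0]
    exact mul_le_mul_of_nonneg_right (penalty_le hε _) (norm_nonneg _)
  · rw [norm_smul, Real.norm_of_nonneg (by linarith)]
    rcases le_total (1 / ε) (‖η‖ - g) with h1 | h1
    · rw [penalty_eq_of_le hε (h1.trans (by linarith)) h1, sub_self, zero_mul]
      positivity
    · have h2 : ‖η‖ ≤ |M| + 1 / ε := by have := le_abs_self M; linarith
      have h3 := penalty_sub_le hε (show ‖η‖ - g ≤ ‖ξ‖ - g by linarith)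
      have h4 : ‖ξ‖ - g - (‖η‖ - g) ≤ ‖ξ - η‖ := by
        have := norm_sub_norm_le ξ η
        linarith
      calc (penalty ε (‖ξ‖ - g) - penalty ε (‖η‖ - g)) * ‖η‖
          ≤ (Real.exp (1 / ε / ε) / ε * ‖ξ - η‖) * (|M| + 1 / ε) := by
            refine mul_le_mul (h3.trans ?_) h2 (norm_nonneg _) (by positivity)
            gcongr
        _ = _ := by ring

/-- Cauchy–Schwarz reduces to the radial profile r ↦ k_ε(r - g) r, which is nondecreasing on r ≥ 0.
-/
theorem inner_penalty_smul_sub_nonneg (hε : 0 < ε) (g : ℝ) (ξ η : E) :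
    0 ≤ inner ℝ (penalty ε (‖ξ‖ - g) • ξ - penalty ε (‖η‖ - g) • η) (ξ - η) := by
  set a := penalty ε (‖ξ‖ - g) with ha
  set b := penalty ε (‖η‖ - g) with hb
  have ha0 : 0 ≤ a := penalty_nonneg hε _
  have hb0 : 0 ≤ b := penalty_nonneg hε _
  have e : inner ℝ (a • ξ - b • η) (ξ - η) =
      a * ‖ξ‖ ^ 2 + b * ‖η‖ ^ 2 - (a + b) * inner ℝ ξ η := by
    simp only [inner_sub_left, inner_sub_right, real_inner_smul_left, real_inner_self_eq_norm_sq,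
      real_inner_comm ξ η]
    ring
  have h1 := real_inner_le_norm ξ η
  have h2 : (a + b) * inner ℝ ξ η ≤ (a + b) * (‖ξ‖ * ‖η‖) := by gcongr
  have h3 : 0 ≤ (a * ‖ξ‖ - b * ‖η‖) * (‖ξ‖ - ‖η‖) := by
    rcases le_total ‖η‖ ‖ξ‖ with h | h
    · have hab : b ≤ a := penalty_mono hε (by linarith)
      refine mul_nonneg (sub_nonneg.2 (mul_le_mul hab h (norm_nonneg _) ha0)) (by linarith)
    · have hab : a ≤ b := penalty_mono hε (by linarith)
      refine mul_nonneg_of_nonpos_of_nonpos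
        (sub_nonpos.2 (mul_le_mul hab h (norm_nonneg _) hb0)) (by linarith)
  rw [e]
  nlinarith

theorem inner_penalty_smul_sub_nonneg_of_norm_le (hε : 0 < ε) {g : ℝ} {ξ η : E} (hη : ‖η‖ ≤ g) :
    0 ≤ inner ℝ (penalty ε (‖ξ‖ - g) • ξ) (ξ - η) := by
  have h := inner_penalty_smul_sub_nonneg hε g ξ η
  have h0 : penalty ε (‖η‖ - g) = 0 :=
    le_antisymm (by
      have := penalty_mono hε (show ‖η‖ - g ≤ 0 by linarith)
      have h1 : penalty ε 0 = 0 := by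
        rw [penalty_eq hε, max_self, min_eq_left (by positivity)]; simp
      rwa [h1] at this) (penalty_nonneg hε _)
  rwa [h0, zero_smul, sub_zero] at h

end Penalty

/-! ### Superposition operators on L². -/

section Nemytskii

variable {N : ℕ}

/-- The superposition operator on `L²` of a Lipschitz monotone field. -/
theorem exists_nemytskii {a : EuclideanSpace ℝ (Fin N) → EuclideanSpace ℝ (Fin N) →
      EuclideanSpace ℝ (Fin N)} {m L : ℝ}
    (hmeas : ∀ G : Lp (EuclideanSpace ℝ (Fin N)) 2 (volume : Measure (EuclideanSpace ℝ (Fin N))),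
      AEStronglyMeasurable fun x => a x (G x))
    (h0 : ∀ᵐ x, a x 0 = 0) (hlip : ∀ᵐ x, ∀ ξ η, ‖a x ξ - a x η‖ ≤ L * ‖ξ - η‖)
    (hmono : ∀ᵐ x, ∀ ξ η, m * ‖ξ - η‖ ^ 2 ≤ inner ℝ (a x ξ - a x η) (ξ - η)) :
    ∃ T : Lp (EuclideanSpace ℝ (Fin N)) 2 (volume : Measure (EuclideanSpace ℝ (Fin N))) →
      Lp (EuclideanSpace ℝ (Fin N)) 2 (volume : Measure (EuclideanSpace ℝ (Fin N))),
      (∀ G, T G =ᵐ[volume] fun x => a x (G x)) ∧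
      (∀ G H, ‖T G - T H‖ ≤ L * ‖G - H‖) ∧
      ∀ G H, m * ‖G - H‖ ^ 2 ≤ inner ℝ (T G - T H) (G - H) := by
  have hmem : ∀ G : Lp (EuclideanSpace ℝ (Fin N)) 2
      (volume : Measure (EuclideanSpace ℝ (Fin N))), MemLp (fun x => a x (G x)) 2 := by
    intro G
    refine MemLp.of_le_mul (c := L) (Lp.memLp G) (hmeas G) ?_
    filter_upwards [h0, hlip] with x hx0 hx
    simpa [hx0] using hx (G x) 0
  have hsub : ∀ G H : Lp (EuclideanSpace ℝ (Fin N)) 2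
      (volume : Measure (EuclideanSpace ℝ (Fin N))),
      ∀ᵐ x, ((hmem G).toLp - (hmem H).toLp) x = a x (G x) - a x (H x) ∧ (G - H) x = G x - H x := by
    intro G H
    filter_upwards [Lp.coeFn_sub (hmem G).toLp (hmem H).toLp, Lp.coeFn_sub G H,
      (hmem G).coeFn_toLp, (hmem H).coeFn_toLp] with x h1 h2 h3 h4
    rw [h1, h2, Pi.sub_apply, Pi.sub_apply, h3, h4]
    exact ⟨rfl, rfl⟩
  refine ⟨fun G => (hmem G).toLp, fun G => (hmem G).coeFn_toLp, fun G H => ?_, fun G H => ?_⟩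
  · refine Lp.norm_le_mul_norm_of_ae_le_mul ?_
    filter_upwards [hsub G H, hlip] with x hx h
    rw [hx.1, hx.2]
    exact h _ _
  · rw [← integral_norm_sq_Lp, L2.inner_def, ← integral_const_mul]
    refine integral_mono_ae (((Lp.memLp _).integrable_norm_pow (by norm_num)).const_mul m)
      (L2.integrable_inner _ _) ?_
    filter_upwards [hsub G H, hmono] with x hx h
    simp only [hx.1, hx.2]
    exact h _ _

theorem aestronglyMeasurable_toEuclideanLin
    {A : EuclideanSpace ℝ (Fin N) → Matrix (Fin N) (Fin N) ℝ}
    (hAm : ∀ i j, AEMeasurable (fun x => A x i j) volume)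
    {G : EuclideanSpace ℝ (Fin N) → EuclideanSpace ℝ (Fin N)} (hG : AEStronglyMeasurable G) :
    AEStronglyMeasurable fun x => Matrix.toEuclideanLin (A x) (G x) := by
  have hGj : ∀ j, AEMeasurable fun x => G x j := fun j =>
    (EuclideanSpace.proj (𝕜 := ℝ) j).continuous.measurable.comp_aemeasurable hG.aemeasurable
  have h : AEMeasurable fun x => (fun i => ∑ j, A x i j * G x j : Fin N → ℝ) := by
    refine aemeasurable_pi_iff.2 fun i => ?_
    exact Finset.aemeasurable_fun_sum _ fun j _ => (hAm i j).mul (hGj j)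
  have h2 : AEMeasurable fun x => WithLp.toLp 2 (fun i => ∑ j, A x i j * G x j : Fin N → ℝ) :=
    (WithLp.measurable_toLp 2 (Fin N → ℝ)).comp_aemeasurable h
  exact h2.aestronglyMeasurable

end Nemytskii

/-! ### The convex set of fields bounded by g. -/

section Constraint

variable {N : ℕ} {g : EuclideanSpace ℝ (Fin N) → ℝ}

/-- The fields in `L²(ℝ^N)^N` with length at most `g`. -/
def boundedFields (g : EuclideanSpace ℝ (Fin N) → ℝ) :
    Set (Lp (EuclideanSpace ℝ (Fin N)) 2 (volume : Measure (EuclideanSpace ℝ (Fin N)))) :=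
  {G | ∀ᵐ x, ‖G x‖ ≤ g x}

theorem isClosed_boundedFields : IsClosed (boundedFields g) := by
  refine IsSeqClosed.isClosed fun u v hu huv => ?_
  obtain ⟨ns, -, hns⟩ := (tendstoInMeasure_of_tendsto_Lp huv).exists_seq_tendsto_ae
  filter_upwards [hns, ae_all_iff.2 hu] with x hx hx'
  exact le_of_tendsto hx.norm (Eventually.of_forall fun n => hx' (ns n))

theorem convex_boundedFields : Convex ℝ (boundedFields g) := by
  intro G hG H hH a b ha hb hab
  filter_upwards [hG, hH, Lp.coeFn_add (a • G) (b • H), Lp.coeFn_smul a G, Lp.coeFn_smul b H]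
    with x h1 h2 h3 h4 h5
  rw [h3, Pi.add_apply, h4, h5, Pi.smul_apply, Pi.smul_apply]
  refine (norm_add_le _ _).trans ?_
  rw [norm_smul, norm_smul, Real.norm_of_nonneg ha, Real.norm_of_nonneg hb]
  calc a * ‖G x‖ + b * ‖H x‖ ≤ a * g x + b * g x := by gcongr
    _ = g x := by rw [← add_mul, hab, one_mul]

theorem zero_mem_boundedFields (hg : ∀ᵐ x, 0 ≤ g x) : 0 ∈ boundedFields g := by
  filter_upwards [hg, Lp.coeFn_zero (EuclideanSpace ℝ (Fin N)) 2
    (volume : Measure (EuclideanSpace ℝ (Fin N)))] with x h1 h2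
  rw [h2]
  simpa using h1

/-- Truncation: the distance of `G` to the bounded fields is at most `‖(|G| - g)⁺‖`. -/
theorem exists_mem_boundedFields_norm_sub_le (hgm : AEStronglyMeasurable g)
    (hg : ∀ᵐ x, 0 < g x)
    (G : Lp (EuclideanSpace ℝ (Fin N)) 2 (volume : Measure (EuclideanSpace ℝ (Fin N)))) :
    ∃ H ∈ boundedFields g, ∀ᵐ x, ‖(G - H) x‖ = max (‖G x‖ - g x) 0 := by
  set h : EuclideanSpace ℝ (Fin N) → EuclideanSpace ℝ (Fin N) :=
    fun x => (min 1 (g x / ‖G x‖)) • G x with hh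
  have hGm := Lp.aestronglyMeasurable G
  have hm : AEStronglyMeasurable h :=
    ((aemeasurable_const.min
      (hgm.aemeasurable.div hGm.norm.aemeasurable)).aestronglyMeasurable).smul hGm
  have hL : MemLp h 2 := by
    refine (Lp.memLp G).mono hm ?_
    filter_upwards [hg] with x hx
    have h1 : 0 ≤ min 1 (g x / ‖G x‖) := le_min zero_le_one (by positivity)
    rw [hh, norm_smul, Real.norm_of_nonneg h1]
    exact mul_le_of_le_one_left (norm_nonneg _) (min_le_left _ _)
  refine ⟨hL.toLp, ?_, ?_⟩
  · filter_upwards [hg, hL.coeFn_toLp] with x hx h2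
    have h1 : 0 ≤ min 1 (g x / ‖G x‖) := le_min zero_le_one (by positivity)
    rw [h2, hh, norm_smul, Real.norm_of_nonneg h1]
    rcases (norm_nonneg (G x)).eq_or_lt with h0 | h0
    · rw [← h0, mul_zero]; exact hx.le
    · calc min 1 (g x / ‖G x‖) * ‖G x‖ ≤ g x / ‖G x‖ * ‖G x‖ := by
            gcongr; exact min_le_right _ _
        _ = g x := by field_simp
  · filter_upwards [hg, hL.coeFn_toLp, Lp.coeFn_sub G hL.toLp] with x hx h2 h3
    rw [h3, Pi.sub_apply, h2, hh]
    have e : G x - (min 1 (g x / ‖G x‖)) • G x = (1 - min 1 (g x / ‖G x‖)) • G x := by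
      rw [sub_smul, one_smul]
    simp only
    rw [e, norm_smul, Real.norm_of_nonneg (sub_nonneg.2 (min_le_left _ _))]
    rcases le_or_gt ‖G x‖ (g x) with h4 | h4
    · rw [max_eq_right (by linarith)]
      rcases (norm_nonneg (G x)).eq_or_lt with h0 | h0
      · rw [← h0, mul_zero]
      · rw [min_eq_left ((one_le_div h0).2 h4)]; simp
    · have h0 : 0 < ‖G x‖ := hx.trans h4
      rw [max_eq_left (by linarith), min_eq_right ((div_le_one h0).2 h4.le)]
      field_simp

end Constraint

/-! ### The matrix and penalty operators. -/

section Operators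

variable {N : ℕ}

theorem exists_matrix_operator (A : EuclideanSpace ℝ (Fin N) → Matrix (Fin N) (Fin N) ℝ)
    (hAm : ∀ i j, AEMeasurable (fun x => A x i j) volume) (aLow aUp : ℝ)
    (hA : ∀ᵐ x : EuclideanSpace ℝ (Fin N), ∀ ξ η : EuclideanSpace ℝ (Fin N),
      aLow * ‖ξ‖ ^ 2 ≤ inner ℝ (Matrix.toEuclideanLin (A x) ξ) ξ ∧
      inner ℝ (Matrix.toEuclideanLin (A x) ξ) η ≤ aUp * ‖ξ‖ * ‖η‖) :
    ∃ T : Lp (EuclideanSpace ℝ (Fin N)) 2 (volume : Measure (EuclideanSpace ℝ (Fin N))) →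
      Lp (EuclideanSpace ℝ (Fin N)) 2 (volume : Measure (EuclideanSpace ℝ (Fin N))),
      (∀ G, T G =ᵐ[volume] fun x => Matrix.toEuclideanLin (A x) (G x)) ∧
      (∀ G H, ‖T G - T H‖ ≤ aUp * ‖G - H‖) ∧
      ∀ G H, aLow * ‖G - H‖ ^ 2 ≤ inner ℝ (T G - T H) (G - H) := by
  refine exists_nemytskii (a := fun x ξ => Matrix.toEuclideanLin (A x) ξ)
    (fun G => aestronglyMeasurable_toEuclideanLin hAm (Lp.aestronglyMeasurable G))
    (Eventually.of_forall fun x => map_zero _) ?_ ?_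
  · filter_upwards [hA] with x hx ξ η
    rw [← map_sub]
    set ζ := Matrix.toEuclideanLin (A x) (ξ - η)
    -- The bilinear bound, tested with the image vector itself, yields the operator bound.
    have h := (hx (ξ - η) ζ).2
    rw [real_inner_self_eq_norm_sq] at h
    rcases (norm_nonneg ζ).eq_or_lt with h0 | h0
    -- The sign of `aUp` is not given; when ξ ≠ η the bound tested with ξ - η shows 0 ≤ aUp‖ξ - η‖.
    · rw [← h0]
      have := (hx (ξ - η) (ξ - η))
      rcases (norm_nonneg (ξ - η)).eq_or_lt with h1 | h1
      · rw [← h1, mul_zero]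
      · have h2 : ζ = 0 := norm_eq_zero.1 h0.symm
        have h3 : inner ℝ ζ (ξ - η) ≤ aUp * ‖ξ - η‖ * ‖ξ - η‖ := this.2
        rw [h2, inner_zero_left] at h3
        exact nonneg_of_mul_nonneg_left h3 h1
    · exact le_of_mul_le_mul_right (by rw [← sq]; exact h) h0
  · filter_upwards [hA] with x hx ξ η
    rw [← map_sub]
    exact (hx (ξ - η) 0).1

theorem exists_penalty_operator {ε : ℝ} (hε : 0 < ε) {g : EuclideanSpace ℝ (Fin N) → ℝ}
    (hgm : AEStronglyMeasurable g) {M : ℝ} (hgM : ∀ᵐ x, g x ≤ M) :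
    ∃ T : Lp (EuclideanSpace ℝ (Fin N)) 2 (volume : Measure (EuclideanSpace ℝ (Fin N))) →
      Lp (EuclideanSpace ℝ (Fin N)) 2 (volume : Measure (EuclideanSpace ℝ (Fin N))),
      (∀ G, T G =ᵐ[volume] fun x => penalty ε (‖G x‖ - g x) • G x) ∧
      (∃ L, ∀ G H, ‖T G - T H‖ ≤ L * ‖G - H‖) ∧
      ∀ G H, 0 * ‖G - H‖ ^ 2 ≤ inner ℝ (T G - T H) (G - H) := by
  obtain ⟨T, h1, h2, h3⟩ := exists_nemytskii (m := 0)
    (L := Real.exp (1 / ε / ε) + Real.exp (1 / ε / ε) / ε * (|M| + 1 / ε))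
    (a := fun x ξ => penalty ε (‖ξ‖ - g x) • ξ)
    (fun G => ((continuous_penalty hε).comp_aestronglyMeasurable
      ((Lp.aestronglyMeasurable G).norm.sub hgm)).smul (Lp.aestronglyMeasurable G))
    (Eventually.of_forall fun x => smul_zero _)
    (by filter_upwards [hgM] with x hx ξ η using norm_penalty_smul_sub_le hε hx ξ η)
    (Eventually.of_forall fun x ξ η => by
      rw [zero_mul]; exact inner_penalty_smul_sub_nonneg hε (g x) ξ η)
  exact ⟨T, h1, ⟨_, h2⟩, h3⟩

end Operators

/-! ### The two problems rewritten in L²(ℝ^N)^N. -/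

section Solutions

variable {N : ℕ} {σ ε : ℝ} {Ω : Set (EuclideanSpace ℝ (Fin N))}
  {A : EuclideanSpace ℝ (Fin N) → Matrix (Fin N) (Fin N) ℝ}
  {f g : EuclideanSpace ℝ (Fin N) → ℝ}
  {F : Lp (EuclideanSpace ℝ (Fin N)) 2 (volume : Measure (EuclideanSpace ℝ (Fin N)))}
  {S T : Lp (EuclideanSpace ℝ (Fin N)) 2 (volume : Measure (EuclideanSpace ℝ (Fin N))) →
    Lp (EuclideanSpace ℝ (Fin N)) 2 (volume : Measure (EuclideanSpace ℝ (Fin N)))}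

theorem isPenalisedSolution_iff
    (hF : ∀ v : SigmaSobolev σ Ω, IntegrableOn (fun x => f x * v.toL2 x) Ω ∧
      ∫ x in Ω, f x * v.toL2 x = inner ℝ F v.grad)
    (hS : ∀ G, S G =ᵐ[volume] fun x => penalty ε (‖G x‖ - g x) • G x)
    (hT : ∀ G, T G =ᵐ[volume] fun x => Matrix.toEuclideanLin (A x) (G x))
    (u : SigmaSobolev σ Ω) :
    IsPenalisedSolution A f g ε u ↔
      ∀ v : SigmaSobolev σ Ω, inner ℝ (S u.grad + T u.grad) v.grad = inner ℝ F v.grad := by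
  refine forall_congr' fun v => ?_
  have e : ∫ x, inner ℝ (penalty ε (‖u.grad x‖ - g x) • u.grad x +
        Matrix.toEuclideanLin (A x) (u.grad x)) (v.grad x) =
      inner ℝ (S u.grad + T u.grad) v.grad := by
    rw [L2.inner_def]
    refine integral_congr_ae ?_
    filter_upwards [hS u.grad, hT u.grad, Lp.coeFn_add (S u.grad) (T u.grad)] with x h1 h2 h3
    rw [h3, Pi.add_apply, h1, h2]
  rw [e, (hF v).2]
  exact and_iff_right (hF v).1

theorem isConstrainedSolution_iff
    (hF : ∀ v : SigmaSobolev σ Ω, IntegrableOn (fun x => f x * v.toL2 x) Ω ∧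
      ∫ x in Ω, f x * v.toL2 x = inner ℝ F v.grad)
    (hT : ∀ G, T G =ᵐ[volume] fun x => Matrix.toEuclideanLin (A x) (G x))
    (u : SigmaSobolev σ Ω) :
    IsConstrainedSolution A f g u ↔ u.grad ∈ boundedFields g ∧
      ∀ v : SigmaSobolev σ Ω, v.grad ∈ boundedFields g →
        0 ≤ inner ℝ (T u.grad - F) (v.grad - u.grad) := by
  refine and_congr Iff.rfl (forall_congr' fun v => forall_congr' fun _ => ?_)
  have e : ∫ x, inner ℝ (Matrix.toEuclideanLin (A x) (u.grad x)) ((v - u).grad x) =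
      inner ℝ (T u.grad) (v - u).grad := by
    rw [L2.inner_def]
    refine integral_congr_ae ?_
    filter_upwards [hT u.grad] with x h1
    rw [h1]
  rw [e, (hF (v - u)).2, inner_sub_left, sub_nonneg, ← map_sub]
  exact and_iff_right (hF (v - u)).1

theorem inner_penalty_operator_sub_nonneg (hε : 0 < ε)
    (hS : ∀ G, S G =ᵐ[volume] fun x => penalty ε (‖G x‖ - g x) • G x)
    (G : Lp (EuclideanSpace ℝ (Fin N)) 2 (volume : Measure (EuclideanSpace ℝ (Fin N))))
    {H : Lp (EuclideanSpace ℝ (Fin N)) 2 (volume : Measure (EuclideanSpace ℝ (Fin N)))}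
    (hH : H ∈ boundedFields g) : 0 ≤ inner ℝ (S G) (G - H) := by
  rw [L2.inner_def]
  refine integral_nonneg_of_ae ?_
  filter_upwards [hS G, Lp.coeFn_sub G H, hH] with x h1 h2 h3
  rw [h1, h2]
  exact inner_penalty_smul_sub_nonneg_of_norm_le hε h3

/-- The penalty term controls the distance to the fields bounded by `g`. -/
theorem exists_mem_boundedFields_norm_sub_sq_le (hε : 0 < ε) (hε1 : ε < 1)
    (hgm : AEStronglyMeasurable g) {ν : ℝ} (hν : 0 < ν) (hgν : ∀ᵐ x, ν ≤ g x)
    (hS : ∀ G, S G =ᵐ[volume] fun x => penalty ε (‖G x‖ - g x) • G x)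
    (G : Lp (EuclideanSpace ℝ (Fin N)) 2 (volume : Measure (EuclideanSpace ℝ (Fin N)))) :
    ∃ H ∈ boundedFields g, ‖G - H‖ ^ 2 ≤ ε * (1 + 1 / ν) * inner ℝ (S G) G := by
  obtain ⟨H, hH, hGH⟩ := exists_mem_boundedFields_norm_sub_le hgm
    (hgν.mono fun x hx => hν.trans_le hx) G
  refine ⟨H, hH, ?_⟩
  rw [← integral_norm_sq_Lp, L2.inner_def, ← integral_const_mul]
  refine integral_mono_of_nonneg (Eventually.of_forall fun x => by positivity)
    ((L2.integrable_inner (S G) G).const_mul _) ?_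
  filter_upwards [hGH, hS G, hgν] with x h1 h2 h3
  simp only [h1, h2, inner_smul_left, real_inner_self_eq_norm_sq]
  exact sq_posPart_le_penalty hε hε1 hν h3

end Solutions

/-! ### Existence, uniqueness and convergence. -/

theorem mainTheorem4 (N : ℕ) (hN : 1 ≤ N) (σ : ℝ) (hσ0 : 0 < σ) (hσ1 : σ < 1)
    (Ω : Set (EuclideanSpace ℝ (Fin N))) (hΩ : IsOpen Ω) (hΩb : Bornology.IsBounded Ω)
    (A : EuclideanSpace ℝ (Fin N) → Matrix (Fin N) (Fin N) ℝ)
    (hAm : ∀ i j, AEMeasurable (fun x => A x i j) volume)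
    (aLow aUp : ℝ) (haLow : 0 < aLow) (haUp : 0 < aUp)
    (hA : ∀ᵐ x : EuclideanSpace ℝ (Fin N), ∀ ξ η : EuclideanSpace ℝ (Fin N),
      aLow * ‖ξ‖ ^ 2 ≤ inner ℝ (Matrix.toEuclideanLin (A x) ξ) ξ ∧
      inner ℝ (Matrix.toEuclideanLin (A x) ξ) η ≤ aUp * ‖ξ‖ * ‖η‖)
    (ν : ℝ) (hν : 0 < ν) (g : EuclideanSpace ℝ (Fin N) → ℝ) (hg : MemLp g ∞ volume)
    (hgν : ∀ᵐ x, ν ≤ g x)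
    (p : ℝ≥0∞) (hp : IsTwoSharp N σ p)
    (f : EuclideanSpace ℝ (Fin N) → ℝ) (hf : MemLp f p (volume.restrict Ω)) :
    (∀ ε ∈ Ioo (0 : ℝ) 1, ∃! w : SigmaSobolev σ Ω, IsPenalisedSolution A f g ε w) ∧
    (∃! u : SigmaSobolev σ Ω, IsConstrainedSolution A f g u) ∧
    ∀ (uε : ℝ → SigmaSobolev σ Ω) (u : SigmaSobolev σ Ω),
      (∀ ε ∈ Ioo (0 : ℝ) 1, IsPenalisedSolution A f g ε (uε ε)) →
      IsConstrainedSolution A f g u →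
      Tendsto (fun ε => toWeakSpace ℝ (SigmaSobolev σ Ω) (uε ε)) (𝓝[>] 0)
        (𝓝 (toWeakSpace ℝ (SigmaSobolev σ Ω) u)) := by
  obtain ⟨F, hF⟩ := exists_inner_grad_eq_setIntegral hN hσ0 hσ1 hΩb hp hf
  obtain ⟨T, hT, hTlip, hTmono⟩ := exists_matrix_operator A hAm aLow aUp hA
  have hgm : AEStronglyMeasurable g := hg.1
  obtain ⟨M, hgM⟩ : ∃ M : ℝ, ∀ᵐ x, g x ≤ M := by
    refine ⟨(eLpNormEssSup g volume).toReal, ?_⟩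
    have hfin : eLpNormEssSup g volume ≠ ⊤ := by
      have h := hg.2
      rw [eLpNorm_exponent_top] at h
      exact h.ne
    filter_upwards [enorm_ae_le_eLpNormEssSup g volume] with x hx
    have h := ENNReal.toReal_mono hfin hx
    rw [toReal_enorm] at h
    exact (le_abs_self _).trans h
  have hinj : Function.Injective (SigmaSobolev.grad : SigmaSobolev σ Ω →ₗ[ℝ] _) :=
    SigmaSobolev.grad_injective hN hσ0 hσ1 hΩb
  set X := LinearMap.range (SigmaSobolev.grad : SigmaSobolev σ Ω →ₗ[ℝ] _) with hX
  have hXc : IsClosed (X : Set (Lp (EuclideanSpace ℝ (Fin N)) 2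
      (volume : Measure (EuclideanSpace ℝ (Fin N))))) :=
    SigmaSobolev.isClosed_range_grad hN hσ0 hσ1 hΩ hΩb
  have hT0 : T 0 = 0 := by
    refine Lp.ext ?_
    filter_upwards [hT 0, Lp.coeFn_zero (EuclideanSpace ℝ (Fin N)) 2
      (volume : Measure (EuclideanSpace ℝ (Fin N)))] with x h1 h2
    rw [h1, h2, Pi.zero_apply, map_zero]
  have eq_of_le : ∀ {a b : SigmaSobolev σ Ω},
      inner ℝ (T a.grad - T b.grad) (a.grad - b.grad) ≤ 0 → a = b := by
    intro a b hab
    have h := (hTmono a.grad b.grad).trans hab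
    have h1 : ‖a.grad - b.grad‖ ^ 2 = 0 :=
      le_antisymm (nonpos_of_mul_nonpos_right h haLow) (sq_nonneg _)
    exact hinj (sub_eq_zero.1 (norm_eq_zero.1 (pow_eq_zero_iff two_ne_zero |>.1 h1)))
  refine ⟨?_, ?_, ?_⟩
  · rintro ε ⟨hε, -⟩
    obtain ⟨S, hS, ⟨L, hSlip⟩, hSmono⟩ := exists_penalty_operator hε hgm hgM
    have hmono : ∀ G H, aLow * ‖G - H‖ ^ 2 ≤
        inner ℝ ((S G + T G - F) - (S H + T H - F)) (G - H) := by
      intro G H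
      rw [show (S G + T G - F) - (S H + T H - F) = (S G - S H) + (T G - T H) by abel,
        inner_add_left]
      linarith [hTmono G H, hSmono G H]
    have hlip : ∀ G H, ‖(S G + T G - F) - (S H + T H - F)‖ ≤ (L + aUp) * ‖G - H‖ := by
      intro G H
      rw [show (S G + T G - F) - (S H + T H - F) = (S G - S H) + (T G - T H) by abel]
      linarith [norm_add_le (S G - S H) (T G - T H), hTlip G H, hSlip G H]
    obtain ⟨_, ⟨w, rfl⟩, hw⟩ := exists_variational_inequality ⟨0, X.zero_mem⟩ hXc X.convex haLow
      hmono hlip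
    refine ⟨w, ?_, ?_⟩
    · refine (isPenalisedSolution_iff hF hS hT w).2 fun v => ?_
      -- On a subspace, the variational inequality at w ± v becomes an equation.
      have h1 := hw (w.grad + v.grad) ⟨w + v, map_add _ _ _⟩
      have h2 := hw (w.grad - v.grad) ⟨w - v, map_sub _ _ _⟩
      rw [add_sub_cancel_left, inner_sub_left] at h1
      rw [sub_sub_cancel_left, inner_neg_right, inner_sub_left] at h2
      linarith
    · intro z hz
      have h1 := (isPenalisedSolution_iff hF hS hT z).1 hz (z - w)
      rw [map_sub] at h1
      have h2 := hw z.grad ⟨z, rfl⟩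
      rw [inner_sub_left] at h2
      refine eq_of_le ?_
      have h3 := hSmono z.grad w.grad
      rw [inner_sub_left] at h3 ⊢
      rw [inner_add_left] at h1 h2
      linarith
  · have hlip : ∀ G H, ‖(T G - F) - (T H - F)‖ ≤ aUp * ‖G - H‖ := by
      intro G H
      rw [sub_sub_sub_cancel_right]
      exact hTlip G H
    have hmono : ∀ G H, aLow * ‖G - H‖ ^ 2 ≤ inner ℝ ((T G - F) - (T H - F)) (G - H) := by
      intro G H
      rw [sub_sub_sub_cancel_right]
      exact hTmono G H
    have hne : ((X : Set (Lp (EuclideanSpace ℝ (Fin N)) 2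
        (volume : Measure (EuclideanSpace ℝ (Fin N))))) ∩ boundedFields g).Nonempty :=
      ⟨0, X.zero_mem, zero_mem_boundedFields (hgν.mono fun x hx => hν.le.trans hx)⟩
    obtain ⟨_, ⟨⟨u, rfl⟩, hu⟩, hu'⟩ := exists_variational_inequality hne
      (hXc.inter (isClosed_boundedFields (g := g))) (X.convex.inter convex_boundedFields) haLow
      hmono hlip
    refine ⟨u, (isConstrainedSolution_iff hF hT u).2 ⟨hu, fun v hv => hu' v.grad ⟨⟨v, rfl⟩, hv⟩⟩,
      fun z hz => ?_⟩
    obtain ⟨hz1, hz2⟩ := (isConstrainedSolution_iff hF hT z).1 hz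
    have h1 := hz2 u hu
    have h2 := hu' z.grad ⟨⟨z, rfl⟩, hz1⟩
    refine eq_of_le ?_
    have h3 : inner ℝ (T z.grad - F) (u.grad - z.grad) =
        -inner ℝ (T z.grad - F) (z.grad - u.grad) := by
      rw [← inner_neg_right, neg_sub]
    rw [inner_sub_left] at h2 h3 ⊢
    rw [inner_sub_left (T z.grad) F (z.grad - u.grad)] at h3
    rw [inner_sub_left] at h1
    linarith
  · intro uε u huε hu
    obtain ⟨hu1, hu2⟩ := (isConstrainedSolution_iff hF hT u).1 hu
    -- Norm convergence is proved, which implies the weak one.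
    suffices h : Tendsto uε (𝓝[>] 0) (𝓝 u) from
      ((toWeakSpaceCLM ℝ (SigmaSobolev σ Ω)).continuous.tendsto u).comp h
    set R := ‖F‖ / aLow with hR
    have hR0 : 0 ≤ R := by positivity
    refine Metric.tendsto_nhds.2 fun r hr => ?_
    -- The tolerance a_* r² is what strong monotonicity converts into ‖G - U‖ < r.
    obtain ⟨δ, hδ, hδ'⟩ := exists_pos_inner_gt_of_mem_cthickening
      (isClosed_boundedFields (g := g)) convex_boundedFields hXc X.convex
      (w := T u.grad - F) (u := u.grad) (by
        rintro _ ⟨⟨v, rfl⟩, hv⟩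
        exact hu2 v hv) R (η := aLow * r ^ 2) (by positivity)
    have hsmall : Tendsto (fun ε : ℝ => ε * (1 + 1 / ν) * (‖F‖ * R)) (𝓝[>] 0) (𝓝 0) := by
      have h : Tendsto (fun ε : ℝ => ε * (1 + 1 / ν) * (‖F‖ * R)) (𝓝 0)
          (𝓝 (0 * (1 + 1 / ν) * (‖F‖ * R))) := Continuous.tendsto (by fun_prop) 0
      rw [zero_mul, zero_mul] at h
      exact h.mono_left nhdsWithin_le_nhds
    filter_upwards [hsmall.eventually_lt_const (pow_pos hδ 2),
      Ioo_mem_nhdsGT (zero_lt_one (α := ℝ))] with ε hεδ hε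
    obtain ⟨S, hS, -, -⟩ := exists_penalty_operator hε.1 hgm hgM
    have hsol := (isPenalisedSolution_iff hF hS hT (uε ε)).1 (huε ε hε)
    set G := (uε ε).grad with hG
    have hS0 : 0 ≤ inner ℝ (S G) G := by
      have h := inner_penalty_operator_sub_nonneg hε.1 hS G
        (zero_mem_boundedFields (hgν.mono fun x hx => hν.le.trans hx))
      rwa [sub_zero] at h
    have hTG : aLow * ‖G‖ ^ 2 ≤ inner ℝ (T G) G := by
      have h := hTmono G 0
      rwa [hT0, sub_zero, sub_zero] at h
    -- The equation tested with u^ε itself.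
    have hFG : inner ℝ (S G) G + inner ℝ (T G) G ≤ ‖F‖ * ‖G‖ := by
      rw [← inner_add_left, hsol (uε ε)]
      exact real_inner_le_norm F G
    have hGR : ‖G‖ ≤ R := by
      rw [hR, le_div_iff₀ haLow]
      rcases (norm_nonneg G).eq_or_lt with h0 | h0
      · rw [← h0, zero_mul]
        positivity
      · refine le_of_mul_le_mul_right ?_ h0
        nlinarith
    obtain ⟨H, hH, hGH⟩ := exists_mem_boundedFields_norm_sub_sq_le hε.1 hε.2 hgm hν hgν hS G
    have hSR : inner ℝ (S G) G ≤ ‖F‖ * R := by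
      have h := mul_le_mul_of_nonneg_left hGR (norm_nonneg F)
      have h' : 0 ≤ aLow * ‖G‖ ^ 2 := by positivity
      linarith
    have hdist : dist G H ≤ δ := by
      rw [dist_eq_norm]
      refine le_of_sq_le_sq ?_ hδ.le
      have hε' := hε.1
      exact (hGH.trans (mul_le_mul_of_nonneg_left hSR (by positivity))).trans hεδ.le
    have h1 := hδ' G ⟨uε ε, rfl⟩ hGR (Metric.mem_cthickening_of_dist_le _ _ _ _ hH hdist)
    have h2 := inner_penalty_operator_sub_nonneg hε.1 hS G hu1
    have h3 := hsol (uε ε - u)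
    rw [map_sub, ← hG, inner_add_left] at h3
    have h4 := hTmono G u.grad
    rw [inner_sub_left] at h1 h4
    -- Combining the tests: a_*‖G - U‖² ≤ ⟨T G - T U, G - U⟩ ≤ -⟨T U - F, G - U⟩ < a_* r², where the
    -- middle step drops ⟨S G, G - U⟩ ≥ 0.
    have h5 : ‖G - u.grad‖ ^ 2 < r ^ 2 := by
      refine lt_of_mul_lt_mul_left ?_ haLow.le
      linarith
    rw [dist_eq_norm, SigmaSobolev.norm_eq, map_sub]
    exact lt_of_pow_lt_pow_left₀ 2 hr.le h5
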